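/- **Theorem.** All logarithms $\lg$ are to base $2$, and $h_2(x) = -x\lg x-(1-x)\lg(1-x)$ (with $0\lg 0=0$). A *biclique* of a graph $G$ is a pair $(L,R)$ of nonempty sets of vertices such that every vertex of $L$ is adjacent to every vertex of $R$. A *biclique partition* of $G$ is a finite list of bicliques of $G$ such that every edge of $G$ joins the two sides of exactly one member of the list. Let $\mathrm{lbp}(G)$ be the least $k$ such that $G$ has a biclique partition in which every vertex lies in at most $k$ bicliques. For $\delta\in[0,\tfrac12]$ let $\mathrm{lbp}(n,\delta)$ be the maximum of $\mathrm{lbp}(G)$ over all $n$-vertex graphs $G$ with $$\min\Big\{\tfrac{d(v)}{n-1},\,1-\tfrac{d(v)}{n-1}\Big\}\le\delta\quad\text{for every vertex } v. \qquad (*)$$ Let $\delta=\delta(n)\in[0,\tfrac12]$ with $1/\delta(n)=n^{o(1)}$. Then, as $n\to\infty$, $$\mathrm{lbp}(n,\delta)\le\Big(\tfrac12+o(1)\Big)\,h_2(\delta)\,\frac{n}{\lg n}.$$ Furthermore, there is a randomized algorithm (one fixed program for a word RAM whose words have $\Theta(\lg n)$ bits, whose memory is initially zero outside the input, and which can draw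 independent fair random bits) and a constant $T$ such that, for every such $\delta$, the following holds. Given an $n$-vertex graph $G$ that satisfies $(*)$ with $\delta=\delta(n)$ and has $m$ edges, represented by adjacency lists, the algorithm, with probability at least $1-o(1)$, halts within $T\,(n+m)$ steps and outputs a biclique partition of $G$ in which every vertex lies in at most $(\tfrac12+o(1))\,h_2(\delta)\,\frac{n}{\lg n}$ bicliques. Both $o(1)$ terms depend only on $n$ and the sequence $\delta$, not on $G$. (In particular the time is $O(m)$ for graphs without isolated vertices.) -/

import Mathlib

open Filter Topology MeasureTheory

/-! Binary entropy, biclique partitions and the local biclique partition number. -/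

/-- The binary entropy function `-x lg x - (1 - x) lg (1 - x)`, with logarithms in base 2. -/
noncomputable def binEntropyTwo (x : ℝ) : ℝ :=
  -x * Real.logb 2 x - (1 - x) * Real.logb 2 (1 - x)

/-- `B = (L, R)` is a biclique of `G`: both sides are nonempty and every vertex of `L` is adjacent
to every vertex of `R` (so that `L` and `R` are disjoint). -/
def IsBiclique {V : Type*} (G : SimpleGraph V) (B : Finset V × Finset V) : Prop :=
  B.1.Nonempty ∧ B.2.Nonempty ∧ ∀ u ∈ B.1, ∀ v ∈ B.2, G.Adj u v

/-- The biclique `B = (L, R)` contains the edge `{u, v}`. -/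
def BicliqueCovers {V : Type*} (B : Finset V × Finset V) (u v : V) : Prop :=
  (u ∈ B.1 ∧ v ∈ B.2) ∨ (v ∈ B.1 ∧ u ∈ B.2)

/-- The list `C` is a biclique partition of `G`: all members are bicliques of `G`, and each edge of
`G` is contained in exactly one member. -/
def IsBicliquePartition {V : Type*} (G : SimpleGraph V) (C : List (Finset V × Finset V)) : Prop :=
  (∀ B ∈ C, IsBiclique G B) ∧
    ∀ u v, G.Adj u v → ∃! i : Fin C.length, BicliqueCovers (C.get i) u v

/-- The number of members of `C` that contain the vertex `v`. -/
def bicliqueLoad {V : Type*} [DecidableEq V] (C : List (Finset V × Finset V)) (v : V) : ℕ :=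
  C.countP fun B => decide (v ∈ B.1 ∨ v ∈ B.2)

/-- The local biclique partition number of `G`: the least `k` such that `G` has a biclique
partition in which each vertex is in at most `k` bicliques. -/
noncomputable def lbp {V : Type*} [DecidableEq V] (G : SimpleGraph V) : ℕ :=
  sInf {k | ∃ C, IsBicliquePartition G C ∧ ∀ v, bicliqueLoad C v ≤ k}

/-- Each vertex has relative degree at most `δ` or relative co-degree at most `δ`. -/
def DegreeBound {n : ℕ} (G : SimpleGraph (Fin n)) (δ : ℝ) : Prop :=
  ∀ v, min (((G.neighborSet v).ncard : ℝ) / ((n : ℝ) - 1))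
    (1 - ((G.neighborSet v).ncard : ℝ) / ((n : ℝ) - 1)) ≤ δ

open Classical in
/-- The maximum of `lbp G` over the `n`-vertex graphs `G` with `DegreeBound G δ`. -/
noncomputable def lbpMax (n : ℕ) (δ : ℝ) : ℕ :=
  (Finset.univ.filter fun G : SimpleGraph (Fin n) => DegreeBound G δ).sup fun G => lbp G

/-- `1 / δ n = n ^ o(1)`. -/
def InvSubpolynomial (δ : ℕ → ℝ) : Prop :=
  ∃ e : ℕ → ℝ, Tendsto e atTop (𝓝 0) ∧ ∀ᶠ n : ℕ in atTop, (δ n)⁻¹ = (n : ℝ) ^ e n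

/-! Randomized word RAM: a program is a fixed finite term of a structured imperative language. It
refers to finitely many registers and finitely many memory banks (each a random access array), all
of whose cells hold words of `w` bits. Each operation takes one step. -/

namespace WordRAM

/-- Binary operations on words. -/
inductive Op where
  | add | sub | mul | div | mod | lt | eq

/-- Value of an operation on words of `w` bits (results are reduced modulo `2 ^ w`; subtraction
stops at `0`, division by `0` gives `0`, comparisons give `0` or `1`). -/
def Op.eval (w : ℕ) : Op → ℕ → ℕ → ℕ
  | .add, a, b => (a + b) % 2 ^ w
  | .sub, a, b => (a - b) % 2 ^ w
  | .mul, a, b => (a * b) % 2 ^ w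
  | .div, a, b => (a / b) % 2 ^ w
  | .mod, a, b => (a % b) % 2 ^ w
  | .lt, a, b => (if a < b then 1 else 0) % 2 ^ w
  | .eq, a, b => (if a = b then 1 else 0) % 2 ^ w

/-- Expressions: constants, registers, operations, and reads `load a i` of cell `i` of bank `a`. -/
inductive Expr where
  | const (k : ℕ)
  | reg (x : ℕ)
  | op (o : Op) (e f : Expr)
  | load (a : ℕ) (i : Expr)

/-- Programs. `assign x e` sets register `x`, `store a i e` writes cell `i` of bank `a`, `flip x`
puts a fair random bit in register `x`, and `emit e` appends a word to the output. -/
inductive Prog where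
  | skip
  | assign (x : ℕ) (e : Expr)
  | store (a : ℕ) (i e : Expr)
  | flip (x : ℕ)
  | emit (e : Expr)
  | seq (c d : Prog)
  | ite (e : Expr) (c d : Prog)
  | while (e : Expr) (c : Prog)

/-- Machine states: registers, memory banks, output so far, number of random bits used so far. -/
structure State where
  reg : ℕ → ℕ
  mem : ℕ → ℕ → ℕ
  out : List ℕ
  flips : ℕ

/-- Value of an expression in a state. -/
def Expr.eval (w : ℕ) (s : State) : Expr → ℕ
  | .const k => k % 2 ^ w
  | .reg x => s.reg x
  | .op o e f => o.eval w (e.eval w s) (f.eval w s)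
  | .load a i => s.mem a (i.eval w s)

/-- Number of steps used to evaluate an expression. -/
def Expr.cost : Expr → ℕ
  | .const _ => 1
  | .reg _ => 1
  | .op _ e f => e.cost + f.cost + 1
  | .load _ i => i.cost + 1

/-- `Exec w ω c s t s'`: with `w`-bit words and random bits `ω`, program `c` started in state `s`
halts after exactly `t` steps in state `s'`. -/
inductive Exec (w : ℕ) (ω : ℕ → Bool) : Prog → State → ℕ → State → Prop where
  | skip (s : State) : Exec w ω .skip s 1 s
  | assign (x : ℕ) (e : Expr) (s : State) :
      Exec w ω (.assign x e) s (e.cost + 1)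
        { s with reg := Function.update s.reg x (e.eval w s) }
  | store (a : ℕ) (i e : Expr) (s : State) :
      Exec w ω (.store a i e) s (i.cost + e.cost + 1)
        { s with mem := Function.update s.mem a
                          (Function.update (s.mem a) (i.eval w s) (e.eval w s)) }
  | flip (x : ℕ) (s : State) :
      Exec w ω (.flip x) s 1
        { s with reg := Function.update s.reg x ((if ω s.flips then 1 else 0) % 2 ^ w)
                 flips := s.flips + 1 }
  | emit (e : Expr) (s : State) :
      Exec w ω (.emit e) s (e.cost + 1) { s with out := s.out ++ [e.eval w s] }
  | seq {c d : Prog} {s s' s'' : State} {t t' : ℕ} (hc : Exec w ω c s t s')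
      (hd : Exec w ω d s' t' s'') : Exec w ω (.seq c d) s (t + t') s''
  | iteTrue {e : Expr} {c d : Prog} {s s' : State} {t : ℕ} (he : e.eval w s ≠ 0)
      (hc : Exec w ω c s t s') : Exec w ω (.ite e c d) s (e.cost + 1 + t) s'
  | iteFalse {e : Expr} {c d : Prog} {s s' : State} {t : ℕ} (he : e.eval w s = 0)
      (hd : Exec w ω d s t s') : Exec w ω (.ite e c d) s (e.cost + 1 + t) s'
  | whileTrue {e : Expr} {c : Prog} {s s' s'' : State} {t t' : ℕ} (he : e.eval w s ≠ 0)
      (hc : Exec w ω c s t s') (hr : Exec w ω (.while e c) s' t' s'') :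
      Exec w ω (.while e c) s (e.cost + 1 + t + t') s''
  | whileFalse {e : Expr} {c : Prog} {s : State} (he : e.eval w s = 0) :
      Exec w ω (.while e c) s (e.cost + 1) s

/-- The law of an infinite sequence of independent fair random bits. -/
noncomputable def coins : Measure (ℕ → Bool) :=
  Measure.infinitePi fun _ : ℕ => (PMF.uniformOfFintype Bool).toMeasure

/-- Word length for inputs with `n` vertices: `κ` times the number of binary digits of `n`. -/
def wordLength (κ n : ℕ) : ℕ := κ * Nat.size n

end WordRAM

/-! Input and output format. -/

/-- `adj v` lists the neighbours of `v` in `G`, once each, in an arbitrary order. -/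
def IsAdjacencyList {n : ℕ} (G : SimpleGraph (Fin n)) (adj : Fin n → List (Fin n)) : Prop :=
  ∀ v, (adj v).Nodup ∧ ∀ u, u ∈ adj v ↔ G.Adj v u

/-- Initial state: register `0` holds `n`; bank `1` holds the lists `adj 0, …, adj (n - 1)`, one
after the other; cell `v ≤ n` of bank `0` holds the total length of the lists before `adj v`, the
place in bank `1` where `adj v` begins. All other registers and cells hold `0`. -/
def adjacencyInput {n : ℕ} (adj : Fin n → List (Fin n)) : WordRAM.State where
  reg x := if x = 0 then n else 0
  mem a i :=
    if a = 0 then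
      if i ≤ n then ((List.ofFn adj).take i).flatten.length else 0
    else if a = 1 then ((List.ofFn adj).flatten.map Fin.val).getD i 0
    else 0
  out := []
  flips := 0

/-- Output code of a list of pairs of vertex lists: for each pair `(L, R)`, the length of `L`, the
members of `L`, the length of `R`, the members of `R`. -/
def bicliqueCode {n : ℕ} (Q : List (List (Fin n) × List (Fin n))) : List ℕ :=
  Q.flatMap fun B =>
    (B.1.length :: B.1.map Fin.val) ++ (B.2.length :: B.2.map Fin.val)

/-- The word list `out` describes the list `C` of pairs of vertex sets: it is the output code of
`C` with the members of each set listed once each. -/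
def Describes {n : ℕ} (out : List ℕ) (C : List (Finset (Fin n) × Finset (Fin n))) : Prop :=
  ∃ Q : List (List (Fin n) × List (Fin n)),
    (∀ B ∈ Q, B.1.Nodup ∧ B.2.Nodup) ∧
      C = Q.map (fun B => (B.1.toFinset, B.2.toFinset)) ∧ out = bicliqueCode Q

/-! Give every vertex a key in `[0, S)` with `S = 2 * H`, arrange the vertices on a circle in the
order of their keys, and make an edge the responsibility of the end from which the other end lies
ahead by at most half a turn, measured in keys (`Handles`). Exactly one end qualifies (`event_xor`).
Positions are counted over two turns, so the neighbours for which `b` is responsible form an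
increasing list of positions, its events. This list is cut greedily into pieces: a piece with `j`
members that spans `l` consecutive positions must satisfy `l ≤ K` and `l.choose j ≤ M`. For every
vertex list `L` that occurs as a piece there is one biclique `(L, R)`, where `R` consists of all
vertices having `L` as a piece. An edge has one responsible end and lies in one piece of that end,
so these bicliques partition the edges (`IsGrouping.isBicliquePartition`).

On the left side a vertex lies in at most `K ^ 3 * M` bicliques, because a piece through it is
determined by an offset, a span, a size and one of at most `M` subsets
(`card_pieces_containing_le`). The choice `M = n / K ^ 5` makes this at most `n / K ^ 2`, which is
negligible. On the right side the load is the number of its own pieces. Put `k = (1 - o(1)) lg n /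
h₂(δ)`. A typical window of `k` positions meets either the neighbourhood or its complement in about
`δ k` vertices, and the number of such subsets is about `2 ^ (k h₂(δ)) = n ^ (1 - o(1)) ≤ M`
(`LargeEnough.choose_le`). So typical pieces may span about `k` positions, and half a turn of about
`n / 2` positions needs `(1/2) n / k` of them. The half turn is the source of the constant `1/2`.

The deviations are controlled by dividing the keys into classes with about `k` expected vertices. A
potential argument (`length_vertexPieces_le`) bounds the number of pieces by the number of classes
in half a turn plus an excess that counts overfull classes. For random keys the mean excess per
class is exponentially small in `δ k` (`sum_card_filter_div_le`), and the bounded differences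
inequality with a union bound over the vertices gives concentration
(`coins_length_vertexPieces_le`). The hypothesis `1 / δ = n ^ o(1)` yields `h₂(δ) = o(δ lg n)`, that
is, `δ k → ∞`.

Two regimes need no probability. If the graph has few edges, drawing random keys would take too
long, so degrees serve as keys; with `H` at least every key, each edge belongs to its end of smaller
degree, and the square of the number of pieces of a vertex is at most the degree sum
(`sq_length_vertexPieces_le`). If `K ^ 5` exceeds `n ^ e`, then the smaller one of degree and
co-degree is `o(n / lg n)` throughout, and a single class suffices (`length_vertexPieces_le_card`).

The program stores pieces as nodes of a trie whose child pointers sit in a zero-initialised array,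
so that equal pieces meet in the same node. It is correct and takes `O(n + m)` steps for every
outcome of the coins (`WordRAM.runs_bicliqueProg`); only the loads are random. The bound on `lbp`
follows because an event of positive probability is nonempty. All estimates are made for a fixed
precision `e` and turned into `o(1)` terms by a diagonal argument. -/

namespace WordRAM

/-- Program `c`, started in `s`, halts after some number `t` of steps in a state `s'` with
`Q t s'`. -/
def Runs (w : ℕ) (ω : ℕ → Bool) (c : Prog) (s : State) (Q : ℕ → State → Prop) : Prop :=
  ∃ t s', Exec w ω c s t s' ∧ Q t s'

/-! ### Proof rules for programs and for word arithmetic without overflow. -/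

section Rules

variable {w : ℕ} {ω : ℕ → Bool}

theorem Runs.mono {c : Prog} {s : State} {Q R : ℕ → State → Prop} (h : Runs w ω c s Q)
    (hQR : ∀ t s', Q t s' → R t s') : Runs w ω c s R := by
  obtain ⟨t, s', he, hq⟩ := h
  exact ⟨t, s', he, hQR _ _ hq⟩

theorem runs_skip {s : State} {Q : ℕ → State → Prop} : Runs w ω .skip s Q ↔ Q 1 s := by
  constructor
  · rintro ⟨t, s', he, hq⟩
    cases he
    exact hq
  · exact fun h => ⟨_, _, .skip s, h⟩

theorem runs_assign {x : ℕ} {e : Expr} {s : State} {Q : ℕ → State → Prop} :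
    Runs w ω (.assign x e) s Q ↔
      Q (e.cost + 1) { s with reg := Function.update s.reg x (e.eval w s) } := by
  constructor
  · rintro ⟨t, s', he, hq⟩
    cases he
    exact hq
  · exact fun h => ⟨_, _, .assign x e s, h⟩

theorem runs_store {a : ℕ} {i e : Expr} {s : State} {Q : ℕ → State → Prop} :
    Runs w ω (.store a i e) s Q ↔
      Q (i.cost + e.cost + 1)
        { s with mem := Function.update s.mem a
                          (Function.update (s.mem a) (i.eval w s) (e.eval w s)) } := by
  constructor
  · rintro ⟨t, s', he, hq⟩
    cases he
    exact hq
  · exact fun h => ⟨_, _, .store a i e s, h⟩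

theorem runs_flip {x : ℕ} {s : State} {Q : ℕ → State → Prop} :
    Runs w ω (.flip x) s Q ↔
      Q 1 { s with reg := Function.update s.reg x ((if ω s.flips then 1 else 0) % 2 ^ w)
                   flips := s.flips + 1 } := by
  constructor
  · rintro ⟨t, s', he, hq⟩
    cases he
    exact hq
  · exact fun h => ⟨_, _, .flip x s, h⟩

theorem runs_emit {e : Expr} {s : State} {Q : ℕ → State → Prop} :
    Runs w ω (.emit e) s Q ↔ Q (e.cost + 1) { s with out := s.out ++ [e.eval w s] } := by
  constructor
  · rintro ⟨t, s', he, hq⟩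
    cases he
    exact hq
  · exact fun h => ⟨_, _, .emit e s, h⟩

theorem runs_seq {c d : Prog} {s : State} {Q : ℕ → State → Prop} :
    Runs w ω (.seq c d) s Q ↔
      Runs w ω c s fun t s' => Runs w ω d s' fun t' s'' => Q (t + t') s'' := by
  constructor
  · rintro ⟨t, s', he, hq⟩
    cases he with
    | seq hc hd => exact ⟨_, _, hc, _, _, hd, hq⟩
  · rintro ⟨t, s', hc, t', s'', hd, hq⟩
    exact ⟨_, _, .seq hc hd, hq⟩

theorem runs_ite {e : Expr} {c d : Prog} {s : State} {Q : ℕ → State → Prop} :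
    Runs w ω (.ite e c d) s Q ↔
      if e.eval w s ≠ 0 then Runs w ω c s fun t s' => Q (e.cost + 1 + t) s'
      else Runs w ω d s fun t s' => Q (e.cost + 1 + t) s' := by
  constructor
  · rintro ⟨t, s', he, hq⟩
    cases he with
    | iteTrue h hc => rw [if_pos h]; exact ⟨_, _, hc, hq⟩
    | iteFalse h hd => rw [if_neg (by simp [h])]; exact ⟨_, _, hd, hq⟩
  · intro h
    split_ifs at h with hc
    · obtain ⟨t, s', hx, hq⟩ := h
      exact ⟨_, _, .iteTrue hc hx, hq⟩
    · obtain ⟨t, s', hx, hq⟩ := h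
      exact ⟨_, _, .iteFalse (by simpa using hc) hx, hq⟩

/-- A loop that runs exactly `N` times, iteration `i` taking at most `C i` steps. -/
theorem runs_while {e : Expr} {c : Prog} (Inv : ℕ → State → Prop) (N : ℕ) (C : ℕ → ℕ)
    (hstep : ∀ i s, i < N → Inv i s → e.eval w s ≠ 0 ∧
      Runs w ω c s fun t s' => t ≤ C i ∧ Inv (i + 1) s')
    (hend : ∀ s, Inv N s → e.eval w s = 0) {s : State} (h0 : Inv 0 s) :
    Runs w ω (.while e c) s fun t s' =>
      t ≤ (∑ i ∈ Finset.range N, (C i + e.cost + 1)) + (e.cost + 1) ∧ Inv N s' := by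
  have key : ∀ m i s, i + m = N → Inv i s → Runs w ω (.while e c) s fun t s' =>
      t ≤ (∑ j ∈ Finset.range m, (C (i + j) + e.cost + 1)) + (e.cost + 1) ∧ Inv N s' := by
    intro m
    induction m with
    | zero =>
      intro i s hi hs
      obtain rfl : i = N := by omega
      exact ⟨_, _, .whileFalse (hend _ hs), by simp, hs⟩
    | succ m ih =>
      intro i s hi hs
      obtain ⟨he, t, s', hx, ht, hs'⟩ := hstep i s (by omega) hs
      obtain ⟨t', s'', hx', ht', hs''⟩ := ih (i + 1) s' (by omega) hs'
      refine ⟨_, _, .whileTrue he hx hx', ?_, hs''⟩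
      rw [Finset.sum_range_succ']
      have : ∀ j, i + 1 + j = i + (j + 1) := by intro j; ring
      simp only [this] at ht'
      simp only [add_zero]
      omega
  simpa using key N 0 s (by omega) h0

/-- A loop that runs exactly `N` times, each iteration taking at most `C` steps. -/
theorem runs_while_const {e : Expr} {c : Prog} (Inv : ℕ → State → Prop) (N C : ℕ)
    (hstep : ∀ i s, i < N → Inv i s → e.eval w s ≠ 0 ∧
      Runs w ω c s fun t s' => t ≤ C ∧ Inv (i + 1) s')
    (hend : ∀ s, Inv N s → e.eval w s = 0) {s : State} (h0 : Inv 0 s) :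
    Runs w ω (.while e c) s fun t s' =>
      t ≤ N * (C + e.cost + 1) + (e.cost + 1) ∧ Inv N s' := by
  have := runs_while Inv N (fun _ => C) hstep hend h0
  simpa using this

theorem eval_const {k : ℕ} {s : State} (h : k < 2 ^ w) : (Expr.const k).eval w s = k :=
  Nat.mod_eq_of_lt h

theorem eval_reg {x : ℕ} {s : State} : (Expr.reg x).eval w s = s.reg x := rfl

theorem eval_load {a : ℕ} {i : Expr} {s : State} :
    (Expr.load a i).eval w s = s.mem a (i.eval w s) := rfl

theorem eval_op {o : Op} {e f : Expr} {s : State} :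
    (Expr.op o e f).eval w s = o.eval w (e.eval w s) (f.eval w s) := rfl

theorem op_add {a b : ℕ} (h : a + b < 2 ^ w) : Op.add.eval w a b = a + b :=
  Nat.mod_eq_of_lt h

theorem op_sub {a b : ℕ} (h : a < 2 ^ w) : Op.sub.eval w a b = a - b :=
  Nat.mod_eq_of_lt (by omega)

theorem op_mul {a b : ℕ} (h : a * b < 2 ^ w) : Op.mul.eval w a b = a * b :=
  Nat.mod_eq_of_lt h

theorem op_div {a b : ℕ} (h : a < 2 ^ w) : Op.div.eval w a b = a / b :=
  Nat.mod_eq_of_lt ((Nat.div_le_self _ _).trans_lt h)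

theorem op_mod {a b : ℕ} (h : a < 2 ^ w) : Op.mod.eval w a b = a % b :=
  Nat.mod_eq_of_lt ((Nat.mod_le _ _).trans_lt h)

theorem op_lt {a b : ℕ} (h : 1 < 2 ^ w) : Op.lt.eval w a b = if a < b then 1 else 0 :=
  Nat.mod_eq_of_lt (by split_ifs <;> omega)

end Rules

end WordRAM

/-! Greedy cutting of an increasing list of positions into pieces. -/

/-- The positions `a < P` may be the first and the last of a piece with `j` members. -/
def FitsPiece (K M a P j : ℕ) : Prop := P - a + 1 ≤ K ∧ (P - a + 1).choose j ≤ M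

instance (K M a P j : ℕ) : Decidable (FitsPiece K M a P j) := by
  unfold FitsPiece; infer_instance

/-- State of the greedy cutting: the closed pieces, the open piece (last position first) and its
first position. -/
structure Cut where
  closed : List (List ℕ)
  cur : List ℕ
  start : ℕ

namespace Cut

/-- The state before any position is read. -/
def init : Cut := ⟨[], [], 0⟩

/-- The closed pieces and the open piece, if there is one. -/
def pieces (c : Cut) : List (List ℕ) := if c.cur = [] then c.closed else c.cur :: c.closed

/-- The open piece is extended by `P` if this fits; otherwise a new piece starts. -/
def push (K M : ℕ) (c : Cut) (P : ℕ) : Cut :=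
  if c.cur ≠ [] ∧ FitsPiece K M c.start P (c.cur.length + 1) then { c with cur := P :: c.cur }
  else ⟨c.pieces, [P], P⟩

/-- The state after the positions in `l` are read. -/
def run (K M : ℕ) (l : List ℕ) : Cut := l.foldl (push K M) init

variable {K M : ℕ}

theorem run_append (l : List ℕ) (P : ℕ) : run K M (l ++ [P]) = (run K M l).push K M P := by
  simp [run]

theorem run_nil : run K M [] = init := rfl

theorem cur_ne_nil {l : List ℕ} (hl : l ≠ []) : (run K M l).cur ≠ [] := by
  induction l using List.reverseRecOn with
  | nil => exact absurd rfl hl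
  | append_singleton l P _ =>
    rw [run_append, push]
    split_ifs <;> simp

theorem cur_ne_nil_iff {l : List ℕ} : (run K M l).cur ≠ [] ↔ l ≠ [] :=
  ⟨fun h hl => h (by rw [hl]; rfl), cur_ne_nil⟩

theorem pieces_eq {c : Cut} (h : c.cur ≠ []) : c.pieces = c.cur :: c.closed := by
  simp [pieces, h]

theorem flatten_pieces (c : Cut) : c.pieces.flatten = c.cur ++ c.closed.flatten := by
  unfold pieces
  split_ifs with h <;> simp [h]

/-- Pieces are stored latest first and each piece last position first, so concatenation reverses the
input. Covering, disjointness and sortedness of the pieces are all read off from this identity. -/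
theorem flatten_run (l : List ℕ) : (run K M l).pieces.flatten = l.reverse := by
  induction l using List.reverseRecOn with
  | nil => rfl
  | append_singleton l P ih =>
    rw [run_append, push]
    split_ifs with h
    · rw [flatten_pieces] at ih ⊢
      simp [← ih]
    · rw [flatten_pieces]
      simp [ih]

theorem ne_nil_of_mem_closed {l : List ℕ} : ∀ p ∈ (run K M l).closed, p ≠ [] := by
  induction l using List.reverseRecOn with
  | nil => simp [run, init]
  | append_singleton l P ih =>
    rw [run_append, push]
    split_ifs with h
    · exact ih
    · intro p hp
      simp only [pieces] at hp
      split_ifs at hp with hc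
      · exact ih p hp
      · rcases List.mem_cons.1 hp with rfl | hp
        · exact hc
        · exact ih p hp

theorem ne_nil_of_mem_pieces {l : List ℕ} {p : List ℕ} (hp : p ∈ (run K M l).pieces) :
    p ≠ [] := by
  unfold pieces at hp
  split_ifs at hp with hc
  · exact ne_nil_of_mem_closed p hp
  · rcases List.mem_cons.1 hp with rfl | hp
    · exact hc
    · exact ne_nil_of_mem_closed p hp

theorem mem_of_mem_pieces {l p : List ℕ} (hp : p ∈ (run K M l).pieces) {x : ℕ} (hx : x ∈ p) :
    x ∈ l := by
  rw [← List.mem_reverse, ← flatten_run (K := K) (M := M)]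
  exact List.mem_flatten.2 ⟨p, hp, hx⟩

theorem exists_mem_pieces {l : List ℕ} {x : ℕ} (hx : x ∈ l) :
    ∃ p ∈ (run K M l).pieces, x ∈ p := by
  rw [← List.mem_reverse, ← flatten_run (K := K) (M := M)] at hx
  exact List.mem_flatten.1 hx

/-- Pieces are nonempty and together have as many members as the input. This serves both the running
time and the sparse case. -/
theorem length_pieces_le (l : List ℕ) : (run K M l).pieces.length ≤ l.length := by
  rw [← List.length_reverse (as := l), ← flatten_run (K := K) (M := M), List.length_flatten]
  have : ∀ L : List (List ℕ), (∀ p ∈ L, p ≠ []) → L.length ≤ (L.map List.length).sum := by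
    intro L hL
    induction L with
    | nil => simp
    | cons p L ih =>
      have h1 := List.length_pos_of_ne_nil (hL p (by simp))
      have h2 := ih fun q hq => hL q (by simp [hq])
      simp only [List.length_cons, List.map_cons, List.sum_cons]
      omega
  exact this _ fun p hp => ne_nil_of_mem_pieces hp

/-- The pieces have pairwise different, disjoint images under a map that is injective on the
positions read. -/
theorem pairwise_disjoint_map {α : Type*} {f : ℕ → α} {l : List ℕ} (hl : (l.map f).Nodup) :
    ((run K M l).pieces.map (List.map f)).Pairwise List.Disjoint := by
  have : ((run K M l).pieces.map (List.map f)).flatten.Nodup := by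
    rw [← List.map_flatten, flatten_run, List.map_reverse]
    exact List.nodup_reverse.2 hl
  exact (List.nodup_flatten.1 this).2

theorem nodup_map_of_mem {α : Type*} {f : ℕ → α} {l p : List ℕ} (hl : (l.map f).Nodup)
    (hp : p ∈ (run K M l).pieces) : (p.map f).Nodup := by
  have : ((run K M l).pieces.map (List.map f)).flatten.Nodup := by
    rw [← List.map_flatten, flatten_run, List.map_reverse]
    exact List.nodup_reverse.2 hl
  exact (List.nodup_flatten.1 this).1 _ (List.mem_map_of_mem hp)

/-- A nonempty list cannot be disjoint from itself. The program relies on this when it closes a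
piece: the vertex is not yet a member of that node. -/
theorem cur_not_mem_closed {α : Type*} {f : ℕ → α} {l : List ℕ} (hl : (l.map f).Nodup)
    (hne : l ≠ []) : (run K M l).cur.map f ∉ (run K M l).closed.map (List.map f) := by
  intro hmem
  have h := pairwise_disjoint_map (K := K) (M := M) hl
  have hc := cur_ne_nil (K := K) (M := M) hne
  rw [pieces_eq hc, List.map_cons, List.pairwise_cons] at h
  have := h.1 _ hmem
  obtain ⟨x, hx⟩ := List.exists_mem_of_ne_nil _ hc
  exact this (List.mem_map_of_mem hx) (List.mem_map_of_mem hx)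

theorem eq_of_mem_of_mem {α : Type*} {f : ℕ → α} {l p q : List ℕ} (hl : (l.map f).Nodup)
    (hp : p ∈ (run K M l).pieces) (hq : q ∈ (run K M l).pieces) {x : α}
    (hxp : x ∈ p.map f) (hxq : x ∈ q.map f) : p.map f = q.map f := by
  by_contra hne
  have h := pairwise_disjoint_map (K := K) (M := M) hl
  have : Std.Symm (List.Disjoint (α := α)) := ⟨fun _ _ h => h.symm⟩
  exact h.forall (List.mem_map_of_mem hp) (List.mem_map_of_mem hq) hne hxp hxq

/-- Shape of the open piece: it is a decreasing list that ends with `start`. -/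
theorem cur_spec {l : List ℕ} (hl : l.Pairwise (· < ·)) (hne : l ≠ []) :
    (run K M l).start ∈ l ∧
      (run K M l).cur = (l.filter fun x => (run K M l).start ≤ x).reverse := by
  induction l using List.reverseRecOn with
  | nil => exact absurd rfl hne
  | append_singleton l P ih =>
    have hl' := List.pairwise_append.1 hl
    have hlt : ∀ x ∈ l, x < P := fun x hx => hl'.2.2 x hx P (by simp)
    rw [run_append, push]
    split_ifs with h
    · have := ih hl'.1 (cur_ne_nil_iff.1 h.1)
      refine ⟨by simp [this.1], ?_⟩
      have h2 := hlt _ this.1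
      simp only [List.filter_append, List.reverse_append]
      rw [← this.2]
      simp [h2.le]
    · refine ⟨by simp, ?_⟩
      have : l.filter (fun x => decide (P ≤ x)) = [] := by
        rw [List.filter_eq_nil_iff]
        intro x hx
        simpa using hlt x hx
      simp [List.filter_append, this]

/-- Every piece fits. -/
theorem fits_of_mem_pieces {l : List ℕ} (hl : l.Pairwise (· < ·)) (hK : 1 ≤ K) (hM : 1 ≤ M) :
    ∀ p ∈ (run K M l).pieces, ∃ a b, a ∈ p ∧ b ∈ p ∧ (∀ x ∈ p, a ≤ x ∧ x ≤ b) ∧ p.Nodup ∧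
      FitsPiece K M a b p.length := by
  -- The induction must also carry that the open piece fits with `start` as its first position,
  -- since this is the value with which `push` tests the next position.
  have key : (∀ p ∈ (run K M l).pieces, ∃ a b, a ∈ p ∧ b ∈ p ∧ (∀ x ∈ p, a ≤ x ∧ x ≤ b) ∧
      p.Nodup ∧ FitsPiece K M a b p.length) ∧ (l ≠ [] → ∃ b, (run K M l).start ∈ (run K M l).cur ∧
        b ∈ (run K M l).cur ∧ (∀ x ∈ (run K M l).cur, (run K M l).start ≤ x ∧ x ≤ b) ∧
      (run K M l).cur.Nodup ∧
      FitsPiece K M (run K M l).start b (run K M l).cur.length) := by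
    induction l using List.reverseRecOn with
    | nil => simp [run, init, pieces]
    | append_singleton l P ih =>
      have hl' := List.pairwise_append.1 hl
      have hlt : ∀ x ∈ l, x < P := fun x hx => hl'.2.2 x hx P (by simp)
      obtain ⟨ih1, ih2⟩ := ih hl'.1
      rw [run_append, push]
      split_ifs with h
      · obtain ⟨b, h1, h2, h3, h4, h5⟩ := ih2 (cur_ne_nil_iff.1 h.1)
        have hP : ∀ x ∈ (run K M l).cur, x < P := fun x hx =>
          hlt x (mem_of_mem_pieces (by rw [pieces_eq h.1]; simp) hx)
        have hnew : (run K M l).start ∈ P :: (run K M l).cur ∧ P ∈ P :: (run K M l).cur ∧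
            (∀ x ∈ P :: (run K M l).cur, (run K M l).start ≤ x ∧ x ≤ P) ∧
            (P :: (run K M l).cur).Nodup ∧
            FitsPiece K M (run K M l).start P (P :: (run K M l).cur).length := by
          refine ⟨by simp [h1], by simp, ?_, ?_, by simpa using h.2⟩
          · intro x hx
            rcases List.mem_cons.1 hx with rfl | hx
            · exact ⟨(hP _ h1).le, le_rfl⟩
            · exact ⟨(h3 x hx).1, (hP x hx).le⟩
          · rw [List.nodup_cons]
            exact ⟨fun hx => lt_irrefl _ (hP _ hx), h4⟩
        refine ⟨?_, fun _ => ⟨P, hnew⟩⟩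
        intro p hp
        rw [pieces_eq (by simp)] at hp
        rcases List.mem_cons.1 hp with rfl | hp
        · exact ⟨_, _, hnew⟩
        · exact ih1 p (by rw [pieces_eq h.1]; simp [hp])
      · have hnew : FitsPiece K M P P 1 := ⟨by simpa using hK, by simpa using hM⟩
        refine ⟨?_, fun _ => ⟨P, by simpa using hnew⟩⟩
        intro p hp
        rw [pieces_eq (by simp)] at hp
        rcases List.mem_cons.1 hp with rfl | hp
        · exact ⟨P, P, by simpa using hnew⟩
        · exact ih1 p hp
  exact key.1

/-- A potential that increases strictly at each break bounds the number of pieces. -/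
theorem length_pieces_add_le {l : List ℕ} (hl : l.Pairwise (· < ·)) (Φ : ℕ → ℕ)
    (hbreak : ∀ a ∈ l, ∀ P ∈ l, a < P →
      ¬ FitsPiece K M a P ((l.filter fun x => a ≤ x ∧ x < P).length + 1) → Φ a < Φ P)
    {first last : ℕ} (hfirst : ∀ x ∈ l, first ≤ Φ x) (hlast : ∀ x ∈ l, Φ x ≤ last) (hne : l ≠ []) :
    (run K M l).pieces.length + first ≤ last + 1 := by
  -- Along prefixes, the number of pieces is compared with the potential at the start of the open
  -- piece; both change only at a break, the first by one and the second by at least one.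
  have key : ∀ l₁ l₂, l = l₁ ++ l₂ → l₁ ≠ [] →
      (run K M l₁).pieces.length + first ≤ Φ (run K M l₁).start + 1 := by
    intro l₁
    induction l₁ using List.reverseRecOn with
    | nil => intro _ _ h; exact absurd rfl h
    | append_singleton l₁ P ih =>
      intro l₂ hl₂ _
      have hP : P ∈ l := by rw [hl₂]; simp
      rw [run_append, push]
      by_cases h1 : l₁ = []
      · subst h1
        have := hfirst P hP
        simp [run_nil, init, pieces]
        omega
      have hsub : ∀ x ∈ l₁, x ∈ l := fun x hx => by rw [hl₂]; simp [hx]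
      have hpw := hl
      rw [hl₂] at hpw
      have hpw1 := (List.pairwise_append.1 hpw).1
      have hpw2 := (List.pairwise_append.1 hpw).2.2
      have hpw3 := (List.pairwise_append.1 hpw1)
      have hlt : ∀ x ∈ l₁, x < P := fun x hx => hpw3.2.2 x hx P (by simp)
      obtain ⟨hs, hcur⟩ := cur_spec (K := K) (M := M) hpw3.1 h1
      have ih' := ih (P :: l₂) (by rw [hl₂]; simp) h1
      split_ifs with h
      · rw [pieces_eq h.1] at ih'
        rw [pieces_eq (by simp)]
        simpa using ih'
      · rw [pieces_eq (by simp)]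
        -- The failed test used the length of the open piece, whereas the hypothesis on breaks
        -- counts members of the whole list between the start and `P`. The shape of the open piece
        -- identifies the two numbers.
        have hf : ¬ FitsPiece K M (run K M l₁).start P
            ((l.filter fun x => (run K M l₁).start ≤ x ∧ x < P).length + 1) := by
          have : l.filter (fun x => decide ((run K M l₁).start ≤ x ∧ x < P)) =
              l₁.filter fun x => (run K M l₁).start ≤ x := by
            rw [hl₂, List.append_assoc, List.filter_append]
            have h2 : List.filter (fun x => decide ((run K M l₁).start ≤ x ∧ x < P))
                ([P] ++ l₂) = [] := by
              rw [List.filter_eq_nil_iff]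
              intro x hx
              simp only [List.cons_append, List.nil_append, List.mem_cons] at hx
              have : P ≤ x := by
                rcases hx with rfl | hx
                · exact le_rfl
                · exact (hpw2 P (by simp) x hx).le
              simp [this]
            rw [h2, List.append_nil]
            apply List.filter_congr
            intro x hx
            simp [hlt x hx]
          rw [this]
          have h3 := congrArg List.length hcur
          rw [List.length_reverse] at h3
          rw [← h3]
          intro hfit
          exact h ⟨cur_ne_nil h1, hfit⟩
        have := hbreak _ (hsub _ hs) P hP (hlt _ hs) hf
        simp only [List.length_cons]
        omega
  have h1 := key l [] (by simp) hne
  have h2 := hlast _ (cur_spec (K := K) (M := M) hl hne).1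
  omega

end Cut

/-! Vertices in the order of their keys, and the cyclic rule that assigns each edge to one of its
ends. -/

section Order

variable {n : ℕ} (key : Fin n → ℕ)

/-- The number of vertices before `v` in the order of the keys. -/
def keyRank (v : Fin n) : ℕ :=
  (Finset.univ.filter fun u => key u < key v ∨ (key u = key v ∧ u < v)).card

variable {key}

theorem keyRank_lt_keyRank {u v : Fin n} (h : key u < key v ∨ (key u = key v ∧ u < v)) :
    keyRank key u < keyRank key v := by
  apply Finset.card_lt_card
  rw [Finset.ssubset_iff_of_subset]
  · exact ⟨u, by simp [h], by simp⟩
  · intro x hx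
    simp only [Finset.mem_filter, Finset.mem_univ, true_and] at hx ⊢
    omega

theorem key_le_of_keyRank_lt {u v : Fin n} (h : keyRank key u < keyRank key v) :
    key u ≤ key v := by
  by_contra! hlt
  exact absurd (keyRank_lt_keyRank (Or.inl hlt)) (by omega)

variable (key)

theorem keyRank_injective : Function.Injective (keyRank key) := by
  intro u v h
  by_contra hne
  rcases lt_trichotomy (key u) (key v) with h1 | h1 | h1
  · exact absurd (keyRank_lt_keyRank (Or.inl h1)) (by omega)
  · rcases lt_or_gt_of_ne hne with h2 | h2
    · exact absurd (keyRank_lt_keyRank (Or.inr ⟨h1, h2⟩)) (by omega)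
    · exact absurd (keyRank_lt_keyRank (Or.inr ⟨h1.symm, h2⟩)) (by omega)
  · exact absurd (keyRank_lt_keyRank (Or.inl h1)) (by omega)

theorem keyRank_lt (v : Fin n) : keyRank key v < n := by
  have : keyRank key v < (Finset.univ : Finset (Fin n)).card := by
    apply Finset.card_lt_card
    rw [Finset.ssubset_iff_of_subset (Finset.subset_univ _)]
    exact ⟨v, by simp, by simp⟩
  simpa using this

/-- The order of the keys as a permutation of `Fin n`. -/
noncomputable def keyPlace : Fin n ≃ Fin n :=
  Equiv.ofBijective (fun v => ⟨keyRank key v, keyRank_lt key v⟩)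
    (Finite.injective_iff_bijective.1 fun _ _ h => keyRank_injective key (Fin.mk.inj h))

/-- The vertex at position `P` of the cyclic order. -/
noncomputable def vertAt [NeZero n] (P : ℕ) : Fin n :=
  (keyPlace key).symm ⟨P % n, Nat.mod_lt _ (NeZero.pos n)⟩

variable [NeZero n]

theorem keyRank_vertAt (P : ℕ) : keyRank key (vertAt key P) = P % n := by
  have := (keyPlace key).apply_symm_apply ⟨P % n, Nat.mod_lt _ (NeZero.pos n)⟩
  exact congrArg Fin.val this

theorem vertAt_keyRank (v : Fin n) : vertAt key (keyRank key v) = v := by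
  apply keyRank_injective key
  rw [keyRank_vertAt, Nat.mod_eq_of_lt (keyRank_lt key v)]

theorem vertAt_congr {P P' : ℕ} (h : P % n = P' % n) : vertAt key P = vertAt key P' := by
  apply keyRank_injective key
  rw [keyRank_vertAt, keyRank_vertAt, h]

theorem vertAt_eq_iff {P P' : ℕ} : vertAt key P = vertAt key P' ↔ P % n = P' % n := by
  refine ⟨fun h => ?_, vertAt_congr key⟩
  rw [← keyRank_vertAt key, h, keyRank_vertAt]

/-- The vertex `b` takes care of the edge to the vertex `u` at position `P`. -/
def Handles (H : ℕ) (b u : Fin n) (P : ℕ) : Prop :=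
  (P < n ∧ keyRank key b < P ∧ key u - key b ≤ H) ∨
    (n ≤ P ∧ P - n < keyRank key b ∧ H < key b - key u)

instance (H : ℕ) (b u : Fin n) (P : ℕ) : Decidable (Handles key H b u P) := by
  unfold Handles; infer_instance

open Classical in
/-- The positions at which `b` takes care of an edge. -/
noncomputable def events (G : SimpleGraph (Fin n)) (H : ℕ) (b : Fin n) (N : ℕ) : List ℕ :=
  (List.range N).filter fun P => G.Adj b (vertAt key P) ∧ Handles key H b (vertAt key P) P

variable {key} {G : SimpleGraph (Fin n)} {H : ℕ} {b : Fin n} {N : ℕ}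

theorem mem_events {P : ℕ} : P ∈ events key G H b N ↔
    P < N ∧ G.Adj b (vertAt key P) ∧ Handles key H b (vertAt key P) P := by
  simp [events]

theorem pairwise_events : (events key G H b N).Pairwise (· < ·) :=
  List.Pairwise.filter _ List.pairwise_lt_range

-- A vertex is responsible only for positions less than one turn ahead of its own. This window is
-- too short to contain two positions of the same vertex.
set_option linter.unusedSectionVars false in
theorem Handles.lt_add {u : Fin n} {P : ℕ} (h : Handles key H b u P) :
    keyRank key b < P ∧ P < keyRank key b + n := by
  have := keyRank_lt key b
  unfold Handles at h
  omega

/-- Two positions of one vertex differ by a multiple of `n`, and both lie in a window of fewer than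
`n` positions. -/
theorem eq_of_mem_events {P P' : ℕ} (h : P ∈ events key G H b N)
    (h' : P' ∈ events key G H b N) (he : vertAt key P = vertAt key P') : P = P' := by
  rw [mem_events] at h h'
  have h1 := h.2.2.lt_add
  have h2 := h'.2.2.lt_add
  rw [vertAt_eq_iff] at he
  have e1 := Nat.div_add_mod P n
  have e2 := Nat.div_add_mod P' n
  rcases lt_trichotomy (P / n) (P' / n) with h | h | h
  · have := Nat.mul_le_mul_left n (Nat.succ_le_of_lt h)
    rw [Nat.mul_succ] at this
    omega
  · rw [h] at e1; omega
  · have := Nat.mul_le_mul_left n (Nat.succ_le_of_lt h)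
    rw [Nat.mul_succ] at this
    omega

theorem nodup_map_vertAt_events :
    ((events key G H b N).map (vertAt key)).Nodup := by
  refine List.Nodup.map_on (fun x hx y hy hxy => eq_of_mem_events hx hy hxy) ?_
  exact pairwise_events.imp (fun h => h.ne)

/-- The first turn accounts for neighbours of larger rank at key distance at most `H`, the second
turn for neighbours of smaller rank at key distance more than `H`. This form no longer mentions
positions. -/
theorem exists_event_iff (u v : Fin n) : (∃ P ∈ events key G H u (2 * n), vertAt key P = v) ↔
    G.Adj u v ∧ ((keyRank key u < keyRank key v ∧ key v - key u ≤ H) ∨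
      (keyRank key v < keyRank key u ∧ H < key u - key v)) := by
  constructor
  · rintro ⟨P, hP, rfl⟩
    rw [mem_events] at hP
    refine ⟨hP.2.1, ?_⟩
    rw [keyRank_vertAt]
    obtain ⟨h1, -, h2⟩ := hP
    unfold Handles at h2
    rcases h2 with h2 | h2
    · left
      rw [Nat.mod_eq_of_lt h2.1]
      exact h2.2
    · right
      rw [Nat.mod_eq_sub_mod h2.1, Nat.mod_eq_of_lt (by omega)]
      exact h2.2
  · rintro ⟨hadj, h | h⟩
    · refine ⟨keyRank key v, ?_, vertAt_keyRank key v⟩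
      have := keyRank_lt key v
      rw [mem_events, vertAt_keyRank]
      exact ⟨by omega, hadj, Or.inl ⟨this, h⟩⟩
    · have hv : vertAt key (keyRank key v + n) = v := by
        rw [← vertAt_keyRank key v, vertAt_eq_iff, vertAt_keyRank]
        simp
      refine ⟨keyRank key v + n, ?_, hv⟩
      have := keyRank_lt key v
      rw [mem_events, hv]
      exact ⟨by omega, hadj, Or.inr ⟨by omega, by simpa using h⟩⟩

/-- Each edge is taken care of by exactly one of its ends. -/
theorem event_xor {u v : Fin n} (h : G.Adj u v) :
    (∃ P ∈ events key G H u (2 * n), vertAt key P = v) ↔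
      ¬ ∃ P ∈ events key G H v (2 * n), vertAt key P = u := by
  rw [exists_event_iff, exists_event_iff]
  have hne : keyRank key u ≠ keyRank key v := fun h' => h.ne (keyRank_injective key h')
  -- For a fixed order of the two ranks, one end is responsible if the key distance is at most `H`
  -- and the other one if it is more; no relation between `H` and the range of the keys is needed.
  rcases lt_or_gt_of_ne hne with h1 | h1
  · simp only [h, h.symm, true_and]
    omega
  · simp only [h, h.symm, true_and]
    omega

end Order

/-! ### From pieces to bicliques: the partition property and the loads. -/

section Pieces

variable {n : ℕ} [NeZero n] (key : Fin n → ℕ) (G : SimpleGraph (Fin n)) (H K M : ℕ)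

/-- The pieces of the neighbourhood of `b`, as lists of vertices. -/
noncomputable def vertexPieces (b : Fin n) : List (List (Fin n)) :=
  (Cut.run K M (events key G H b (2 * n))).pieces.map (List.map (vertAt key))

/-- The list `Q` consists of the pairs `(L, R)` such that `L` is a piece of some vertex and `R`
lists the vertices that have `L` as a piece. -/
structure IsGrouping (Q : List (List (Fin n) × List (Fin n))) : Prop where
  nodup_fst : (Q.map Prod.fst).Nodup
  ne_nil : ∀ B ∈ Q, B.2 ≠ []
  nodup : ∀ B ∈ Q, B.2.Nodup
  mem_iff : ∀ B ∈ Q, ∀ b, b ∈ B.2 ↔ B.1 ∈ vertexPieces key G H K M b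
  exists_mem : ∀ b, ∀ L ∈ vertexPieces key G H K M b, ∃ B ∈ Q, B.1 = L

variable {key G H K M}

theorem exists_event_of_mem_vertexPieces {b u : Fin n} {L : List (Fin n)}
    (hL : L ∈ vertexPieces key G H K M b) (hu : u ∈ L) :
    ∃ P ∈ events key G H b (2 * n), vertAt key P = u := by
  obtain ⟨p, hp, rfl⟩ := List.mem_map.1 hL
  obtain ⟨P, hP, rfl⟩ := List.mem_map.1 hu
  exact ⟨P, Cut.mem_of_mem_pieces hp hP, rfl⟩

theorem nodup_of_mem_vertexPieces {b : Fin n} {L : List (Fin n)}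
    (hL : L ∈ vertexPieces key G H K M b) : L.Nodup := by
  obtain ⟨p, hp, rfl⟩ := List.mem_map.1 hL
  exact Cut.nodup_map_of_mem nodup_map_vertAt_events hp

theorem ne_nil_of_mem_vertexPieces {b : Fin n} {L : List (Fin n)}
    (hL : L ∈ vertexPieces key G H K M b) : L ≠ [] := by
  obtain ⟨p, hp, rfl⟩ := List.mem_map.1 hL
  simpa using Cut.ne_nil_of_mem_pieces hp

theorem exists_mem_vertexPieces {b u : Fin n}
    (h : ∃ P ∈ events key G H b (2 * n), vertAt key P = u) :
    ∃ L ∈ vertexPieces key G H K M b, u ∈ L := by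
  obtain ⟨P, hP, rfl⟩ := h
  obtain ⟨p, hp, hPp⟩ := Cut.exists_mem_pieces (K := K) (M := M) hP
  exact ⟨_, List.mem_map_of_mem hp, List.mem_map_of_mem hPp⟩

theorem vertexPieces_eq_of_mem {b u : Fin n} {L L' : List (Fin n)}
    (hL : L ∈ vertexPieces key G H K M b) (hL' : L' ∈ vertexPieces key G H K M b)
    (hu : u ∈ L) (hu' : u ∈ L') : L = L' := by
  obtain ⟨p, hp, rfl⟩ := List.mem_map.1 hL
  obtain ⟨q, hq, rfl⟩ := List.mem_map.1 hL'
  exact Cut.eq_of_mem_of_mem nodup_map_vertAt_events hp hq hu hu'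

/-- Every member of `R` is adjacent to all of `L`, because pieces consist of events. Uniqueness
combines three facts: one responsible end per edge, one piece of that end through the other end, one
biclique per piece. -/
theorem IsGrouping.isBicliquePartition {Q : List (List (Fin n) × List (Fin n))}
    (hQ : IsGrouping key G H K M Q) :
    IsBicliquePartition G (Q.map fun B => (B.1.toFinset, B.2.toFinset)) := by
  have hpiece : ∀ B ∈ Q, ∃ b, B.1 ∈ vertexPieces key G H K M b := by
    intro B hB
    obtain ⟨b, hb⟩ := List.exists_mem_of_ne_nil _ (hQ.ne_nil B hB)
    exact ⟨b, (hQ.mem_iff B hB b).1 hb⟩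
  constructor
  · intro C hC
    obtain ⟨B, hB, rfl⟩ := List.mem_map.1 hC
    obtain ⟨b, hb⟩ := hpiece B hB
    refine ⟨?_, ?_, ?_⟩
    · simpa [List.toFinset_nonempty_iff] using ne_nil_of_mem_vertexPieces hb
    · simpa [List.toFinset_nonempty_iff] using hQ.ne_nil B hB
    · intro u hu v hv
      rw [List.mem_toFinset] at hu hv
      obtain ⟨P, hP, rfl⟩ := exists_event_of_mem_vertexPieces ((hQ.mem_iff B hB v).1 hv) hu
      exact (mem_events.1 hP).2.1.symm
  · have main : ∀ u v, G.Adj u v → (∃ P ∈ events key G H u (2 * n), vertAt key P = v) →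
        ∃! i : Fin (Q.map fun B => (B.1.toFinset, B.2.toFinset)).length,
          BicliqueCovers ((Q.map fun B => (B.1.toFinset, B.2.toFinset)).get i) u v := by
      intro u v huv hev
      obtain ⟨L, hL, hvL⟩ := exists_mem_vertexPieces (K := K) (M := M) hev
      obtain ⟨B, hB, rfl⟩ := hQ.exists_mem u L hL
      obtain ⟨i, hi, rfl⟩ := List.getElem_of_mem hB
      refine ⟨⟨i, by simpa using hi⟩, ?_, ?_⟩
      · right
        simp only [List.get_eq_getElem, List.getElem_map, List.mem_toFinset]
        exact ⟨hvL, (hQ.mem_iff _ hB u).2 hL⟩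
      · rintro ⟨j, hj⟩ hcov
        have hj' : j < Q.length := by simpa using hj
        simp only [BicliqueCovers, List.get_eq_getElem, List.getElem_map, List.mem_toFinset]
          at hcov
        -- If the roles of the ends were swapped, `v` would be responsible as well. Otherwise both
        -- bicliques come from the same piece of `u`, and the left sides in `Q` are pairwise
        -- different.
        rcases hcov with ⟨h1, h2⟩ | ⟨h1, h2⟩
        · exact absurd hev ((event_xor huv.symm).1 (exists_event_of_mem_vertexPieces
            ((hQ.mem_iff _ (List.getElem_mem hj') v).1 h2) h1))
        · have := vertexPieces_eq_of_mem hL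
            ((hQ.mem_iff _ (List.getElem_mem hj') u).1 h2) hvL h1
          rw [Fin.mk.injEq]
          have hnd := hQ.nodup_fst
          refine (hnd.getElem_inj_iff (hi := by simpa using hj') (hj := by simpa using hi)).1 ?_
          simpa using this.symm
    intro u v huv
    by_cases hev : ∃ P ∈ events key G H u (2 * n), vertAt key P = v
    · exact main u v huv hev
    · have := main v u huv.symm ((event_xor huv.symm).2 hev)
      simpa only [BicliqueCovers, or_comm] using this

open Classical in
/-- The number of different pieces that contain a given vertex. -/
theorem card_pieces_containing_le (hK : 1 ≤ K) (hM : 1 ≤ M) (a : Fin n)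
    (𝓛 : Finset (List (Fin n)))
    (h𝓛 : ∀ L ∈ 𝓛, a ∈ L ∧ ∃ b, L ∈ vertexPieces key G H K M b) : 𝓛.card ≤ K ^ 3 * M := by
  -- The possible shapes of pieces, shifted to start at `0`: there are `K ^ 2` pairs of span and
  -- size, and each pair that fits admits at most `M` subsets.
  set 𝒯 : Finset (Finset ℕ) := (Finset.Icc 1 K ×ˢ Finset.Icc 1 K).biUnion fun q =>
    if q.1.choose q.2 ≤ M then (Finset.range q.1).powersetCard q.2 else ∅ with h𝒯
  have hcard𝒯 : 𝒯.card ≤ K ^ 2 * M := by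
    refine (Finset.card_biUnion_le_card_mul _ _ M fun q _ => ?_).trans_eq ?_
    · split_ifs with h
      · simpa using h
      · simp
    · simp [pow_two]
  -- A piece through `a` is recovered from its shape and the offset `q.1` of `a` in it. The start is
  -- the rank of `a` minus the offset, modulo `n`; the summand `n * q.1` keeps the subtraction in
  -- `ℕ` exact.
  set f : ℕ × Finset ℕ → List (Fin n) := fun q =>
    (q.2.sort (· ≥ ·)).map fun x => vertAt key (keyRank key a + n * q.1 - q.1 + x) with hf
  have hsub : 𝓛 ⊆ (Finset.range K ×ˢ 𝒯).image f := by
    intro L hL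
    obtain ⟨haL, b, hb⟩ := h𝓛 L hL
    obtain ⟨p, hp, rfl⟩ := List.mem_map.1 hb
    obtain ⟨Pa, hPa, rfl⟩ := List.mem_map.1 haL
    obtain ⟨s, e, hs, he, hse, hnd, hfit⟩ :=
      Cut.fits_of_mem_pieces pairwise_events hK hM p hp
    have hs_le : s ≤ e := (hse e he).1
    have hsorted : p.Pairwise (· ≥ ·) := by
      have hfl := Cut.flatten_run (K := K) (M := M) (events key G H b (2 * n))
      have : (Cut.run K M (events key G H b (2 * n))).pieces.flatten.Pairwise (· ≥ ·) := by
        rw [hfl, List.pairwise_reverse]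
        exact pairwise_events.imp fun h => le_of_lt h
      exact (List.pairwise_flatten.1 this).1 p hp
    rw [Finset.mem_image]
    refine ⟨(Pa - s, (p.map fun x => x - s).toFinset), ?_, ?_⟩
    · have hnd' : (p.map fun x => x - s).Nodup := by
        refine List.Nodup.map_on (fun x hx y hy hxy => ?_) hnd
        have := (hse x hx).1
        have := (hse y hy).1
        omega
      rw [Finset.mem_product]
      constructor
      · rw [Finset.mem_range]
        have := hse Pa hPa
        have := hfit.1
        dsimp only
        omega
      · rw [h𝒯, Finset.mem_biUnion]
        have hT : (p.map fun x => x - s).toFinset ⊆ Finset.range (e - s + 1) := by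
          intro y hy
          simp only [List.mem_toFinset, List.mem_map] at hy
          obtain ⟨x, hx, rfl⟩ := hy
          have := hse x hx
          rw [Finset.mem_range]
          omega
        have hTc : (p.map fun x => x - s).toFinset.card = p.length := by
          rw [List.toFinset_card_of_nodup hnd', List.length_map]
        have hle := Finset.card_le_card hT
        rw [hTc, Finset.card_range] at hle
        have hpos := List.length_pos_of_mem hs
        have := hfit.1
        refine ⟨(e - s + 1, p.length), ?_, ?_⟩
        · simp only [Finset.mem_product, Finset.mem_Icc]
          omega
        · rw [if_pos hfit.2, Finset.mem_powersetCard]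
          exact ⟨hT, hTc⟩
    · have hsort : ((p.map fun x => x - s).toFinset).sort (· ≥ ·) = p.map fun x => x - s := by
        have hpw : (p.map fun x => x - s).Pairwise (· ≥ ·) := by
          rw [List.pairwise_map]
          exact hsorted.imp fun h => Nat.sub_le_sub_right h s
        have hnd' : (p.map fun x => x - s).Nodup := by
          refine List.Nodup.map_on (fun x hx y hy hxy => ?_) hnd
          have := (hse x hx).1
          have := (hse y hy).1
          omega
        exact (List.toFinset_sort (r := (· ≥ ·)) hnd').2 hpw
      rw [hf]
      dsimp only
      rw [hsort, List.map_map]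
      apply List.map_congr_left
      intro x hx
      apply vertAt_congr
      have h1 := (hse x hx).1
      have h2 := (hse Pa hPa).1
      rw [keyRank_vertAt]
      dsimp only
      have h3 : Pa - s ≤ n * (Pa - s) := Nat.le_mul_of_pos_left _ (NeZero.pos n)
      have hmod := Nat.div_add_mod Pa n
      have : Pa % n + n * (Pa - s) - (Pa - s) + (x - s) + n * (Pa / n) = x + n * (Pa - s) := by
        omega
      have := congrArg (· % n) this
      simpa using this
  calc 𝓛.card ≤ (Finset.range K ×ˢ 𝒯).card :=
        (Finset.card_le_card hsub).trans Finset.card_image_le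
    _ ≤ K * (K ^ 2 * M) := by
        rw [Finset.card_product, Finset.card_range]
        exact Nat.mul_le_mul_left _ hcard𝒯
    _ = K ^ 3 * M := by ring

-- Left sides are different pieces through `v`, which are few because there are few shapes; right
-- sides are charged to the pieces of `v` itself.
open Classical in
theorem IsGrouping.bicliqueLoad_le {Q : List (List (Fin n) × List (Fin n))}
    (hQ : IsGrouping key G H K M Q) (hK : 1 ≤ K) (hM : 1 ≤ M) (v : Fin n) :
    bicliqueLoad (Q.map fun B => (B.1.toFinset, B.2.toFinset)) v ≤
      K ^ 3 * M + (vertexPieces key G H K M v).length := by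
  have h1 : (Q.filter fun B => v ∈ B.1).length ≤ K ^ 3 * M := by
    have hnd : ((Q.filter fun B => v ∈ B.1).map Prod.fst).Nodup :=
      (List.filter_sublist.map _).nodup hQ.nodup_fst
    rw [← List.length_map Prod.fst, ← List.toFinset_card_of_nodup hnd]
    refine card_pieces_containing_le (key := key) (G := G) (H := H) hK hM v _ ?_
    intro L hL
    simp only [List.mem_toFinset, List.mem_map, List.mem_filter, decide_eq_true_eq] at hL
    obtain ⟨B, ⟨hB, hv⟩, rfl⟩ := hL
    obtain ⟨b, hb⟩ := List.exists_mem_of_ne_nil _ (hQ.ne_nil B hB)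
    exact ⟨hv, b, (hQ.mem_iff B hB b).1 hb⟩
  have h2 : (Q.filter fun B => v ∈ B.2).length ≤ (vertexPieces key G H K M v).length := by
    have hnd : ((Q.filter fun B => v ∈ B.2).map Prod.fst).Nodup :=
      (List.filter_sublist.map _).nodup hQ.nodup_fst
    rw [← List.length_map Prod.fst, ← List.toFinset_card_of_nodup hnd]
    refine (Finset.card_le_card ?_).trans (List.toFinset_card_le _)
    intro L hL
    simp only [List.mem_toFinset, List.mem_map, List.mem_filter, decide_eq_true_eq] at hL ⊢
    obtain ⟨B, ⟨hB, hv⟩, rfl⟩ := hL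
    exact (hQ.mem_iff B hB v).1 hv
  have h3 : bicliqueLoad (Q.map fun B => (B.1.toFinset, B.2.toFinset)) v ≤
      (Q.filter fun B => v ∈ B.1).length + (Q.filter fun B => v ∈ B.2).length := by
    unfold bicliqueLoad
    rw [List.countP_map, ← List.countP_eq_length_filter, ← List.countP_eq_length_filter]
    clear hQ h1 h2
    induction Q with
    | nil => simp
    | cons B Q ih =>
      rw [List.countP_cons, List.countP_cons, List.countP_cons]
      have hB : (if (decide (v ∈ B.1.toFinset ∨ v ∈ B.2.toFinset)) = true then 1 else 0) ≤
          (if decide (v ∈ B.1) = true then 1 else 0) +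
            (if decide (v ∈ B.2) = true then 1 else 0) := by
        by_cases h1 : v ∈ B.1 <;> by_cases h2 : v ∈ B.2 <;> simp [h1, h2]
      exact (Nat.add_le_add ih hB).trans_eq (by ring)
  omega

end Pieces

/-! The number of pieces of a vertex in terms of how its neighbours fall into classes of keys. -/

section PieceCount

variable {n : ℕ} [NeZero n] (key : Fin n → ℕ)

/-- The class of the position `P < 2 * n` if keys less than `S` are divided into classes of `g`
consecutive keys. -/
noncomputable def posClass (S g P : ℕ) : ℕ :=
  if P < n then key (vertAt key P) / g else S / g + 1 + key (vertAt key P) / g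

open Classical in
/-- The number of positions before `P` in class `A` that belong to members of `W`. -/
noncomputable def countBefore (S g : ℕ) (W : Finset (Fin n)) (P A : ℕ) : ℕ :=
  ((Finset.range P).filter fun x => vertAt key x ∈ W ∧ posClass key S g x = A).card

/-- The number of members of `W` whose keys lie in class `A`. -/
def classCount (g : ℕ) (W : Finset (Fin n)) (A : ℕ) : ℕ := (W.filter fun v => key v / g = A).card

variable {key} {S g : ℕ}

theorem key_vertAt_mono {P P' : ℕ} (h : P ≤ P') (h' : P' < n) :
    key (vertAt key P) ≤ key (vertAt key P') := by
  rcases h.eq_or_lt with rfl | h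
  · exact le_rfl
  · apply key_le_of_keyRank_lt
    rwa [keyRank_vertAt, keyRank_vertAt, Nat.mod_eq_of_lt h', Nat.mod_eq_of_lt (h.trans h')]

theorem vertAt_sub {P : ℕ} (h : n ≤ P) : vertAt key (P - n) = vertAt key P :=
  vertAt_congr key (Nat.mod_eq_sub_mod h).symm

/-- Within one turn keys increase with position, and the shift `S / g + 1` used in the second turn
exceeds every class of the first turn. -/
theorem posClass_mono (hS : ∀ v, key v < S) {P P' : ℕ} (h : P ≤ P') (h' : P' < 2 * n) :
    posClass key S g P ≤ posClass key S g P' := by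
  unfold posClass
  split_ifs with h1 h2 h2
  · exact Nat.div_le_div_right (key_vertAt_mono h h2)
  · have := Nat.div_le_div_right (c := g) (hS (vertAt key P)).le
    generalize key (vertAt key P') / g = q
    omega
  · omega
  · rw [← vertAt_sub (not_lt.1 h1), ← vertAt_sub (not_lt.1 h2)]
    have := Nat.div_le_div_right (c := g)
      (key_vertAt_mono (key := key) (P := P - n) (P' := P' - n) (by omega) (by omega))
    omega

theorem countBefore_mono {W : Finset (Fin n)} {P P' A : ℕ} (h : P ≤ P') :
    countBefore key S g W P A ≤ countBefore key S g W P' A :=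
  Finset.card_le_card (Finset.filter_subset_filter _ (Finset.range_subset_range.2 h))

open Classical in
theorem countBefore_add {W : Finset (Fin n)} {a P A : ℕ} (h : a ≤ P)
    (hA : ∀ x, a ≤ x → x < P → posClass key S g x = A) :
    countBefore key S g W P A =
      countBefore key S g W a A + ((Finset.Ico a P).filter fun x => vertAt key x ∈ W).card := by
  have : (Finset.Ico a P).filter (fun x => vertAt key x ∈ W) =
      (Finset.Ico a P).filter fun x => vertAt key x ∈ W ∧ posClass key S g x = A := by
    apply Finset.filter_congr
    intro x hx
    rw [Finset.mem_Ico] at hx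
    simp [hA x hx.1 hx.2]
  unfold countBefore
  rw [this, Finset.range_eq_Ico, Finset.range_eq_Ico,
      ← Finset.Ico_union_Ico_eq_Ico (Nat.zero_le a) h,
    Finset.filter_union, Finset.card_union_of_disjoint]
  exact (Finset.Ico_disjoint_Ico_consecutive 0 a P).mono (Finset.filter_subset _ _)
    (Finset.filter_subset _ _)

/-- Class numbers below `S / g + 1` occur in the first turn only, where each vertex has a single
position. `countBefore_le_classCount'` is the counterpart for the second turn. -/
theorem countBefore_le_classCount {W : Finset (Fin n)} {A : ℕ}
    (hA : A < S / g + 1) : countBefore key S g W (2 * n) A ≤ classCount key g W A := by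
  classical
  refine Finset.card_le_card_of_injOn (vertAt key) ?_ ?_
  · intro x hx
    rw [Finset.mem_coe, Finset.mem_filter, Finset.mem_range, posClass] at hx
    generalize hq : key (vertAt key x) / g = q at hx
    split_ifs at hx with h
    · simp [hx.2.1, hx.2.2, hq]
    · omega
  · intro x hx y hy hxy
    rw [Finset.mem_coe, Finset.mem_filter, Finset.mem_range, posClass] at hx hy
    generalize key (vertAt key x) / g = q at hx
    generalize key (vertAt key y) / g = r at hy
    rw [vertAt_eq_iff] at hxy
    by_cases h : x < n <;> by_cases h' : y < n <;> simp only [h, h', if_true, if_false] at hx hy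
    · rw [Nat.mod_eq_of_lt h, Nat.mod_eq_of_lt h'] at hxy
      exact hxy
    all_goals omega

theorem countBefore_le_classCount' {W : Finset (Fin n)} (hS : ∀ v, key v < S) {A : ℕ} :
    countBefore key S g W (2 * n) (S / g + 1 + A) ≤ classCount key g W A := by
  classical
  refine Finset.card_le_card_of_injOn (vertAt key) ?_ ?_
  · intro x hx
    rw [Finset.mem_coe, Finset.mem_filter, Finset.mem_range, posClass] at hx
    have := Nat.div_le_div_right (c := g) (hS (vertAt key x)).le
    split_ifs at hx with h
    · omega
    · have := hx.2.2
      simp [hx.2.1]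
      omega
  · intro x hx y hy hxy
    rw [Finset.mem_coe, Finset.mem_filter, Finset.mem_range, posClass] at hx hy
    have h1 := Nat.div_le_div_right (c := g) (hS (vertAt key x)).le
    have h2 := Nat.div_le_div_right (c := g) (hS (vertAt key y)).le
    rw [vertAt_eq_iff] at hxy
    by_cases h : x < n <;> by_cases h' : y < n <;> simp only [h, h', if_true, if_false] at hx hy
    · omega
    · omega
    · omega
    · rw [Nat.mod_eq_sub_mod (not_lt.1 h), Nat.mod_eq_sub_mod (not_lt.1 h'),
        Nat.mod_eq_of_lt (by omega), Nat.mod_eq_of_lt (by omega)] at hxy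
      omega

variable {G : SimpleGraph (Fin n)} {H K M : ℕ} {b : Fin n}

/-- The positions at which `b` would take care of an edge are consecutive. -/
theorem Handles.between (hS : ∀ v, key v < S) (hH : S ≤ 2 * H) {a P x : ℕ}
    (ha : Handles key H b (vertAt key a) a) (hP : Handles key H b (vertAt key P) P)
    (hP' : P < 2 * n) (h1 : a ≤ x) (h2 : x ≤ P) : Handles key H b (vertAt key x) x := by
  by_cases hx : x < n
  · rcases ha with ha | ha
    · refine Or.inl ⟨hx, by omega, ?_⟩
      rcases hP with hP | hP
      · have := key_vertAt_mono (key := key) h2 hP.1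
        omega
      -- Here the window wraps, so `key b` exceeds `H` and the keys above it lie within `S - H ≤ H`.
      -- This is where `S ≤ 2 * H` is needed.
      · have := hS (vertAt key x)
        have := hS b
        omega
    · omega
  · rcases hP with hP | hP
    · omega
    · refine Or.inr ⟨by omega, by omega, ?_⟩
      have := key_vertAt_mono (key := key) (P := x - n) (P' := P - n) (by omega) (by omega)
      rw [vertAt_sub (not_lt.1 hx), vertAt_sub hP.1] at this
      omega

-- A break inside a class happens only after `K₀` positions or after `t` members of `W`, since
-- otherwise the next event would still fit. The responsible half turn meets at most `H / g + 3`
-- classes, and the floor quotients count the breaks caused by crowding; the factor `2` is due to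
-- the two turns. The set `W` may be the neighbourhood or its complement, because `l.choose j` does
-- not change when `j` is replaced by `l - j`.
open Classical in
theorem length_vertexPieces_le (hS : ∀ v, key v < S) (hH : S = 2 * H) {t K₀ : ℕ}
    (hg : 1 ≤ g) (ht : 1 ≤ t) (hK₀ : 1 ≤ K₀) (hK : K₀ ≤ K)
    (hM : ∀ l j, l ≤ K₀ → j ≤ t → l.choose j ≤ M) {W : Finset (Fin n)}
    (hW : W = Finset.univ.filter (G.Adj b) ∨ W = Finset.univ.filter (Gᶜ.Adj b)) :
    (vertexPieces key G H K M b).length ≤ H / g + 3 +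
      2 * ∑ A ∈ Finset.range (S / g + 1),
        (classCount key g W A / t + classCount key g Finset.univ A / K₀) := by
  by_cases hne : events key G H b (2 * n) = []
  · simp [vertexPieces, hne, Cut.run_nil, Cut.init, Cut.pieces]
  set NB := S / g + 1 with hNB
  -- The second part of the potential: per class, how many full batches of `t` members of `W` and of
  -- `K₀` arbitrary positions have been passed. The first part is the class of the position.
  set F : ℕ → ℕ := fun P => ∑ A ∈ Finset.range (2 * NB),
    (countBefore key S g W P A / t + countBefore key S g Finset.univ P A / K₀) with hF
  have hFmono : Monotone F := fun P P' h => Finset.sum_le_sum fun A _ =>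
    Nat.add_le_add (Nat.div_le_div_right (countBefore_mono h))
      (Nat.div_le_div_right (countBefore_mono h))
  set T := ∑ A ∈ Finset.range NB,
    (classCount key g W A / t + classCount key g Finset.univ A / K₀) with hT
  have hFlast : F (2 * n) ≤ 2 * T := by
    rw [hF]
    dsimp only
    rw [two_mul NB, Finset.sum_range_add, two_mul T]
    refine Nat.add_le_add (Finset.sum_le_sum fun A hA => ?_) (Finset.sum_le_sum fun A hA => ?_)
    · rw [Finset.mem_range] at hA
      exact Nat.add_le_add (Nat.div_le_div_right (countBefore_le_classCount hA))
        (Nat.div_le_div_right (countBefore_le_classCount hA))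
    · exact Nat.add_le_add (Nat.div_le_div_right (countBefore_le_classCount' hS))
        (Nat.div_le_div_right (countBefore_le_classCount' hS))
  have hclass : ∀ P, P < 2 * n → posClass key S g P < 2 * NB := by
    intro P _
    have := Nat.div_le_div_right (c := g) (hS (vertAt key P)).le
    unfold posClass
    split_ifs <;> omega
  have hbreak : ∀ a ∈ events key G H b (2 * n), ∀ P ∈ events key G H b (2 * n), a < P →
      ¬ FitsPiece K M a P (((events key G H b (2 * n)).filter fun x =>
        a ≤ x ∧ x < P).length + 1) → posClass key S g a + F a < posClass key S g P + F P := by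
    intro a ha P hP haP hfit
    have hP' := mem_events.1 hP
    have hcm := posClass_mono (key := key) (g := g) hS haP.le hP'.1
    rcases hcm.lt_or_eq with hlt | heq
    -- A break across classes raises the class number, and `F` does not drop.
    · have := hFmono haP.le
      omega
    rw [heq]
    apply Nat.add_lt_add_left
    set A := posClass key S g P with hA
    have hconst : ∀ x, a ≤ x → x < P → posClass key S g x = A := by
      intro x h1 h2
      have h3 := posClass_mono (key := key) (g := g) hS h1 (by omega)
      have h4 := posClass_mono (key := key) (g := g) hS h2.le (by omega)
      omega
    have hsum : ∀ B ∈ Finset.range (2 * NB),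
        countBefore key S g W a B / t + countBefore key S g Finset.univ a B / K₀ ≤
        countBefore key S g W P B / t + countBefore key S g Finset.univ P B / K₀ := fun B _ =>
      Nat.add_le_add (Nat.div_le_div_right (countBefore_mono haP.le))
        (Nat.div_le_div_right (countBefore_mono haP.le))
    refine Finset.sum_lt_sum hsum ⟨A, Finset.mem_range.2 (hclass P hP'.1), ?_⟩
    rw [countBefore_add haP.le hconst (W := W), countBefore_add haP.le hconst (W := Finset.univ)]
    set j := ((events key G H b (2 * n)).filter fun x => a ≤ x ∧ x < P).length with hj
    -- If neither threshold is reached, the piece extended by `P` has span at most `K₀`, and it has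
    -- at most `t` members or at most `t` gaps, so that it fits.
    have hcase : K₀ ≤ P - a ∨ t ≤ ((Finset.Ico a P).filter fun x => vertAt key x ∈ W).card := by
      by_contra! hcon
      apply hfit
      refine ⟨by omega, ?_⟩
      have hjE : j = ((Finset.Ico a P).filter fun x => x ∈ events key G H b (2 * n)).card := by
        rw [hj, ← List.toFinset_card_of_nodup
          ((pairwise_events.imp fun h => ne_of_lt h).filter _)]
        congr 1
        ext x
        simp only [List.mem_toFinset, List.mem_filter, decide_eq_true_eq, Finset.mem_filter,
          Finset.mem_Ico]
        tauto
      rcases hW with hW | hW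
      · apply hM _ _ (by omega)
        have : j ≤ ((Finset.Ico a P).filter fun x => vertAt key x ∈ W).card := by
          rw [hjE]
          apply Finset.card_le_card
          intro x hx
          rw [Finset.mem_filter] at hx ⊢
          refine ⟨hx.1, ?_⟩
          rw [hW]
          simpa using (mem_events.1 hx.2).2.1
        omega
      · have hadd : j + ((Finset.Ico a P).filter fun x => x ∉ events key G H b (2 * n)).card =
            P - a := by
          rw [hjE, Finset.card_filter_add_card_filter_not, Nat.card_Ico]
        have hmiss : ((Finset.Ico a P).filter fun x => x ∉ events key G H b (2 * n)).card ≤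
            ((Finset.Ico a P).filter fun x => vertAt key x ∈ W).card := by
          apply Finset.card_le_card
          intro x hx
          rw [Finset.mem_filter, Finset.mem_Ico] at hx
          rw [Finset.mem_filter, Finset.mem_Ico]
          refine ⟨hx.1, ?_⟩
          -- Between two events of `b` every position is in the range of its responsibility, so a
          -- position that is no event belongs to a non-neighbour.
          have hh := Handles.between (key := key) hS hH.le (mem_events.1 ha).2.2 hP'.2.2 hP'.1
            hx.1.1 hx.1.2.le
          have hnadj : ¬ G.Adj b (vertAt key x) := by
            intro hadj
            exact hx.2 (mem_events.2 ⟨by omega, hadj, hh⟩)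
          have hb : b ≠ vertAt key x := by
            intro hb
            have h1 := hh.lt_add
            have h2 := keyRank_vertAt key x
            rw [← hb] at h2
            by_cases hx' : x < n
            · rw [Nat.mod_eq_of_lt hx'] at h2
              omega
            · rw [Nat.mod_eq_sub_mod (by omega), Nat.mod_eq_of_lt (by omega)] at h2
              omega
          rw [hW]
          simp [SimpleGraph.compl_adj, hb, hnadj]
        -- Count the gaps of the extended piece instead of its members.
        have hle : j + 1 ≤ P - a + 1 := by omega
        rw [← Nat.choose_symm hle]
        exact hM _ _ (by omega) (by omega)
    rcases hcase with h | h
    · apply Nat.add_lt_add_of_le_of_lt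
      · exact Nat.div_le_div_right (Nat.le_add_right _ _)
      · have : ((Finset.Ico a P).filter fun x => vertAt key x ∈ Finset.univ).card = P - a := by
          simp
        rw [this]
        calc _ < countBefore key S g Finset.univ a A / K₀ + 1 := Nat.lt_succ_self _
          _ = (countBefore key S g Finset.univ a A + K₀) / K₀ := by
            rw [Nat.add_div_right _ (by omega)]
          _ ≤ _ := Nat.div_le_div_right (by omega)
    · apply Nat.add_lt_add_of_lt_of_le
      · calc _ < countBefore key S g W a A / t + 1 := Nat.lt_succ_self _
          _ = (countBefore key S g W a A + t) / t := by
            rw [Nat.add_div_right _ (by omega)]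
          _ ≤ _ := Nat.div_le_div_right (by omega)
      · exact Nat.div_le_div_right (Nat.le_add_right _ _)
  have hfirst : ∀ x ∈ events key G H b (2 * n), key b / g ≤ posClass key S g x + F x := by
    intro x hx
    have hx' := mem_events.1 hx
    refine le_trans ?_ (Nat.le_add_right _ _)
    unfold posClass
    split_ifs with h
    · apply Nat.div_le_div_right
      apply key_le_of_keyRank_lt
      have := hx'.2.2.lt_add.1
      rwa [keyRank_vertAt, Nat.mod_eq_of_lt h]
    · have := Nat.div_le_div_right (c := g) (hS b).le
      generalize key (vertAt key x) / g = q
      omega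
  -- All events have keys at most `key b + H` if a second-turn key is raised by `S = 2 * H`.
  -- Rounding in the division by `g` costs one, and the shift by `S / g + 1` costs another one.
  have hlast : ∀ x ∈ events key G H b (2 * n),
      posClass key S g x + F x ≤ key b / g + H / g + 2 + 2 * T := by
    intro x hx
    have hx' := mem_events.1 hx
    have h1 := (hFmono hx'.1.le).trans hFlast
    have hdiv : ∀ y z : ℕ, (y + z) / g ≤ y / g + z / g + 1 := by
      intro y z
      have h1 := Nat.div_add_mod y g
      have h2 := Nat.div_add_mod z g
      have h3 := Nat.mod_lt y hg
      have h4 := Nat.mod_lt z hg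
      rw [← Nat.lt_succ_iff, Nat.div_lt_iff_lt_mul hg]
      have : (y / g + z / g + 1).succ * g = g * (y / g) + g * (z / g) + g + g := by
        rw [Nat.succ_eq_add_one]; ring
      omega
    have h2 : posClass key S g x ≤ key b / g + H / g + 2 := by
      unfold posClass
      rcases hx'.2.2 with h | h
      · rw [if_pos h.1]
        have h3 : key (vertAt key x) / g ≤ (key b + H) / g := Nat.div_le_div_right (by omega)
        have := hdiv (key b) H
        omega
      · rw [if_neg (by omega)]
        have h3 : S / g + key (vertAt key x) / g ≤ (key b + H) / g :=
          (Nat.div_add_div_le_add_div).trans (Nat.div_le_div_right (by omega))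
        have := hdiv (key b) H
        omega
    omega
  have := Cut.length_pieces_add_le (K := K) (M := M) pairwise_events
    (fun P => posClass key S g P + F P) hbreak hfirst hlast hne
  unfold vertexPieces
  rw [List.length_map]
  omega

end PieceCount

/-! The program. Registers: `0` holds `n`, `1` and `2` hold `2 ^ s` and `s` for `s = Nat.size n`,
`3` to `6` hold the parameters `Δ`, `K`, `M`, `H`, `7` counts the nodes of the trie of pieces;
registers from `10` on are scratch. Banks: `0`, `1` input, `2` binomial coefficients, `3` keys,
`4` counters, `5` order, `6` ranks, `7` open node and `8` first position of each vertex, `9`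
children, `10` parents, `11` last vertices, `12` depths of nodes, `13` numbers of members and `14`
members of nodes. -/

set_option linter.unusedSimpArgs false
set_option linter.unnecessarySeqFocus false

namespace WordRAM

infixr:60 " ;; " => Prog.seq

section Abbreviations

abbrev cst (k : ℕ) : Expr := .const k
abbrev rg (x : ℕ) : Expr := .reg x
abbrev ad (e f : Expr) : Expr := .op .add e f
abbrev sb (e f : Expr) : Expr := .op .sub e f
abbrev ml (e f : Expr) : Expr := .op .mul e f
abbrev dv (e f : Expr) : Expr := .op .div e f
abbrev md (e f : Expr) : Expr := .op .mod e f
abbrev lt (e f : Expr) : Expr := .op .lt e f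
abbrev ld (a : ℕ) (e : Expr) : Expr := .load a e

/-- Add one to register `x`. -/
abbrev incr (x : ℕ) : Prog := .assign x (ad (rg x) (cst 1))

end Abbreviations

/-- Between `s` and `s'`, only scratch registers, the registers in `rs` and the banks in `bs` have
changed. -/
structure Frame (rs bs : List ℕ) (s s' : State) : Prop where
  reg : ∀ r, r < 10 → r ∉ rs → s'.reg r = s.reg r
  mem : ∀ a, a ∉ bs → s'.mem a = s.mem a
  out : s'.out = s.out

theorem Frame.refl (rs bs : List ℕ) (s : State) : Frame rs bs s s :=
  ⟨fun _ _ _ => rfl, fun _ _ => rfl, rfl⟩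

theorem Frame.trans {rs bs : List ℕ} {s s' s'' : State} (h : Frame rs bs s s')
    (h' : Frame rs bs s' s'') : Frame rs bs s s'' :=
  ⟨fun r h1 h2 => (h'.reg r h1 h2).trans (h.reg r h1 h2),
    fun a ha => (h'.mem a ha).trans (h.mem a ha), h'.out.trans h.out⟩

theorem Frame.mono {rs bs rs' bs' : List ℕ} {s s' : State} (h : Frame rs bs s s')
    (hr : rs ⊆ rs') (hb : bs ⊆ bs') : Frame rs' bs' s s' :=
  ⟨fun r h1 h2 => h.reg r h1 fun h3 => h2 (hr h3), fun a ha => h.mem a fun h3 => ha (hb h3), h.out⟩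

theorem Frame.update_reg {rs bs : List ℕ} {s : State} {R : ℕ → ℕ} {M : ℕ → ℕ → ℕ} {O : List ℕ}
    {F x v : ℕ} (h : Frame rs bs s ⟨R, M, O, F⟩) (hx : 10 ≤ x ∨ x ∈ rs) :
    Frame rs bs s ⟨Function.update R x v, M, O, F⟩ :=
  ⟨fun r h1 h2 => by
    have : r ≠ x := by rintro rfl; rcases hx with hx | hx <;> [omega; exact h2 hx]
    simpa [Function.update_of_ne this] using h.reg r h1 h2, h.mem, h.out⟩

theorem Frame.update_mem {rs bs : List ℕ} {s : State} {R : ℕ → ℕ} {M : ℕ → ℕ → ℕ} {O : List ℕ}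
    {F a : ℕ} {f : ℕ → ℕ} (h : Frame rs bs s ⟨R, M, O, F⟩) (ha : a ∈ bs) :
    Frame rs bs s ⟨R, Function.update M a f, O, F⟩ :=
  ⟨h.reg, fun b hb => by
    have : b ≠ a := by rintro rfl; exact hb ha
    simpa [Function.update_of_ne this] using h.mem b hb, h.out⟩

theorem Frame.set_flips {rs bs : List ℕ} {s s' : State} {F : ℕ} (h : Frame rs bs s s') :
    Frame rs bs s ⟨s'.reg, s'.mem, s'.out, F⟩ := ⟨h.reg, h.mem, h.out⟩

/-- Compute `2 ^ s` and `s`. -/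
def sizeProg : Prog :=
  .assign 1 (cst 1) ;;
  .while (lt (rg 1) (ad (rg 0) (cst 1))) (.assign 1 (ad (rg 1) (rg 1)) ;; incr 2)

/-- Compute the largest value `Δ` of the smaller one of degree and co-degree. -/
def degreeProg : Prog :=
  .assign 10 (cst 0) ;;
  .while (lt (rg 10) (rg 0))
    (.assign 11 (sb (ld 0 (ad (rg 10) (cst 1))) (ld 0 (rg 10))) ;;
      .assign 12 (sb (sb (rg 0) (cst 1)) (rg 11)) ;;
      .ite (lt (rg 12) (rg 11)) (.assign 11 (rg 12)) .skip ;;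
      .ite (lt (rg 3) (rg 11)) (.assign 3 (rg 11)) .skip ;;
      incr 10)

/-- The fifth power of an expression. -/
abbrev pow5 (e : Expr) : Expr := ml (ml (ml e e) (ml e e)) e

/-- The eighth power of an expression. -/
abbrev pow8 (e : Expr) : Expr := ml (ml (ml e e) (ml e e)) (ml (ml e e) (ml e e))

/-- Compute the greatest length `K` of a piece and the bound `M` on binomial coefficients. -/
def paramProg : Prog :=
  .assign 11 (ml (ad (dv (rg 0) (ad (rg 3) (cst 1))) (cst 1)) (rg 2)) ;;
  .assign 4 (cst 1) ;;
  .while (ml (lt (rg 4) (rg 11)) (lt (pow8 (ad (rg 4) (cst 1))) (ad (rg 0) (cst 1)))) (incr 4) ;;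
  .assign 5 (dv (rg 0) (pow5 (rg 4)))

/-- Compute the binomial coefficients up to row `K`, cut off at `M + 1`. -/
def tableProg : Prog :=
  .store 2 (cst 0) (cst 1) ;;
  .assign 10 (cst 0) ;;
  .while (lt (rg 10) (rg 4))
    (.store 2 (ml (ad (rg 10) (cst 1)) (rg 0)) (cst 1) ;;
      .assign 11 (cst 0) ;;
      .while (lt (rg 11) (ad (rg 10) (cst 1)))
        (.assign 12 (ad (ml (rg 10) (rg 0)) (rg 11)) ;;
          .assign 13 (ad (ld 2 (rg 12)) (ld 2 (ad (rg 12) (cst 1)))) ;;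
          .ite (lt (rg 5) (rg 13)) (.assign 13 (ad (rg 5) (cst 1))) .skip ;;
          .store 2 (ad (ad (rg 12) (rg 0)) (cst 1)) (rg 13) ;;
          incr 11) ;;
      incr 10)

/-- Use the degrees as keys. -/
def degreeKeyProg : Prog :=
  .assign 10 (cst 0) ;;
  .while (lt (rg 10) (rg 0))
    (.store 3 (rg 10) (sb (ld 0 (ad (rg 10) (cst 1))) (ld 0 (rg 10))) ;; incr 10) ;;
  .assign 6 (rg 1)

/-- Draw random keys of `s` bits. -/
def randomKeyProg : Prog :=
  .assign 10 (cst 0) ;;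
  .while (lt (rg 10) (rg 0))
    (.assign 11 (cst 0) ;;
      .assign 12 (cst 0) ;;
      .while (lt (rg 12) (rg 2)) (.flip 13 ;; .assign 11 (ad (ad (rg 11) (rg 11)) (rg 13)) ;;
          incr 12) ;;
      .store 3 (rg 10) (rg 11) ;;
      incr 10) ;;
  .assign 6 (dv (rg 1) (cst 2))

/-- Choose the keys: degrees for sparse graphs, random keys otherwise. -/
def keyProg : Prog := .ite (lt (ld 0 (rg 0)) (ml (rg 0) (rg 2))) degreeKeyProg randomKeyProg

/-- Count the keys. -/
def countProg : Prog :=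
  .assign 10 (cst 0) ;;
  .while (lt (rg 10) (rg 0))
    (.assign 11 (ad (ld 3 (rg 10)) (cst 1)) ;;
      .store 4 (rg 11) (ad (ld 4 (rg 11)) (cst 1)) ;;
      incr 10)

/-- Compute prefix sums of the counts. -/
def prefixProg : Prog :=
  .assign 10 (cst 0) ;;
  .while (lt (rg 10) (rg 1))
    (.store 4 (ad (rg 10) (cst 1)) (ad (ld 4 (rg 10)) (ld 4 (ad (rg 10) (cst 1)))) ;; incr 10)

/-- Compute the order of the keys and the ranks. -/
def placeProg : Prog :=
  .assign 10 (cst 0) ;;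
  .while (lt (rg 10) (rg 0))
    (.assign 11 (ld 3 (rg 10)) ;;
      .assign 12 (ld 4 (rg 11)) ;;
      .store 5 (rg 12) (rg 10) ;;
      .store 6 (rg 10) (rg 12) ;;
      .store 4 (rg 11) (ad (rg 12) (cst 1)) ;;
      incr 10)

/-- Add the vertex in register `15` to the members of the node in register `16`. -/
def closeProg : Prog :=
  .store 14 (ad (ml (rg 16) (rg 0)) (ld 13 (rg 16))) (rg 15) ;;
  .store 13 (rg 16) (ad (ld 13 (rg 16)) (cst 1))

/-- Close the open piece in register `16` if it does not fit with the position in register `10`. -/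
def cutProg : Prog :=
  .assign 17 (ad (sb (rg 10) (ld 8 (rg 15))) (cst 1)) ;;
  .ite (ml (ml (lt (cst 0) (rg 16)) (lt (rg 17) (ad (rg 4) (cst 1))))
      (lt (ld 2 (ad (ad (ml (rg 17) (rg 0)) (ld 12 (rg 16))) (cst 1))) (ad (rg 5) (cst 1))))
    .skip
    (.ite (rg 16) closeProg .skip ;; .assign 16 (cst 0) ;; .store 8 (rg 15) (rg 10))

/-- Go from the node in register `16` to its child for the vertex in register `11`. -/
def childProg : Prog :=
  .assign 18 (ad (ml (rg 16) (rg 0)) (rg 11)) ;;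
  .ite (ld 9 (rg 18)) .skip
    (incr 7 ;;
      .store 9 (rg 18) (rg 7) ;;
      .store 10 (rg 7) (rg 16) ;;
      .store 11 (rg 7) (rg 11) ;;
      .store 12 (rg 7) (ad (ld 12 (rg 16)) (cst 1))) ;;
  .store 7 (rg 15) (ld 9 (rg 18))

/-- The vertex in register `15` reads its neighbour in register `11` at the position in register
`10`. -/
def pushProg : Prog := .assign 16 (ld 7 (rg 15)) ;; cutProg ;; childProg

/-- Decide whether the vertex in register `15` takes care of the edge to the vertex in register
`11` at the position in register `10`. -/
def handleProg : Prog :=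
  .ite (lt (rg 10) (rg 0))
    (.assign 14 (ml (lt (ld 6 (rg 15)) (rg 10))
      (lt (sb (ld 3 (rg 11)) (ld 3 (rg 15))) (ad (rg 6) (cst 1)))))
    (.assign 14 (ml (lt (sb (rg 10) (rg 0)) (ld 6 (rg 15)))
      (lt (rg 6) (sb (ld 3 (rg 15)) (ld 3 (rg 11))))))

/-- Go through the positions and build the pieces. -/
def mainProg : Prog :=
  .assign 10 (cst 0) ;;
  .while (lt (rg 10) (ad (rg 0) (rg 0)))
    (.assign 11 (ld 5 (md (rg 10) (rg 0))) ;;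
      .assign 12 (ld 0 (rg 11)) ;;
      .assign 13 (ld 0 (ad (rg 11) (cst 1))) ;;
      .while (lt (rg 12) (rg 13))
        (.assign 15 (ld 1 (rg 12)) ;;
          handleProg ;;
          .ite (rg 14) pushProg .skip ;;
          incr 12) ;;
      incr 10)

/-- Close the open pieces. -/
def flushProg : Prog :=
  .assign 15 (cst 0) ;;
  .while (lt (rg 15) (rg 0))
    (.assign 16 (ld 7 (rg 15)) ;; .ite (rg 16) closeProg .skip ;; incr 15)

/-- Print the biclique of the node in register `10`. -/
def emitNodeProg : Prog :=
  .emit (ld 12 (rg 10)) ;;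
  .assign 11 (rg 10) ;;
  .while (rg 11) (.emit (ld 11 (rg 11)) ;; .assign 11 (ld 10 (rg 11))) ;;
  .emit (ld 13 (rg 10)) ;;
  .assign 12 (cst 0) ;;
  .while (lt (rg 12) (ld 13 (rg 10)))
    (.emit (ld 14 (ad (ml (rg 10) (rg 0)) (rg 12))) ;; incr 12)

/-- Print the bicliques of all nodes with members. -/
def outputProg : Prog :=
  .assign 10 (cst 1) ;;
  .while (lt (rg 10) (ad (rg 7) (cst 1))) (.ite (ld 13 (rg 10)) emitNodeProg .skip ;; incr 10)

/-- The randomized algorithm. -/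
def bicliqueProg : Prog :=
  sizeProg ;; degreeProg ;; paramProg ;; tableProg ;; keyProg ;; countProg ;; prefixProg ;;
    placeProg ;; mainProg ;; flushProg ;; outputProg

/-! ### Correctness of the set-up: word size, degree bound and parameters. -/

variable {w : ℕ} {ω : ℕ → Bool}

theorem ite_one_zero_eq {p : Prop} [Decidable p] : ((if p then 1 else 0 : ℕ) = 0) ↔ ¬ p := by
  split_ifs <;> simp [*]

theorem op_and {p q : Prop} [Decidable p] [Decidable q] (h : 1 < 2 ^ w) :
    Op.mul.eval w (if p then 1 else 0) (if q then 1 else 0) = if p ∧ q then 1 else 0 := by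
  unfold Op.eval
  split_ifs <;> simp_all [Nat.mod_eq_of_lt h]

/-- Here and below, `n ^ 4 < 2 ^ w` guarantees that all intermediate results fit into a word, so
that the operations modulo `2 ^ w` agree with those on `ℕ`. The largest addresses are of order `n ^
3`. -/
theorem runs_sizeProg {n : ℕ} {s : State} (hn : 2 ≤ n) (hw : n ^ 4 < 2 ^ w) (h0 : s.reg 0 = n)
    (h2 : s.reg 2 = 0) :
    Runs w ω sizeProg s fun t s' => t ≤ 20 * Nat.size n + 20 ∧ Frame [1, 2] [] s s' ∧
      s'.reg 1 = 2 ^ Nat.size n ∧ s'.reg 2 = Nat.size n ∧ s'.flips = s.flips := by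
  have hw1 : 4 * n < 2 ^ w := by nlinarith [Nat.pow_le_pow_left hn 3]
  unfold sizeProg
  rw [runs_seq, runs_assign]
  refine (runs_while_const (fun i s' => Frame [1, 2] [] s s' ∧
      s'.reg 1 = 2 ^ i ∧ s'.reg 2 = i ∧ s'.flips = s.flips) (Nat.size n) 10 ?_ ?_ ?_).mono ?_
  · rintro i s' hi ⟨hF, h1, h2, hfl⟩
    have h0' : s'.reg 0 = n := by rw [hF.reg 0 (by simp) (by simp), h0]
    have hi' := Nat.lt_size.1 hi
    have hi2 : i ≤ n := Nat.lt_two_pow_self.le.trans hi'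
    simp (disch := omega) only [eval_op, eval_reg, eval_const, eval_load, op_add, op_sub, op_mul,
      op_div, op_mod, op_lt, op_and, ite_one_zero_eq, runs_seq, runs_assign, runs_store,
      runs_ite, runs_skip, runs_flip, runs_emit, Function.update_self, ne_eq, not_not,
      Function.update_of_ne, Expr.cost, true_and, and_true, h0', h1, h2]
    exact ⟨by omega, by omega, by (apply_rules [hF.set_flips, Frame.update_reg,
        Frame.update_mem] <;> simp), by ring, hfl⟩
  · rintro s' ⟨hF, h1, h2, hfl⟩
    have h0' : s'.reg 0 = n := by rw [hF.reg 0 (by simp) (by simp), h0]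
    have hi' : n < 2 ^ n.size := Nat.lt_size_self n
    simp (disch := omega) only [eval_op, eval_reg, eval_const, eval_load, op_add, op_sub, op_mul,
      op_div, op_mod, op_lt, op_and, ite_one_zero_eq, runs_seq, runs_assign, runs_store,
      runs_ite, runs_skip, runs_flip, runs_emit, Function.update_self, ne_eq, not_not,
      Function.update_of_ne, Expr.cost, true_and, and_true, h0', h1]
    omega
  · refine ⟨(Frame.refl _ _ _).update_reg (by simp), ?_, ?_, rfl⟩
    · simp [eval_const (show 1 < 2 ^ w by omega)]
    · simpa using h2
  · rintro t s' ⟨ht, h⟩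
    refine ⟨?_, h⟩
    simp [Expr.cost] at ht ⊢
    omega

/-- The smaller one of degree and co-degree, from the offsets of the adjacency lists. -/
def minDegree (n : ℕ) (off : ℕ → ℕ) (v : ℕ) : ℕ :=
  min (off (v + 1) - off v) (n - 1 - (off (v + 1) - off v))

theorem runs_degreeProg {n : ℕ} {s : State} {off : ℕ → ℕ} (hn : 2 ≤ n) (hw : n ^ 4 < 2 ^ w)
    (h0 : s.reg 0 = n) (h3 : s.reg 3 = 0) (hoff : s.mem 0 = off) (hle : ∀ v ≤ n, off v ≤ n ^ 2) :
    Runs w ω degreeProg s fun t s' => t ≤ 40 * n + 40 ∧ Frame [3] [] s s' ∧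
      s'.reg 3 = (Finset.range n).sup (minDegree n off) ∧ s'.flips = s.flips := by
  have hw1 : 4 * n < 2 ^ w := by nlinarith [Nat.pow_le_pow_left hn 3]
  have hw2 : n ^ 2 < 2 ^ w := (Nat.pow_le_pow_right (by omega) (by omega)).trans_lt hw
  unfold degreeProg
  rw [runs_seq, runs_assign]
  refine (runs_while_const (fun i s' => Frame [3] [] s s' ∧ s'.reg 10 = i ∧
      s'.reg 3 = (Finset.range i).sup (minDegree n off) ∧ s'.flips = s.flips) n 32 ?_ ?_ ?_).mono ?_
  · rintro i s' hi ⟨hF, h1, h2, hfl⟩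
    have h0' : s'.reg 0 = n := by rw [hF.reg 0 (by simp) (by simp), h0]
    have hm : s'.mem 0 = off := by rw [hF.mem 0 (by simp), hoff]
    have b1 := hle i hi.le
    have b2 := hle (i + 1) hi
    simp (disch := omega) only [eval_op, eval_reg, eval_const, eval_load, op_add, op_sub, op_mul,
      op_div, op_mod, op_lt, op_and, ite_one_zero_eq, runs_seq, runs_assign, runs_store,
      runs_ite, runs_skip, runs_flip, runs_emit, Function.update_self, ne_eq, not_not,
      Function.update_of_ne, Expr.cost, true_and, and_true, h0', h1, h2, hm]
    refine ⟨hi, ?_⟩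
    have hsup : (Finset.range (i + 1)).sup (minDegree n off) =
        max (minDegree n off i) ((Finset.range i).sup (minDegree n off)) := by
      rw [Finset.range_add_one, Finset.sup_insert]
    rw [hsup, minDegree]
    split_ifs <;> simp (disch := omega) only [eval_op, eval_reg, eval_const, eval_load, op_add,
        op_sub, op_mul,
      op_div, op_mod, op_lt, op_and, ite_one_zero_eq, runs_seq, runs_assign, runs_store,
      runs_ite, runs_skip, runs_flip, runs_emit, Function.update_self, ne_eq, not_not,
      Function.update_of_ne, Expr.cost, true_and, and_true, h1, h2, hfl]
    all_goals exact ⟨by omega, by (apply_rules [hF.set_flips, Frame.update_reg,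
        Frame.update_mem] <;> simp), by omega⟩
  · rintro s' ⟨hF, h1, h2, hfl⟩
    have h0' : s'.reg 0 = n := by rw [hF.reg 0 (by simp) (by simp), h0]
    simp (disch := omega) only [eval_op, eval_reg, eval_const, eval_load, op_add, op_sub, op_mul,
      op_div, op_mod, op_lt, op_and, ite_one_zero_eq, runs_seq, runs_assign, runs_store,
      runs_ite, runs_skip, runs_flip, runs_emit, Function.update_self, ne_eq, not_not,
      Function.update_of_ne, Expr.cost, true_and, and_true, h0', h1]
    omega
  · have hF := Frame.refl [3] [] s
    exact ⟨by (apply_rules [hF.set_flips, Frame.update_reg, Frame.update_mem] <;> simp),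
        by simp [Nat.zero_mod, Expr.eval], by simp [h3], rfl⟩
  · rintro t s' ⟨ht, hF, h1, h2⟩
    refine ⟨?_, hF, h2⟩
    simp [Expr.cost] at ht ⊢
    omega

theorem exists_lengthBound (n B : ℕ) : ∃ k, ¬ (k + 1 < B ∧ (k + 2) ^ 8 < n + 1) := ⟨B, by omega⟩

/-- The greatest length of a piece. -/
def lengthBound (n B : ℕ) : ℕ := Nat.find (exists_lengthBound n B) + 1

theorem one_le_lengthBound (n B : ℕ) : 1 ≤ lengthBound n B := Nat.le_add_left _ _

/-- The two reasons for which the loop for `K` can stop. -/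
theorem lengthBound_spec (n B : ℕ) : B ≤ lengthBound n B ∨ n < (lengthBound n B + 1) ^ 8 := by
  have := Nat.find_spec (exists_lengthBound n B)
  unfold lengthBound
  generalize Nat.find (exists_lengthBound n B) = k at *
  by_contra! h
  exact this ⟨h.1, Nat.lt_succ_of_le h.2⟩

theorem of_lt_lengthBound {n B k : ℕ} (h : k + 1 < lengthBound n B) :
    k + 1 < B ∧ (k + 2) ^ 8 < n + 1 := by
  unfold lengthBound at h
  have := Nat.find_min (exists_lengthBound n B) (show k < _ by omega)
  simpa using this

/-- The cap `K ^ 8 ≤ n` makes the table of binomial coefficients cost only `O(n)` and ensures `K ≤ n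
/ K ^ 5`, hence also `1 ≤ M`. -/
theorem lengthBound_pow_le {n : ℕ} (hn : 1 ≤ n) (B : ℕ) : lengthBound n B ^ 8 ≤ n := by
  rcases hk : lengthBound n B with _ | _ | k
  · simp
  · simpa using hn
  · have := (of_lt_lengthBound (n := n) (B := B) (k := k) (by omega)).2
    simpa [add_assoc] using Nat.lt_succ_iff.1 this

theorem lengthBound_le (n B : ℕ) : lengthBound n B ≤ max 1 B := by
  rcases hk : lengthBound n B with _ | _ | k
  · simp
  · simp
  · have := (of_lt_lengthBound (n := n) (B := B) (k := k) (by omega)).1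
    rw [le_max_iff]
    omega

theorem lengthBound_lt {n : ℕ} (hn : 2 ≤ n) (B : ℕ) : lengthBound n B < n := by
  have h := lengthBound_pow_le (n := n) (by omega) B
  have h1 := one_le_lengthBound n B
  by_contra! hle
  have h2 : n ^ 8 ≤ n := (Nat.pow_le_pow_left hle 8).trans h
  have h3 : n ^ 1 < n ^ 8 := Nat.pow_lt_pow_right (by omega) (by omega)
  rw [pow_one] at h3
  omega

theorem lengthBound_sq_le {n : ℕ} (hn : 2 ≤ n) (B : ℕ) : lengthBound n B ^ 2 ≤ n :=
  (Nat.pow_le_pow_right (one_le_lengthBound n B) (by omega)).trans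
    (lengthBound_pow_le (by omega) B)

theorem runs_paramProg {n Δ r : ℕ} {s : State} (hn : 16 ≤ n) (hw : n ^ 4 < 2 ^ w)
    (h0 : s.reg 0 = n) (h2 : s.reg 2 = r) (h3 : s.reg 3 = Δ) (hr : r ≤ n) (hΔ : Δ ≤ n) :
    Runs w ω paramProg s fun t s' => t ≤ 100 * n + 100 ∧ Frame [4, 5] [] s s' ∧
      s'.reg 4 = lengthBound n ((n / (Δ + 1) + 1) * r) ∧
      s'.reg 5 = n / lengthBound n ((n / (Δ + 1) + 1) * r) ^ 5 ∧ s'.flips = s.flips := by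
  have hn3 : n * 4096 ≤ n ^ 4 := by
    have := Nat.pow_le_pow_left hn 3
    calc n * 4096 = n * 16 ^ 3 := by norm_num
      _ ≤ n * n ^ 3 := Nat.mul_le_mul_left _ this
      _ = n ^ 4 := by ring
  set B := (n / (Δ + 1) + 1) * r with hB
  have hBw : B < 2 ^ w := by
    have h1 : n / (Δ + 1) ≤ n := Nat.div_le_self _ _
    calc B ≤ (n + 1) * n := Nat.mul_le_mul (by omega) hr
      _ ≤ n ^ 4 := by nlinarith [Nat.pow_le_pow_left hn 2]
      _ < 2 ^ w := hw
  have hdw : n / (Δ + 1) ≤ n := Nat.div_le_self _ _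
  have hKn := lengthBound_lt (n := n) (by omega) B
  -- The loop condition is also evaluated one step beyond the final value; the resulting factor `2 ^
  -- 8` is absorbed by the room between `n` and `n ^ 4`.
  have hpow : ∀ i, i < lengthBound n B → (i + 1 + 1) ^ 8 < 2 ^ w := by
    intro i hi
    have h1 : i + 1 + 1 ≤ 2 * lengthBound n B := by have := one_le_lengthBound n B; omega
    calc (i + 1 + 1) ^ 8 ≤ (2 * lengthBound n B) ^ 8 := Nat.pow_le_pow_left h1 8
      _ = 256 * lengthBound n B ^ 8 := by ring
      _ ≤ 256 * n := Nat.mul_le_mul_left _ (lengthBound_pow_le (by omega) B)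
      _ < 2 ^ w := by omega
  have hmul : ∀ x : ℕ, x ^ 8 < 2 ^ w → x * x < 2 ^ w ∧ x * x * (x * x) < 2 ^ w ∧
      x * x * (x * x) * x < 2 ^ w ∧ x * x * (x * x) * (x * x * (x * x)) < 2 ^ w := by
    intro x hx
    rcases Nat.eq_zero_or_pos x with rfl | hx0
    · simp
    · have h2 : x ^ 2 ≤ x ^ 8 := Nat.pow_le_pow_right hx0 (by omega)
      have h4 : x ^ 4 ≤ x ^ 8 := Nat.pow_le_pow_right hx0 (by omega)
      have h5 : x ^ 5 ≤ x ^ 8 := Nat.pow_le_pow_right hx0 (by omega)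
      refine ⟨?_, ?_, ?_, ?_⟩ <;> ring_nf <;> omega
  unfold paramProg
  simp (disch := omega) only [eval_op, eval_reg, eval_const, eval_load, op_add, op_sub, op_mul,
      op_div, op_mod, op_lt, op_and, ite_one_zero_eq, runs_seq, runs_assign, runs_store,
      runs_ite, runs_skip, runs_flip, runs_emit, Function.update_self, ne_eq, not_not,
      Function.update_of_ne, Expr.cost, true_and, and_true, h0, h2, h3]
  rw [← hB]
  -- Register `4` starts at `1`, so there is one iteration fewer than the final value of `K`.
  refine (runs_while_const (fun i s' => Frame [4, 5] [] s s' ∧ s'.reg 4 = i + 1 ∧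
    s'.reg 11 = B ∧ s'.flips = s.flips) (lengthBound n B - 1) 4 ?_ ?_ ?_).mono ?_
  · rintro i s' hi ⟨hF, h4, h11, hfl⟩
    have h0' : s'.reg 0 = n := by rw [hF.reg 0 (by simp) (by simp), h0]
    obtain ⟨m1, m2, -, m4⟩ := hmul _ (hpow i (by omega))
    have hlt := of_lt_lengthBound (n := n) (B := B) (k := i) (by omega)
    have e8 : (i + 1 + 1) * (i + 1 + 1) * ((i + 1 + 1) * (i + 1 + 1)) *
      ((i + 1 + 1) * (i + 1 + 1) * ((i + 1 + 1) * (i + 1 + 1))) = (i + 2) ^ 8 := by ring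
    simp (disch := omega) only [eval_op, eval_reg, eval_const, eval_load, op_add, op_sub, op_mul,
      op_div, op_mod, op_lt, op_and, ite_one_zero_eq, runs_seq, runs_assign, runs_store,
      runs_ite, runs_skip, runs_flip, runs_emit, Function.update_self, ne_eq, not_not,
      Function.update_of_ne, Expr.cost, true_and, and_true, h0', h4, h11, e8]
    exact ⟨hlt, by omega, by (apply_rules [hF.set_flips, Frame.update_reg,
        Frame.update_mem] <;> simp), hfl⟩
  · rintro s' ⟨hF, h4, h11, hfl⟩
    have h0' : s'.reg 0 = n := by rw [hF.reg 0 (by simp) (by simp), h0]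
    have h1 := one_le_lengthBound n B
    obtain ⟨m1, m2, -, m4⟩ := hmul _ (hpow (lengthBound n B - 1) (by omega))
    have e8 : (lengthBound n B - 1 + 1 + 1) * (lengthBound n B - 1 + 1 + 1) *
      ((lengthBound n B - 1 + 1 + 1) * (lengthBound n B - 1 + 1 + 1)) *
      ((lengthBound n B - 1 + 1 + 1) * (lengthBound n B - 1 + 1 + 1) *
      ((lengthBound n B - 1 + 1 + 1) * (lengthBound n B - 1 + 1 + 1))) =
        (lengthBound n B + 1) ^ 8 := by
      rw [Nat.sub_add_cancel h1]; ring
    have := lengthBound_spec n B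
    simp (disch := omega) only [eval_op, eval_reg, eval_const, eval_load, op_add, op_sub, op_mul,
      op_div, op_mod, op_lt, op_and, ite_one_zero_eq, runs_seq, runs_assign, runs_store,
      runs_ite, runs_skip, runs_flip, runs_emit, Function.update_self, ne_eq, not_not,
      Function.update_of_ne, Expr.cost, true_and, and_true, h0', h4, h11, e8]
    omega
  · have hF := Frame.refl [4, 5] [] s
    refine ⟨by (apply_rules [hF.set_flips, Frame.update_reg, Frame.update_mem] <;> simp), ?_, ?_,
        rfl⟩ <;> simp (disch := omega) only [eval_op, eval_reg, eval_const, eval_load, op_add,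
        op_sub, op_mul,
      op_div, op_mod, op_lt, op_and, ite_one_zero_eq, runs_seq, runs_assign, runs_store,
      runs_ite, runs_skip, runs_flip, runs_emit, Function.update_self, ne_eq, not_not,
      Function.update_of_ne, Expr.cost, true_and, and_true]
  · rintro t s' ⟨ht, hF, h4, h11, hfl⟩
    have h0' : s'.reg 0 = n := by rw [hF.reg 0 (by simp) (by simp), h0]
    have h1 := one_le_lengthBound n B
    rw [Nat.sub_add_cancel h1] at h4
    have hK8 : lengthBound n B ^ 8 < 2 ^ w := (lengthBound_pow_le (by omega) B).trans_lt (by omega)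
    obtain ⟨m1, m2, m3, -⟩ := hmul _ hK8
    have e5 : lengthBound n B * lengthBound n B * (lengthBound n B * lengthBound n B) *
      lengthBound n B = lengthBound n B ^ 5 := by ring
    simp (disch := omega) only [eval_op, eval_reg, eval_const, eval_load, op_add, op_sub, op_mul,
      op_div, op_mod, op_lt, op_and, ite_one_zero_eq, runs_seq, runs_assign, runs_store,
      runs_ite, runs_skip, runs_flip, runs_emit, Function.update_self, ne_eq, not_not,
      Function.update_of_ne, Expr.cost, true_and, and_true, h0', h4, e5]
    refine ⟨?_, by (apply_rules [hF.set_flips, Frame.update_reg, Frame.update_mem] <;> simp), hfl⟩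
    simp only [Expr.cost] at ht
    omega

end WordRAM

/-! ### The table of binomial coefficients, the keys and the counting sort. -/

set_option linter.unusedSimpArgs false
set_option linter.unnecessarySeqFocus false

namespace WordRAM

variable {w : ℕ} {ω : ℕ → Bool}

/-- Contents of bank `2` after the entries of row `i + 1` up to column `j` are computed. -/
def tableRow (n M i j a : ℕ) : ℕ :=
  if a / n ≤ i ∨ (a / n = i + 1 ∧ a % n ≤ j) then min ((a / n).choose (a % n)) (M + 1) else 0

theorem tableRow_apply {n M i j r c : ℕ} (hc : c < n) : tableRow n M i j (r * n + c) =
    if r ≤ i ∨ (r = i + 1 ∧ c ≤ j) then min (r.choose c) (M + 1) else 0 := by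
  have h1 : (r * n + c) / n = r := by
    rw [mul_comm, Nat.mul_add_div (by omega), Nat.div_eq_of_lt hc, add_zero]
  have h2 : (r * n + c) % n = c := by
    rw [mul_comm, Nat.mul_add_mod, Nat.mod_eq_of_lt hc]
  rw [tableRow, h1, h2]

theorem update_tableRow {n M i j : ℕ} (hj : j + 1 < n) {v : ℕ}
    (hv : v = min ((i + 1).choose (j + 1)) (M + 1)) :
    Function.update (tableRow n M i j) ((i + 1) * n + (j + 1)) v = tableRow n M i (j + 1) := by
  ext a
  have ha := Nat.div_add_mod' a n
  have hlt := Nat.mod_lt a (show 0 < n by omega)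
  rw [Function.update_apply]
  split_ifs with h
  · rw [h, tableRow_apply hj, if_pos (by simp), hv]
  · unfold tableRow
    have : ¬ (a / n = i + 1 ∧ a % n = j + 1) := by
      rintro ⟨h1, h2⟩
      rw [h1, h2] at ha
      exact h ha.symm
    congr 1
    apply propext
    generalize a / n = q at *
    generalize a % n = r at *
    omega

theorem tableRow_last {n M i : ℕ} : tableRow n M i (i + 1) = fun a =>
    if a / n ≤ i + 1 then min ((a / n).choose (a % n)) (M + 1) else 0 := by
  ext a
  unfold tableRow
  by_cases h : a / n = i + 1
  · rw [if_pos (by omega : a / n ≤ i + 1), h]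
    split_ifs with h1
    · rfl
    -- Columns that were never written hold `0`, which is the correct binomial coefficient there.
    · rw [Nat.choose_eq_zero_of_lt (by omega)]
      simp
  · congr 1
    apply propext
    generalize a / n = q at *
    omega

theorem update_tableRow_zero {n M i : ℕ} (hn : 0 < n) :
    Function.update (fun a => if a / n ≤ i then min ((a / n).choose (a % n)) (M + 1) else 0)
      ((i + 1) * n) 1 = tableRow n M i 0 := by
  ext a
  have ha := Nat.div_add_mod' a n
  rw [Function.update_apply]
  split_ifs with h h1
  · have := tableRow_apply (n := n) (M := M) (i := i) (j := 0) (r := i + 1) (c := 0) hn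
    rw [add_zero] at this
    rw [h, this]
    simp
  · rw [tableRow, if_pos (Or.inl h1)]
  · rw [tableRow, if_neg]
    rintro (h2 | ⟨h2, h3⟩)
    · exact h1 h2
    · rw [h2, Nat.le_zero.1 h3, add_zero] at ha
      exact h ha.symm

/-- Pascal's rule survives truncation at `M + 1`, and truncated values suffice because they are only
compared with `M`. The nested loops take `O(K ^ 2 + K)` steps, which is `O(n)` by `K ^ 2 ≤ n`. -/
theorem runs_tableProg {n K M : ℕ} {s : State} (hn : 2 ≤ n) (hw : n ^ 4 < 2 ^ w)
    (h0 : s.reg 0 = n) (h4 : s.reg 4 = K) (h5 : s.reg 5 = M) (hK : K < n) (hK2 : K ^ 2 ≤ n)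
    (hM : M ≤ n) (hm : s.mem 2 = fun _ => 0) :
    Runs w ω tableProg s fun t s' => t ≤ 200 * n + 100 ∧ Frame [] [2] s s' ∧
      (s'.mem 2 = fun a => if a / n ≤ K then min ((a / n).choose (a % n)) (M + 1) else 0) ∧
      s'.flips = s.flips := by
  have hn2 : n * 8 ≤ n ^ 4 := by
    calc n * 8 = n * 2 ^ 3 := by norm_num
      _ ≤ n * n ^ 3 := Nat.mul_le_mul_left _ (Nat.pow_le_pow_left hn 3)
      _ = n ^ 4 := by ring
  have hsq : 4 * n ^ 2 ≤ n ^ 4 := by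
    calc 4 * n ^ 2 = 2 ^ 2 * n ^ 2 := by norm_num
      _ ≤ n ^ 2 * n ^ 2 := Nat.mul_le_mul_right _ (Nat.pow_le_pow_left hn 2)
      _ = n ^ 4 := by ring
  unfold tableProg
  simp (disch := omega) only [eval_op, eval_reg, eval_const, eval_load, op_add, op_sub, op_mul,
      op_div, op_mod, op_lt, op_and, ite_one_zero_eq, runs_seq, runs_assign, runs_store,
      runs_ite, runs_skip, runs_flip, runs_emit, Function.update_self, ne_eq, not_not,
      Function.update_of_ne, Expr.cost, true_and, and_true]
  refine (runs_while (fun i s' => Frame [] [2] s s' ∧ s'.reg 10 = i ∧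
      (s'.mem 2 = fun a => if a / n ≤ i then min ((a / n).choose (a % n)) (M + 1) else 0) ∧
      s'.flips = s.flips) K (fun i => 42 * (i + 1) + 20) ?_ ?_ ?_).mono ?_
  · rintro i s' hi ⟨hF, h10, hm2, hfl⟩
    have h0' : s'.reg 0 = n := by rw [hF.reg 0 (by simp) (by simp), h0]
    have h4' : s'.reg 4 = K := by rw [hF.reg 4 (by simp) (by simp), h4]
    have hin : (i + 1) * n ≤ n ^ 2 := by rw [pow_two]; exact Nat.mul_le_mul_right _ (by omega)
    simp (disch := omega) only [eval_op, eval_reg, eval_const, eval_load, op_add, op_sub, op_mul,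
      op_div, op_mod, op_lt, op_and, ite_one_zero_eq, runs_seq, runs_assign, runs_store,
      runs_ite, runs_skip, runs_flip, runs_emit, Function.update_self, ne_eq, not_not,
      Function.update_of_ne, Expr.cost, true_and, and_true, h0', h4', h10, hm2]
    refine ⟨hi, ?_⟩
    refine (runs_while_const (fun j s'' => Frame [] [2] s s'' ∧ s''.reg 10 = i ∧
      s''.reg 11 = j ∧ s''.mem 2 = tableRow n M i j ∧ s''.flips = s.flips) (i + 1) 36
      ?_ ?_ ?_).mono ?_
    · rintro j s'' hj ⟨hF, h10, h11, hm2, hfl⟩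
      have h0' : s''.reg 0 = n := by rw [hF.reg 0 (by simp) (by simp), h0]
      have h5' : s''.reg 5 = M := by rw [hF.reg 5 (by simp) (by simp), h5]
      have hin' : (i + 1) * n = i * n + n := by ring
      have e1 : tableRow n M i j (i * n + j) = min (i.choose j) (M + 1) := by
        rw [tableRow_apply (by omega), if_pos (by simp)]
      have e2 : tableRow n M i j (i * n + j + 1) = min (i.choose (j + 1)) (M + 1) := by
        rw [add_assoc, tableRow_apply (by omega), if_pos (by simp)]
      have e3 : i * n + j + n + 1 = (i + 1) * n + (j + 1) := by ring
      have e4 := Nat.choose_succ_succ' i j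
      simp (disch := omega) only [eval_op, eval_reg, eval_const, eval_load, op_add, op_sub, op_mul,
      op_div, op_mod, op_lt, op_and, ite_one_zero_eq, runs_seq, runs_assign, runs_store,
      runs_ite, runs_skip, runs_flip, runs_emit, Function.update_self, ne_eq, not_not,
      Function.update_of_ne, Expr.cost, true_and, and_true, h0', h5', h10, h11, hm2, e1, e2]
      refine ⟨hj, ?_⟩
      split_ifs <;> simp (disch := omega) only [eval_op, eval_reg, eval_const, eval_load, op_add,
          op_sub, op_mul,
      op_div, op_mod, op_lt, op_and, ite_one_zero_eq, runs_seq, runs_assign, runs_store,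
      runs_ite, runs_skip, runs_flip, runs_emit, Function.update_self, ne_eq, not_not,
      Function.update_of_ne, Expr.cost, true_and, and_true, h0', h11, hm2, h5', hfl, e3]
      all_goals exact ⟨by omega, by (apply_rules [hF.set_flips, Frame.update_reg,
          Frame.update_mem] <;> simp), by rw [update_tableRow (by omega) (by omega)]⟩
    · rintro s'' ⟨hF, h10, h11, hm2, hfl⟩
      simp (disch := omega) only [eval_op, eval_reg, eval_const, eval_load, op_add, op_sub, op_mul,
      op_div, op_mod, op_lt, op_and, ite_one_zero_eq, runs_seq, runs_assign, runs_store,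
      runs_ite, runs_skip, runs_flip, runs_emit, Function.update_self, ne_eq, not_not,
      Function.update_of_ne, Expr.cost, true_and, and_true, h10, h11]
      omega
    · exact ⟨by (apply_rules [hF.set_flips, Frame.update_reg, Frame.update_mem] <;> simp), h10, rfl,
          update_tableRow_zero (by omega), hfl⟩
    · rintro t s'' ⟨ht, hF, h10, h11, hm2, hfl⟩
      simp (disch := omega) only [eval_op, eval_reg, eval_const, eval_load, op_add, op_sub, op_mul,
      op_div, op_mod, op_lt, op_and, ite_one_zero_eq, runs_seq, runs_assign, runs_store,
      runs_ite, runs_skip, runs_flip, runs_emit, Function.update_self, ne_eq, not_not,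
      Function.update_of_ne, Expr.cost, true_and, and_true, h10]
      simp only [Expr.cost] at ht
      exact ⟨by omega, by (apply_rules [hF.set_flips, Frame.update_reg, Frame.update_mem] <;> simp),
          by rw [hm2, tableRow_last], hfl⟩
  · rintro s' ⟨hF, h10, hm2, hfl⟩
    have h4' : s'.reg 4 = K := by rw [hF.reg 4 (by simp) (by simp), h4]
    simp (disch := omega) only [eval_op, eval_reg, eval_const, eval_load, op_add, op_sub, op_mul,
      op_div, op_mod, op_lt, op_and, ite_one_zero_eq, runs_seq, runs_assign, runs_store,
      runs_ite, runs_skip, runs_flip, runs_emit, Function.update_self, ne_eq, not_not,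
      Function.update_of_ne, Expr.cost, true_and, and_true, h4', h10]
    omega
  · have hF := Frame.refl [] [2] s
    refine ⟨by (apply_rules [hF.set_flips, Frame.update_reg, Frame.update_mem] <;> simp),
        by simp (disch := omega) only [eval_op, eval_reg, eval_const, eval_load, op_add, op_sub,
        op_mul,
      op_div, op_mod, op_lt, op_and, ite_one_zero_eq, runs_seq, runs_assign, runs_store,
      runs_ite, runs_skip, runs_flip, runs_emit, Function.update_self, ne_eq, not_not,
      Function.update_of_ne, Expr.cost, true_and, and_true], ?_, rfl⟩
    ext a
    simp only [hm, Function.update_self, Nat.le_zero]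
    rw [Function.update_apply]
    split_ifs with h1 h2 h2
    · simp [h1]
    · simp [h1] at h2
    · rw [Nat.div_eq_zero_iff] at h2
      rw [Nat.mod_eq_of_lt (by omega), Nat.div_eq_of_lt (by omega),
        Nat.choose_eq_zero_of_lt (by omega)]
      simp
    · rfl
  · rintro t s' ⟨ht, hF, h10, hm2, hfl⟩
    refine ⟨?_, hF, hm2, hfl⟩
    have hsum : ∑ i ∈ Finset.range K, (42 * (i + 1) + 20 + (lt (rg 10) (rg 4)).cost + 1) ≤
        K * (42 * K + 24) := by
      refine (Finset.sum_le_card_nsmul _ _ (42 * K + 24) ?_).trans_eq (by simp)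
      intro i hi
      rw [Finset.mem_range] at hi
      simp only [Expr.cost]
      omega
    have : K * (42 * K + 24) = 42 * K ^ 2 + 24 * K := by ring
    simp only [Expr.cost] at ht hsum
    omega

/-- The number with the `i` binary digits that `ω` has from place `k` on. -/
def bitsValue (ω : ℕ → Bool) (k : ℕ) : ℕ → ℕ
  | 0 => 0
  | i + 1 => bitsValue ω k i + bitsValue ω k i + if ω (k + i) then 1 else 0

theorem bitsValue_lt (ω : ℕ → Bool) (k i : ℕ) : bitsValue ω k i < 2 ^ i := by
  induction i with
  | zero => simp [bitsValue]
  | succ i ih =>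
    rw [bitsValue, pow_succ]
    split_ifs <;> omega

theorem runs_degreeKeyProg {n : ℕ} {s : State} {off : ℕ → ℕ} (hn : 2 ≤ n) (hw : n ^ 4 < 2 ^ w)
    (h0 : s.reg 0 = n) (hoff : s.mem 0 = off) (hle : ∀ v ≤ n, off v ≤ n ^ 2) :
    Runs w ω degreeKeyProg s fun t s' => t ≤ 30 * n + 30 ∧ Frame [6] [3] s s' ∧
      (∀ v < n, s'.mem 3 v = off (v + 1) - off v) ∧ s'.reg 6 = s.reg 1 := by
  have hw1 : 4 * n < 2 ^ w := by nlinarith [Nat.pow_le_pow_left hn 3]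
  have hw2 : n ^ 2 < 2 ^ w := (Nat.pow_le_pow_right (by omega) (by omega)).trans_lt hw
  unfold degreeKeyProg
  simp (disch := omega) only [eval_op, eval_reg, eval_const, eval_load, op_add, op_sub, op_mul,
      op_div, op_mod, op_lt, op_and, ite_one_zero_eq, runs_seq, runs_assign, runs_store,
      runs_ite, runs_skip, runs_flip, runs_emit, Function.update_self, ne_eq, not_not,
      Function.update_of_ne, Expr.cost, true_and, and_true]
  refine (runs_while_const (fun i s' => Frame [6] [3] s s' ∧ s'.reg 10 = i ∧
      ∀ v < i, s'.mem 3 v = off (v + 1) - off v) n 20 ?_ ?_ ?_).mono ?_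
  · rintro i s' hi ⟨hF, h10, hm⟩
    have h0' : s'.reg 0 = n := by rw [hF.reg 0 (by simp) (by simp), h0]
    have hm0 : s'.mem 0 = off := by rw [hF.mem 0 (by simp), hoff]
    have b1 := hle i hi.le
    have b2 := hle (i + 1) hi
    simp (disch := omega) only [eval_op, eval_reg, eval_const, eval_load, op_add, op_sub, op_mul,
      op_div, op_mod, op_lt, op_and, ite_one_zero_eq, runs_seq, runs_assign, runs_store,
      runs_ite, runs_skip, runs_flip, runs_emit, Function.update_self, ne_eq, not_not,
      Function.update_of_ne, Expr.cost, true_and, and_true, h0', h10, hm0]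
    refine ⟨hi, by omega, by (apply_rules [hF.set_flips, Frame.update_reg,
        Frame.update_mem] <;> simp), ?_⟩
    intro v hv
    rcases Nat.lt_succ_iff_lt_or_eq.1 hv with hv | rfl
    · rw [Function.update_of_ne (by omega), hm v hv]
    · rw [Function.update_self]
  · rintro s' ⟨hF, h10, hm⟩
    have h0' : s'.reg 0 = n := by rw [hF.reg 0 (by simp) (by simp), h0]
    simp (disch := omega) only [eval_op, eval_reg, eval_const, eval_load, op_add, op_sub, op_mul,
      op_div, op_mod, op_lt, op_and, ite_one_zero_eq, runs_seq, runs_assign, runs_store,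
      runs_ite, runs_skip, runs_flip, runs_emit, Function.update_self, ne_eq, not_not,
      Function.update_of_ne, Expr.cost, true_and, and_true, h0', h10]
    omega
  · have hF := Frame.refl [6] [3] s
    exact ⟨by (apply_rules [hF.set_flips, Frame.update_reg, Frame.update_mem] <;> simp),
        by simp (disch := omega) only [eval_op, eval_reg, eval_const, eval_load, op_add, op_sub,
        op_mul,
      op_div, op_mod, op_lt, op_and, ite_one_zero_eq, runs_seq, runs_assign, runs_store,
      runs_ite, runs_skip, runs_flip, runs_emit, Function.update_self, ne_eq, not_not,
      Function.update_of_ne, Expr.cost, true_and, and_true], by simp⟩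
  · rintro t s' ⟨ht, hF, h10, hm⟩
    have h1' : s'.reg 1 = s.reg 1 := hF.reg 1 (by simp) (by simp)
    simp (disch := omega) only [eval_op, eval_reg, eval_const, eval_load, op_add, op_sub, op_mul,
      op_div, op_mod, op_lt, op_and, ite_one_zero_eq, runs_seq, runs_assign, runs_store,
      runs_ite, runs_skip, runs_flip, runs_emit, Function.update_self, ne_eq, not_not,
      Function.update_of_ne, Expr.cost, true_and, and_true, h1']
    simp only [Expr.cost] at ht
    exact ⟨by omega, by (apply_rules [hF.set_flips, Frame.update_reg, Frame.update_mem] <;> simp),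
        hm⟩

/-- No bit has been used before, so the key of `v` is read from the bits `v * r, …, v * r + r - 1`.
These blocks are disjoint for different vertices, which makes the keys independent. -/
theorem runs_randomKeyProg {n r : ℕ} {s : State} (hn : 2 ≤ n) (hw : n ^ 4 < 2 ^ w)
    (h0 : s.reg 0 = n) (h1 : s.reg 1 = 2 ^ r) (h2 : s.reg 2 = r) (hr : 2 ^ r ≤ 2 * n)
    (hfl : s.flips = 0) :
    Runs w ω randomKeyProg s fun t s' => t ≤ 20 * (n * r) + 40 * n + 30 ∧ Frame [6] [3] s s' ∧
      (∀ v < n, s'.mem 3 v = bitsValue ω (v * r) r) ∧ s'.reg 6 = 2 ^ r / 2 := by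
  have hw1 : 4 * n < 2 ^ w := by nlinarith [Nat.pow_le_pow_left hn 3]
  have hr2 : r < 2 ^ r := Nat.lt_two_pow_self
  unfold randomKeyProg
  simp (disch := omega) only [eval_op, eval_reg, eval_const, eval_load, op_add, op_sub, op_mul,
      op_div, op_mod, op_lt, op_and, ite_one_zero_eq, runs_seq, runs_assign, runs_store,
      runs_ite, runs_skip, runs_flip, runs_emit, Function.update_self, ne_eq, not_not,
      Function.update_of_ne, Expr.cost, true_and, and_true]
  refine (runs_while_const (fun i s' => Frame [6] [3] s s' ∧ s'.reg 10 = i ∧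
      s'.flips = i * r ∧ ∀ v < i, s'.mem 3 v = bitsValue ω (v * r) r) n (20 * r + 26)
      ?_ ?_ ?_).mono ?_
  · rintro i s' hi ⟨hF, h10, hfl, hm⟩
    have h0' : s'.reg 0 = n := by rw [hF.reg 0 (by simp) (by simp), h0]
    simp (disch := omega) only [eval_op, eval_reg, eval_const, eval_load, op_add, op_sub, op_mul,
      op_div, op_mod, op_lt, op_and, ite_one_zero_eq, runs_seq, runs_assign, runs_store,
      runs_ite, runs_skip, runs_flip, runs_emit, Function.update_self, ne_eq, not_not,
      Function.update_of_ne, Expr.cost, true_and, and_true, h0', h10]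
    refine ⟨hi, ?_⟩
    refine (runs_while_const (fun j s' => Frame [6] [3] s s' ∧ s'.reg 10 = i ∧
      s'.flips = i * r + j ∧ s'.reg 11 = bitsValue ω (i * r) j ∧ s'.reg 12 = j ∧
      ∀ v < i, s'.mem 3 v = bitsValue ω (v * r) r) r 14 ?_ ?_ ?_).mono ?_
    · rintro j s' hj ⟨hF, h10, hfl, h11, h12, hm⟩
      have h2' : s'.reg 2 = r := by rw [hF.reg 2 (by simp) (by simp), h2]
      have hb := bitsValue_lt ω (i * r) (j + 1)
      have hb' : 2 ^ (j + 1) ≤ 2 ^ r := Nat.pow_le_pow_right (by omega) hj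
      rw [bitsValue] at hb
      have hbit : (if ω (i * r + j) = true then 1 else 0) % 2 ^ w =
          if ω (i * r + j) = true then 1 else 0 := Nat.mod_eq_of_lt (by split_ifs <;> omega)
      simp (disch := omega) only [eval_op, eval_reg, eval_const, eval_load, op_add, op_sub, op_mul,
      op_div, op_mod, op_lt, op_and, ite_one_zero_eq, runs_seq, runs_assign, runs_store,
      runs_ite, runs_skip, runs_flip, runs_emit, Function.update_self, ne_eq, not_not,
      Function.update_of_ne, Expr.cost, true_and, and_true, h2', h10, h11, h12, hfl, hbit,
          bitsValue]
      exact ⟨hj, by omega, by (apply_rules [hF.set_flips, Frame.update_reg,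
          Frame.update_mem] <;> simp), by omega, hm⟩
    · rintro s' ⟨hF, h10, hfl, h11, h12, hm⟩
      have h2' : s'.reg 2 = r := by rw [hF.reg 2 (by simp) (by simp), h2]
      simp (disch := omega) only [eval_op, eval_reg, eval_const, eval_load, op_add, op_sub, op_mul,
      op_div, op_mod, op_lt, op_and, ite_one_zero_eq, runs_seq, runs_assign, runs_store,
      runs_ite, runs_skip, runs_flip, runs_emit, Function.update_self, ne_eq, not_not,
      Function.update_of_ne, Expr.cost, true_and, and_true, h2', h12]
      omega
    · exact ⟨by (apply_rules [hF.set_flips, Frame.update_reg, Frame.update_mem] <;> simp), h10, hfl,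
          by simp (disch := omega) only [eval_op, eval_reg, eval_const, eval_load, op_add, op_sub,
          op_mul,
      op_div, op_mod, op_lt, op_and, ite_one_zero_eq, runs_seq, runs_assign, runs_store,
      runs_ite, runs_skip, runs_flip, runs_emit, Function.update_self, ne_eq, not_not,
      Function.update_of_ne, Expr.cost, true_and, and_true, bitsValue], by simp (disch :=
          omega) only [eval_op, eval_reg, eval_const, eval_load, op_add, op_sub, op_mul,
      op_div, op_mod, op_lt, op_and, ite_one_zero_eq, runs_seq, runs_assign, runs_store,
      runs_ite, runs_skip, runs_flip, runs_emit, Function.update_self, ne_eq, not_not,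
      Function.update_of_ne, Expr.cost, true_and, and_true], hm⟩
    · rintro t s' ⟨ht, hF, h10, hfl, h11, h12, hm⟩
      simp (disch := omega) only [eval_op, eval_reg, eval_const, eval_load, op_add, op_sub, op_mul,
      op_div, op_mod, op_lt, op_and, ite_one_zero_eq, runs_seq, runs_assign, runs_store,
      runs_ite, runs_skip, runs_flip, runs_emit, Function.update_self, ne_eq, not_not,
      Function.update_of_ne, Expr.cost, true_and, and_true, h10, h11, hfl]
      simp only [Expr.cost] at ht
      refine ⟨by omega, by (apply_rules [hF.set_flips, Frame.update_reg,
          Frame.update_mem] <;> simp), by ring, ?_⟩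
      intro v hv
      rcases Nat.lt_succ_iff_lt_or_eq.1 hv with hv | rfl
      · rw [Function.update_of_ne (by omega), hm v hv]
      · rw [Function.update_self]
  · rintro s' ⟨hF, h10, hfl, hm⟩
    have h0' : s'.reg 0 = n := by rw [hF.reg 0 (by simp) (by simp), h0]
    simp (disch := omega) only [eval_op, eval_reg, eval_const, eval_load, op_add, op_sub, op_mul,
      op_div, op_mod, op_lt, op_and, ite_one_zero_eq, runs_seq, runs_assign, runs_store,
      runs_ite, runs_skip, runs_flip, runs_emit, Function.update_self, ne_eq, not_not,
      Function.update_of_ne, Expr.cost, true_and, and_true, h0', h10]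
    omega
  · have hF := Frame.refl [6] [3] s
    exact ⟨by (apply_rules [hF.set_flips, Frame.update_reg, Frame.update_mem] <;> simp),
        by simp (disch := omega) only [eval_op, eval_reg, eval_const, eval_load, op_add, op_sub,
        op_mul,
      op_div, op_mod, op_lt, op_and, ite_one_zero_eq, runs_seq, runs_assign, runs_store,
      runs_ite, runs_skip, runs_flip, runs_emit, Function.update_self, ne_eq, not_not,
      Function.update_of_ne, Expr.cost, true_and, and_true], by simpa using hfl, by simp⟩
  · rintro t s' ⟨ht, hF, h10, hfl, hm⟩
    have h1' : s'.reg 1 = 2 ^ r := by rw [hF.reg 1 (by simp) (by simp), h1]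
    simp (disch := omega) only [eval_op, eval_reg, eval_const, eval_load, op_add, op_sub, op_mul,
      op_div, op_mod, op_lt, op_and, ite_one_zero_eq, runs_seq, runs_assign, runs_store,
      runs_ite, runs_skip, runs_flip, runs_emit, Function.update_self, ne_eq, not_not,
      Function.update_of_ne, Expr.cost, true_and, and_true, h1']
    simp only [Expr.cost] at ht
    refine ⟨?_, by (apply_rules [hF.set_flips, Frame.update_reg, Frame.update_mem] <;> simp), hm⟩
    have : n * (20 * r + 26 + (1 + 1 + 1) + 1) = 20 * (n * r) + 30 * n := by ring
    omega

/-- Contents of bank `3` after `keyProg`. -/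
def keyValue (ω : ℕ → Bool) (n : ℕ) (off : ℕ → ℕ) (v : ℕ) : ℕ :=
  if off n < n * Nat.size n then off (v + 1) - off v else bitsValue ω (v * Nat.size n) (Nat.size n)

/-- Contents of register `6` after `keyProg`. -/
def keyRange (n : ℕ) (off : ℕ → ℕ) : ℕ :=
  if off n < n * Nat.size n then 2 ^ Nat.size n else 2 ^ Nat.size n / 2

/-- Random keys take about `n * Nat.size n` steps. They are drawn only if the adjacency lists have
at least that total length, so the time stays linear in the input. -/
theorem runs_keyProg {n : ℕ} {s : State} {off : ℕ → ℕ} (hn : 2 ≤ n) (hw : n ^ 4 < 2 ^ w)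
    (h0 : s.reg 0 = n) (h1 : s.reg 1 = 2 ^ Nat.size n) (h2 : s.reg 2 = Nat.size n)
    (hoff : s.mem 0 = off) (hle : ∀ v ≤ n, off v ≤ n ^ 2) (hr : 2 ^ Nat.size n ≤ 2 * n)
    (hfl : s.flips = 0) :
    Runs w ω keyProg s fun t s' => t ≤ 20 * off n + 40 * n + 50 ∧ Frame [6] [3] s s' ∧
      (∀ v < n, s'.mem 3 v = keyValue ω n off v) ∧ s'.reg 6 = keyRange n off := by
  have hw1 : 4 * n < 2 ^ w := by nlinarith [Nat.pow_le_pow_left hn 3]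
  have hr2 : Nat.size n < 2 ^ Nat.size n := Nat.lt_two_pow_self
  have hw2 : 4 * n ^ 2 ≤ n ^ 4 := by
    calc 4 * n ^ 2 = 2 ^ 2 * n ^ 2 := by norm_num
      _ ≤ n ^ 2 * n ^ 2 := Nat.mul_le_mul_right _ (Nat.pow_le_pow_left hn 2)
      _ = n ^ 4 := by ring
  have hns : n * Nat.size n ≤ 2 * n ^ 2 := by
    calc n * Nat.size n ≤ n * (2 * n) := Nat.mul_le_mul_left _ (by omega)
      _ = 2 * n ^ 2 := by ring
  unfold keyProg
  simp (disch := omega) only [eval_op, eval_reg, eval_const, eval_load, op_add, op_sub, op_mul,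
      op_div, op_mod, op_lt, op_and, ite_one_zero_eq, runs_seq, runs_assign, runs_store,
      runs_ite, runs_skip, runs_flip, runs_emit, Function.update_self, ne_eq, not_not,
      Function.update_of_ne, Expr.cost, true_and, and_true, h0, h2, hoff]
  by_cases h : off n < n * Nat.size n
  · rw [if_pos h]
    refine (runs_degreeKeyProg hn hw h0 hoff hle).mono ?_
    rintro t s' ⟨ht, hF, hm, h6⟩
    simp only [keyValue, keyRange, if_pos h]
    exact ⟨by omega, hF, hm, h6.trans h1⟩
  · rw [if_neg h]
    refine (runs_randomKeyProg hn hw h0 h1 h2 hr hfl).mono ?_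
    rintro t s' ⟨ht, hF, hm, h6⟩
    simp only [keyValue, keyRange, if_neg h]
    exact ⟨by omega, hF, hm, h6⟩

/-- First pass of a counting sort. A key is counted one cell later, so that the prefix sums give the
number of strictly smaller keys, the first free place for that key. -/
theorem runs_countProg {n S : ℕ} {s : State} {kf : ℕ → ℕ} (hn : 2 ≤ n) (hw : n ^ 4 < 2 ^ w)
    (hS : S ≤ 2 * n) (h0 : s.reg 0 = n) (hk : ∀ v < n, s.mem 3 v = kf v) (hkS : ∀ v < n, kf v < S)
    (hm4 : s.mem 4 = fun _ => 0) :
    Runs w ω countProg s fun t s' => t ≤ 30 * n + 30 ∧ Frame [] [4] s s' ∧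
      s'.mem 4 = fun a => ((Finset.range n).filter fun u => kf u + 1 = a).card := by
  have hw1 : 4 * n < 2 ^ w := by nlinarith [Nat.pow_le_pow_left hn 3]
  unfold countProg
  simp (disch := omega) only [eval_op, eval_reg, eval_const, eval_load, op_add, op_sub, op_mul,
      op_div, op_mod, op_lt, op_and, ite_one_zero_eq, runs_seq, runs_assign, runs_store,
      runs_ite, runs_skip, runs_flip, runs_emit, Function.update_self, ne_eq, not_not,
      Function.update_of_ne, Expr.cost, true_and, and_true]
  refine (runs_while_const (fun i s' => Frame [] [4] s s' ∧ s'.reg 10 = i ∧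
      s'.mem 4 = fun a => ((Finset.range i).filter fun u => kf u + 1 = a).card) n 20
      ?_ ?_ ?_).mono ?_
  · rintro i s' hi ⟨hF, h10, hm⟩
    have h0' : s'.reg 0 = n := by rw [hF.reg 0 (by simp) (by simp), h0]
    have h3 : s'.mem 3 i = kf i := by rw [hF.mem 3 (by simp), hk i hi]
    have b1 := hkS i hi
    have b2 : ((Finset.range i).filter fun u => kf u + 1 = kf i + 1).card ≤ i :=
      (Finset.card_filter_le _ _).trans_eq (by simp)
    simp (disch := omega) only [eval_op, eval_reg, eval_const, eval_load, op_add, op_sub, op_mul,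
      op_div, op_mod, op_lt, op_and, ite_one_zero_eq, runs_seq, runs_assign, runs_store,
      runs_ite, runs_skip, runs_flip, runs_emit, Function.update_self, ne_eq, not_not,
      Function.update_of_ne, Expr.cost, true_and, and_true, h0', h10, h3, hm]
    refine ⟨hi, by omega, by (apply_rules [hF.set_flips, Frame.update_reg,
        Frame.update_mem] <;> simp), ?_⟩
    ext a
    rw [Function.update_apply, Finset.range_add_one, Finset.filter_insert]
    split_ifs with h1 h2 h2
    · rw [Finset.card_insert_of_notMem (by simp), h1]
    · exact absurd h1.symm h2
    · exact absurd h2.symm h1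
    · rfl
  · rintro s' ⟨hF, h10, hm⟩
    have h0' : s'.reg 0 = n := by rw [hF.reg 0 (by simp) (by simp), h0]
    simp (disch := omega) only [eval_op, eval_reg, eval_const, eval_load, op_add, op_sub, op_mul,
      op_div, op_mod, op_lt, op_and, ite_one_zero_eq, runs_seq, runs_assign, runs_store,
      runs_ite, runs_skip, runs_flip, runs_emit, Function.update_self, ne_eq, not_not,
      Function.update_of_ne, Expr.cost, true_and, and_true, h0', h10]
    omega
  · have hF := Frame.refl [] [4] s
    exact ⟨by (apply_rules [hF.set_flips, Frame.update_reg, Frame.update_mem] <;> simp),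
        by simp (disch := omega) only [eval_op, eval_reg, eval_const, eval_load, op_add, op_sub,
        op_mul,
      op_div, op_mod, op_lt, op_and, ite_one_zero_eq, runs_seq, runs_assign, runs_store,
      runs_ite, runs_skip, runs_flip, runs_emit, Function.update_self, ne_eq, not_not,
      Function.update_of_ne, Expr.cost, true_and, and_true], by simp [hm4]⟩
  · rintro t s' ⟨ht, hF, h10, hm⟩
    simp only [Expr.cost] at ht ⊢
    exact ⟨by omega, hF, hm⟩

theorem runs_prefixProg {n S : ℕ} {s : State} {kf : ℕ → ℕ} (hn : 2 ≤ n) (hw : n ^ 4 < 2 ^ w)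
    (hS : S ≤ 2 * n) (h1 : s.reg 1 = S)
    (hm4 : s.mem 4 = fun a => ((Finset.range n).filter fun u => kf u + 1 = a).card) :
    Runs w ω prefixProg s fun t s' => t ≤ 60 * n + 30 ∧ Frame [] [4] s s' ∧
      ∀ a ≤ S, s'.mem 4 a = ((Finset.range n).filter fun u => kf u < a).card := by
  have hw1 : 4 * n < 2 ^ w := by nlinarith [Nat.pow_le_pow_left hn 3]
  unfold prefixProg
  simp (disch := omega) only [eval_op, eval_reg, eval_const, eval_load, op_add, op_sub, op_mul,
      op_div, op_mod, op_lt, op_and, ite_one_zero_eq, runs_seq, runs_assign, runs_store,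
      runs_ite, runs_skip, runs_flip, runs_emit, Function.update_self, ne_eq, not_not,
      Function.update_of_ne, Expr.cost, true_and, and_true]
  refine (runs_while_const (fun i s' => Frame [] [4] s s' ∧ s'.reg 10 = i ∧
      s'.mem 4 = fun a => if a ≤ i then ((Finset.range n).filter fun u => kf u < a).card else
        ((Finset.range n).filter fun u => kf u + 1 = a).card) S 20
      ?_ ?_ ?_).mono ?_
  · rintro i s' hi ⟨hF, h10, hm⟩
    have h1' : s'.reg 1 = S := by rw [hF.reg 1 (by simp) (by simp), h1]
    have hsum : ((Finset.range n).filter fun u => kf u < i).card +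
        ((Finset.range n).filter fun u => kf u + 1 = i + 1).card =
        ((Finset.range n).filter fun u => kf u < i + 1).card := by
      rw [← Finset.card_union_of_disjoint]
      · congr 1
        ext u
        simp only [Finset.mem_union, Finset.mem_filter, Finset.mem_range]
        omega
      · rw [Finset.disjoint_filter]
        intros
        omega
    have b2 : ((Finset.range n).filter fun u => kf u < i + 1).card ≤ n :=
      (Finset.card_filter_le _ _).trans_eq (by simp)
    have e1 : (if i ≤ i then ((Finset.range n).filter fun u => kf u < i).card else
      ((Finset.range n).filter fun u => kf u + 1 = i).card) =
        ((Finset.range n).filter fun u => kf u < i).card := if_pos le_rfl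
    have e2 : (if i + 1 ≤ i then ((Finset.range n).filter fun u => kf u < i + 1).card else
      ((Finset.range n).filter fun u => kf u + 1 = i + 1).card) =
        ((Finset.range n).filter fun u => kf u + 1 = i + 1).card := if_neg (by omega)
    simp (disch := omega) only [eval_op, eval_reg, eval_const, eval_load, op_add, op_sub, op_mul,
      op_div, op_mod, op_lt, op_and, ite_one_zero_eq, runs_seq, runs_assign, runs_store,
      runs_ite, runs_skip, runs_flip, runs_emit, Function.update_self, ne_eq, not_not,
      Function.update_of_ne, Expr.cost, true_and, and_true, h1', h10, hm, e1, e2]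
    refine ⟨hi, by omega, by (apply_rules [hF.set_flips, Frame.update_reg,
        Frame.update_mem] <;> simp), ?_⟩
    ext a
    rw [Function.update_apply]
    split_ifs with h1 h2 h3 h2 h3
    · rw [h1, hsum]
    · omega
    · rfl
    · omega
    · omega
    · rfl
  · rintro s' ⟨hF, h10, hm⟩
    have h1' : s'.reg 1 = S := by rw [hF.reg 1 (by simp) (by simp), h1]
    simp (disch := omega) only [eval_op, eval_reg, eval_const, eval_load, op_add, op_sub, op_mul,
      op_div, op_mod, op_lt, op_and, ite_one_zero_eq, runs_seq, runs_assign, runs_store,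
      runs_ite, runs_skip, runs_flip, runs_emit, Function.update_self, ne_eq, not_not,
      Function.update_of_ne, Expr.cost, true_and, and_true, h1', h10]
    omega
  · have hF := Frame.refl [] [4] s
    refine ⟨by (apply_rules [hF.set_flips, Frame.update_reg, Frame.update_mem] <;> simp),
        by simp (disch := omega) only [eval_op, eval_reg, eval_const, eval_load, op_add, op_sub,
        op_mul,
      op_div, op_mod, op_lt, op_and, ite_one_zero_eq, runs_seq, runs_assign, runs_store,
      runs_ite, runs_skip, runs_flip, runs_emit, Function.update_self, ne_eq, not_not,
      Function.update_of_ne, Expr.cost, true_and, and_true], ?_⟩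
    simp only [hm4]
    ext a
    split_ifs with h
    · rw [Nat.le_zero.1 h]
      simp
    · rfl
  · rintro t s' ⟨ht, hF, h10, hm⟩
    simp only [Expr.cost] at ht ⊢
    refine ⟨by omega, hF, ?_⟩
    intro a ha
    rw [hm]
    exact if_pos ha

/-- Smaller keys come first and ties are broken by index. The right-hand side is what the counter
for the key of `v` holds when `placeProg` arrives at `v`. -/
theorem keyRank_eq_card_add_card {n : ℕ} {key : Fin n → ℕ} {kf : ℕ → ℕ}
    (hk : ∀ v : Fin n, kf v = key v) (v : Fin n) : keyRank key v =
      ((Finset.range n).filter fun u => kf u < key v).card +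
        ((Finset.range v).filter fun u => kf u = key v).card := by
  rw [keyRank, ← Finset.card_map Fin.valEmbedding, ← Finset.card_union_of_disjoint]
  · congr 1
    ext u
    simp only [Finset.mem_map, Finset.mem_filter, Finset.mem_univ, true_and, Fin.valEmbedding_apply,
      Finset.mem_union, Finset.mem_range]
    constructor
    · rintro ⟨x, hx, rfl⟩
      rw [hk]
      have : (x : ℕ) < v ↔ x < v := Iff.rfl
      have := x.2
      tauto
    · intro h
      have hu : u < n := by have := v.2; omega
      have hku : kf u = key ⟨u, hu⟩ := hk ⟨u, hu⟩
      rw [hku] at h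
      refine ⟨⟨u, hu⟩, ?_, rfl⟩
      rcases h with h | h
      · exact Or.inl h.2
      · exact Or.inr ⟨h.2, h.1⟩
  · rw [Finset.disjoint_left]
    intro u
    simp only [Finset.mem_filter]
    omega

theorem runs_placeProg {n S : ℕ} {s : State} {key : Fin n → ℕ} (hn : 2 ≤ n) (hw : n ^ 4 < 2 ^ w)
    (h0 : s.reg 0 = n) {kf : ℕ → ℕ} (hk : ∀ v : Fin n, kf v = key v)
    (hm3 : ∀ v < n, s.mem 3 v = kf v) (hkS : ∀ v, key v < S)
    (hm4 : ∀ a ≤ S, s.mem 4 a = ((Finset.range n).filter fun u => kf u < a).card) :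
    Runs w ω placeProg s fun t s' => t ≤ 30 * n + 30 ∧ Frame [] [4, 5, 6] s s' ∧
      ∀ v : Fin n, s'.mem 6 v = keyRank key v ∧ s'.mem 5 (keyRank key v) = v := by
  have hw1 : 4 * n < 2 ^ w := by nlinarith [Nat.pow_le_pow_left hn 3]
  unfold placeProg
  simp (disch := omega) only [eval_op, eval_reg, eval_const, eval_load, op_add, op_sub, op_mul,
      op_div, op_mod, op_lt, op_and, ite_one_zero_eq, runs_seq, runs_assign, runs_store,
      runs_ite, runs_skip, runs_flip, runs_emit, Function.update_self, ne_eq, not_not,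
      Function.update_of_ne, Expr.cost, true_and, and_true]
  refine (runs_while_const (fun i s' => Frame [] [4, 5, 6] s s' ∧ s'.reg 10 = i ∧
      (∀ a ≤ S, s'.mem 4 a = ((Finset.range n).filter fun u => kf u < a).card +
        ((Finset.range i).filter fun u => kf u = a).card) ∧
      ∀ v : Fin n, (v : ℕ) < i → s'.mem 6 v = keyRank key v ∧ s'.mem 5 (keyRank key v) = v) n 22
      ?_ ?_ ?_).mono ?_
  · rintro i s' hi ⟨hF, h10, hm, hv⟩
    have h0' : s'.reg 0 = n := by rw [hF.reg 0 (by simp) (by simp), h0]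
    have hki : kf i = key ⟨i, hi⟩ := hk ⟨i, hi⟩
    have h3 : s'.mem 3 i = key ⟨i, hi⟩ := by rw [hF.mem 3 (by simp), hm3 i hi, hki]
    have b1 := hkS ⟨i, hi⟩
    have h4 : s'.mem 4 (key ⟨i, hi⟩) = keyRank key ⟨i, hi⟩ := by
      rw [hm _ b1.le, keyRank_eq_card_add_card hk]
    have b2 := keyRank_lt key ⟨i, hi⟩
    simp (disch := omega) only [eval_op, eval_reg, eval_const, eval_load, op_add, op_sub, op_mul,
      op_div, op_mod, op_lt, op_and, ite_one_zero_eq, runs_seq, runs_assign, runs_store,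
      runs_ite, runs_skip, runs_flip, runs_emit, Function.update_self, ne_eq, not_not,
      Function.update_of_ne, Expr.cost, true_and, and_true, h0', h10, h3, h4]
    refine ⟨hi, by omega, by (apply_rules [hF.set_flips, Frame.update_reg,
        Frame.update_mem] <;> simp), ?_, ?_⟩
    · intro a ha
      rw [Function.update_apply, Finset.range_add_one, Finset.filter_insert, hki]
      split_ifs with h1 h2 h2
      · rw [Finset.card_insert_of_notMem (by simp), h1, keyRank_eq_card_add_card hk, add_assoc]
      · exact absurd h1.symm h2
      · exact absurd h2.symm h1
      · exact hm a ha
    · intro v hvi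
      rcases Nat.lt_succ_iff_lt_or_eq.1 hvi with hvi | rfl
      · have hne : keyRank key v ≠ keyRank key ⟨i, hi⟩ := fun h => by
          have := congrArg Fin.val (keyRank_injective key h)
          simp only at this
          omega
        rw [Function.update_of_ne (by omega), Function.update_of_ne hne]
        exact hv v hvi
      · rw [Function.update_self, Function.update_self]
        exact ⟨rfl, rfl⟩
  · rintro s' ⟨hF, h10, hm⟩
    have h0' : s'.reg 0 = n := by rw [hF.reg 0 (by simp) (by simp), h0]
    simp (disch := omega) only [eval_op, eval_reg, eval_const, eval_load, op_add, op_sub, op_mul,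
      op_div, op_mod, op_lt, op_and, ite_one_zero_eq, runs_seq, runs_assign, runs_store,
      runs_ite, runs_skip, runs_flip, runs_emit, Function.update_self, ne_eq, not_not,
      Function.update_of_ne, Expr.cost, true_and, and_true, h0', h10]
    omega
  · have hF := Frame.refl [] [4, 5, 6] s
    exact ⟨by (apply_rules [hF.set_flips, Frame.update_reg, Frame.update_mem] <;> simp),
        by simp (disch := omega) only [eval_op, eval_reg, eval_const, eval_load, op_add, op_sub,
        op_mul,
      op_div, op_mod, op_lt, op_and, ite_one_zero_eq, runs_seq, runs_assign, runs_store,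
      runs_ite, runs_skip, runs_flip, runs_emit, Function.update_self, ne_eq, not_not,
      Function.update_of_ne, Expr.cost, true_and, and_true], by simpa using hm4, by simp⟩
  · rintro t s' ⟨ht, hF, h10, hm, hv⟩
    simp only [Expr.cost] at ht ⊢
    exact ⟨by omega, hF, fun v => hv v v.2⟩

end WordRAM

/-! ### The trie of pieces: closing a piece, moving to a child, cutting. -/

set_option linter.unusedSimpArgs false
set_option linter.unnecessarySeqFocus false

namespace WordRAM

variable {w : ℕ} {ω : ℕ → Bool} {n : ℕ}

/-- The banks `9` to `12` describe a trie with nodes `0, …, c`, where node `y` stands for the list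
`path y`. -/
structure IsTrie (c : ℕ) (path : ℕ → List (Fin n)) (s : State) : Prop where
  root : path 0 = []
  parent_lt : ∀ y, 1 ≤ y → y ≤ c → s.mem 10 y < y
  path_eq : ∀ y, 1 ≤ y → y ≤ c → ∃ u : Fin n, s.mem 11 y = u ∧ path y = u :: path (s.mem 10 y)
  inj : ∀ x ≤ c, ∀ y ≤ c, path x = path y → x = y
  depth : ∀ y ≤ c, s.mem 12 y = (path y).length
  child : ∀ x ≤ c, ∀ u : Fin n, s.mem 9 (x * n + u) ≠ 0 →
    s.mem 9 (x * n + u) ≤ c ∧ path (s.mem 9 (x * n + u)) = u :: path x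
  child_parent : ∀ y, 1 ≤ y → y ≤ c → s.mem 9 (s.mem 10 y * n + s.mem 11 y) = y
  fresh : ∀ x, c < x → ∀ u : Fin n, s.mem 9 (x * n + u) = 0

/-- The banks `13` and `14` list the members of the nodes: `b` belongs to the nodes of the lists in
`closed b`. -/
def HasMembers (c : ℕ) (path : ℕ → List (Fin n)) (closed : Fin n → List (List (Fin n)))
    (ml : ℕ → List (Fin n)) (s : State) : Prop :=
  (∀ x, s.mem 13 x = (ml x).length) ∧ (∀ x, (ml x).Nodup) ∧
    (∀ x i (h : i < (ml x).length), s.mem 14 (x * n + i) = (ml x)[i]) ∧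
    ∀ x b, b ∈ ml x ↔ 1 ≤ x ∧ x ≤ c ∧ path x ∈ closed b

theorem mul_add_inj {x y i j : ℕ} (hi : i < n) (hj : j < n) :
    x * n + i = y * n + j ↔ x = y ∧ i = j := by
  constructor
  · intro h
    have h1 := congrArg (· / n) h
    have h2 := congrArg (· % n) h
    simp only [mul_comm _ n, Nat.mul_add_div (show 0 < n by omega), Nat.div_eq_of_lt hi,
      Nat.div_eq_of_lt hj, Nat.mul_add_mod, Nat.mod_eq_of_lt hi, Nat.mod_eq_of_lt hj,
      add_zero] at h1 h2
    exact ⟨h1, h2⟩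
  · rintro ⟨rfl, rfl⟩
    rfl

theorem IsTrie.congr {c : ℕ} {path : ℕ → List (Fin n)} {s s' : State} (h : IsTrie c path s)
    (h9 : s'.mem 9 = s.mem 9) (h10 : s'.mem 10 = s.mem 10) (h11 : s'.mem 11 = s.mem 11)
    (h12 : s'.mem 12 = s.mem 12) : IsTrie c path s' := by
  obtain ⟨a1, a2, a3, a4, a5, a6, a7, a8⟩ := h
  refine ⟨a1, ?_, ?_, a4, ?_, ?_, ?_, ?_⟩ <;> simpa only [h9, h10, h11, h12]

/-- The root is the only node with the empty list, so the value `0` in bank `7` can signal that a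
vertex has no open piece. -/
theorem IsTrie.path_ne_nil {c : ℕ} {path : ℕ → List (Fin n)} {s : State} (h : IsTrie c path s)
    {x : ℕ} (hx : x ≤ c) : path x ≠ [] ↔ x ≠ 0 := by
  constructor
  · rintro h1 rfl
    exact h1 h.root
  · intro h1 h2
    exact h1 (h.inj x hx 0 (Nat.zero_le _) (by rw [h2, h.root]))

/-- Different nodes carry different lists, so recording `b` at node `x` changes the membership
relation only for the list of `x`. The conclusion takes an arbitrary postcondition so that it can be
used in the middle of a program. -/
theorem runs_closeProg {c x : ℕ} {b : Fin n} {path : ℕ → List (Fin n)}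
    {closed : Fin n → List (List (Fin n))} {ml : ℕ → List (Fin n)} {s : State} (hn : 16 ≤ n)
    (hw : n ^ 4 < 2 ^ w) (h0 : s.reg 0 = n) (h15 : s.reg 15 = b) (h16 : s.reg 16 = x)
    (hx : 1 ≤ x) (hxc : x ≤ c) (hc : c ≤ 2 * n ^ 2)
    (hinj : ∀ x ≤ c, ∀ y ≤ c, path x = path y → x = y)
    (hm : HasMembers c path closed ml s) (hnew : path x ∉ closed b)
    {Q : ℕ → State → Prop}
    (hQ : ∀ t s', t ≤ 20 → s'.reg = s.reg → (∀ a, a ≠ 13 → a ≠ 14 → s'.mem a = s.mem a) →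
      s'.out = s.out →
      HasMembers c path (Function.update closed b (path x :: closed b))
        (Function.update ml x (ml x ++ [b])) s' → Q t s') :
    Runs w ω closeProg s Q := by
  have hn4 : 16 * n ^ 3 ≤ n ^ 4 := by
    calc 16 * n ^ 3 ≤ n * n ^ 3 := Nat.mul_le_mul_right _ hn
      _ = n ^ 4 := by ring
  have hn3 : 16 * n ^ 2 ≤ n ^ 3 := by
    calc 16 * n ^ 2 ≤ n * n ^ 2 := Nat.mul_le_mul_right _ hn
      _ = n ^ 3 := by ring
  have hn2 : n * 16 ≤ n ^ 2 := by nlinarith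
  have hxn : x * n ≤ 2 * n ^ 3 := by
    calc x * n ≤ (2 * n ^ 2) * n := Nat.mul_le_mul_right _ (hxc.trans hc)
      _ = 2 * n ^ 3 := by ring
  obtain ⟨m1, m2, m3, m4⟩ := hm
  have hbx : b ∉ ml x := by rw [m4]; tauto
  -- Since `b` is new, fewer than `n` vertices are stored, and the new entry stays inside the block
  -- of `n` cells reserved for the node.
  have hlt : (ml x).length < n := by
    have : (b :: ml x).length ≤ Fintype.card (Fin n) :=
      List.Nodup.length_le_card (List.nodup_cons.2 ⟨hbx, m2 x⟩)
    simpa using this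
  have hlen : ∀ y, (ml y).length ≤ n := fun y => by
    simpa using List.Nodup.length_le_card (m2 y)
  unfold closeProg
  simp (disch := omega) only [eval_op, eval_reg, eval_const, eval_load, op_add, op_sub, op_mul,
      op_div, op_mod, op_lt, op_and, ite_one_zero_eq, runs_seq, runs_assign, runs_store,
      runs_ite, runs_skip, runs_flip, runs_emit, Function.update_self, ne_eq, not_not,
      Function.update_of_ne, Expr.cost, true_and, and_true, h0, h15, h16, m1]
  refine hQ _ _ (by omega) rfl ?_ rfl ⟨?_, ?_, ?_, ?_⟩
  · intro a h1 h2
    simp only [Function.update_of_ne h1, Function.update_of_ne h2]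
  · intro y
    simp only [Function.update_self]
    by_cases hy : y = x
    · rw [hy]
      simp
    · rw [Function.update_of_ne hy, Function.update_of_ne hy]
      simp (disch := omega) only [ne_eq, Function.update_of_ne, m1]
  · intro y
    by_cases hy : y = x
    · rw [hy, Function.update_self, List.nodup_append]
      refine ⟨m2 x, by simp, ?_⟩
      intro a ha b' hb'
      rw [List.mem_singleton] at hb'
      rintro rfl
      exact hbx (hb' ▸ ha)
    · rw [Function.update_of_ne hy]
      exact m2 y
  · intro y i hi
    simp (disch := omega) only [ne_eq, Function.update_of_ne, Function.update_self]
    by_cases hy : y = x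
    · subst hy
      simp only [Function.update_self, List.length_append, List.length_singleton] at hi ⊢
      rcases Nat.lt_succ_iff_lt_or_eq.1 hi with h | h
      · rw [Function.update_of_ne (by omega), m3 y i h, List.getElem_append_left h]
      · subst h
        simp
    · simp only [Function.update_of_ne hy] at hi ⊢
      rw [Function.update_of_ne, m3 y i hi]
      have := hlen y
      rw [Ne, mul_add_inj (by omega) hlt]
      tauto
  · intro y b'
    by_cases hy : y = x
    · subst hy
      rw [Function.update_self]
      by_cases hb : b' = b
      · subst hb
        simp [hx, hxc]
      · rw [Function.update_of_ne hb, ← m4]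
        simp [hb]
    · rw [Function.update_of_ne hy, m4]
      by_cases hb : b' = b
      · subst hb
        rw [Function.update_self, List.mem_cons]
        have : y ≤ c → path y ≠ path x := fun h1 h2 => hy (hinj y h1 x hxc h2)
        tauto
      · rw [Function.update_of_ne hb]

/-- A zero cell means that the child is missing, because memory starts at zero and nodes are
numbered from `1`. In that case no node carries `u :: path x`, so the new node keeps lists and nodes
in bijection. -/
theorem runs_childProg {c x : ℕ} {b u : Fin n} {path : ℕ → List (Fin n)} {s : State} (hn : 16 ≤ n)
    (hw : n ^ 4 < 2 ^ w) (h0 : s.reg 0 = n) (h15 : s.reg 15 = b) (h16 : s.reg 16 = x)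
    (h7 : s.reg 7 = c) (h11 : s.reg 11 = u) (hxc : x ≤ c) (hc : c ≤ 2 * n ^ 2)
    (hT : IsTrie c path s) {Q : ℕ → State → Prop}
    (hQ : ∀ t s' c' path' z, t ≤ 50 → Frame [7] [7, 9, 10, 11, 12] s s' →
      (∀ r, r ≠ 7 → r ≠ 18 → s'.reg r = s.reg r) → s'.reg 7 = c' → c ≤ c' → c' ≤ c + 1 →
      IsTrie c' path' s' → (∀ y ≤ c, path' y = path y) → 1 ≤ z → z ≤ c' →
      path' z = u :: path x → s'.mem 7 = Function.update (s.mem 7) b z → Q t s') :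
    Runs w ω childProg s Q := by
  have hn4 : 16 * n ^ 3 ≤ n ^ 4 := by
    calc 16 * n ^ 3 ≤ n * n ^ 3 := Nat.mul_le_mul_right _ hn
      _ = n ^ 4 := by ring
  have hn3 : 16 * n ^ 2 ≤ n ^ 3 := by
    calc 16 * n ^ 2 ≤ n * n ^ 2 := Nat.mul_le_mul_right _ hn
      _ = n ^ 3 := by ring
  have hn2 : n * 16 ≤ n ^ 2 := by nlinarith
  have hxn : x * n ≤ 2 * n ^ 3 := by
    calc x * n ≤ (2 * n ^ 2) * n := Nat.mul_le_mul_right _ (hxc.trans hc)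
      _ = 2 * n ^ 3 := by ring
  have hun := u.2
  unfold childProg
  simp (disch := omega) only [eval_op, eval_reg, eval_const, eval_load, op_add, op_sub, op_mul,
      op_div, op_mod, op_lt, op_and, ite_one_zero_eq, runs_seq, runs_assign, runs_store,
      runs_ite, runs_skip, runs_flip, runs_emit, Function.update_self, ne_eq, not_not,
      Function.update_of_ne, Expr.cost, true_and, and_true, h0, h15, h16, h7, h11]
  have hF := Frame.refl [7] [7, 9, 10, 11, 12] s
  split_ifs with hz
  -- Parents have smaller numbers, so the depth of a node is at most its number; this rules out an
  -- overflow in the new depth.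
  · have hlen : s.mem 12 x ≤ c := by
      rw [hT.depth x hxc]
      have : ∀ y ≤ c, (path y).length ≤ y := by
        intro y
        induction y using Nat.strong_induction_on with
        | _ y ih =>
          intro hy
          rcases Nat.eq_zero_or_pos y with rfl | h1
          · simp [hT.root]
          · obtain ⟨u, -, hu⟩ := hT.path_eq y h1 hy
            have h2 := hT.parent_lt y h1 hy
            have := ih _ h2 (by omega)
            rw [hu, List.length_cons]
            omega
      exact (this x hxc).trans hxc
    simp (disch := omega) only [eval_op, eval_reg, eval_const, eval_load, op_add, op_sub, op_mul,
      op_div, op_mod, op_lt, op_and, ite_one_zero_eq, runs_seq, runs_assign, runs_store,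
      runs_ite, runs_skip, runs_flip, runs_emit, Function.update_self, ne_eq, not_not,
      Function.update_of_ne, Expr.cost, true_and, and_true, h0, h15, h16, h7, h11]
    -- A node with this list would have `x` as its parent and `u` as its last vertex, and
    -- `child_parent` would contradict the zero cell.
    have hnew : ∀ y ≤ c, path y ≠ u :: path x := by
      intro y hy he
      have hy0 : 1 ≤ y := by
        by_contra hy0
        rw [show y = 0 by omega, hT.root] at he
        simp at he
      obtain ⟨u', h1, h2⟩ := hT.path_eq y hy0 hy
      rw [he, List.cons.injEq] at h2
      have h3 := hT.parent_lt y hy0 hy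
      have h4 := hT.inj _ hxc _ (by omega) h2.2
      have h5 := hT.child_parent y hy0 hy
      rw [← h4, h1, ← h2.1, hz] at h5
      omega
    have hpar : ∀ y, 1 ≤ y → y ≤ c → s.mem 10 y < c + 1 := fun y h1 h2 => by
      have := hT.parent_lt y h1 h2
      omega
    refine hQ _ _ (c + 1) (Function.update path (c + 1) (u :: path x)) (c + 1) (by omega)
      (by (apply_rules [hF.set_flips, Frame.update_reg,
          Frame.update_mem] <;> simp)) ?_ ?_ (by omega) le_rfl ?_ ?_ (by omega) le_rfl (by simp) ?_
    · intro r h1 h2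
      simp only [Function.update_of_ne h1, Function.update_of_ne h2]
    · simp (disch := omega) only [eval_op, eval_reg, eval_const, eval_load, op_add, op_sub, op_mul,
      op_div, op_mod, op_lt, op_and, ite_one_zero_eq, runs_seq, runs_assign, runs_store,
      runs_ite, runs_skip, runs_flip, runs_emit, Function.update_self, ne_eq, not_not,
      Function.update_of_ne, Expr.cost, true_and, and_true]
    · constructor
      · rw [Function.update_of_ne (by omega), hT.root]
      · intro y h1 h2
        simp (disch := omega) only [eval_op, eval_reg, eval_const, eval_load, op_add, op_sub,
            op_mul,
      op_div, op_mod, op_lt, op_and, ite_one_zero_eq, runs_seq, runs_assign, runs_store,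
      runs_ite, runs_skip, runs_flip, runs_emit, Function.update_self, ne_eq, not_not,
      Function.update_of_ne, Expr.cost, true_and, and_true]
        by_cases hy : y = c + 1
        · rw [hy, Function.update_self]
          omega
        · rw [Function.update_of_ne hy]
          exact hT.parent_lt y h1 (by omega)
      · intro y h1 h2
        simp (disch := omega) only [eval_op, eval_reg, eval_const, eval_load, op_add, op_sub,
            op_mul,
      op_div, op_mod, op_lt, op_and, ite_one_zero_eq, runs_seq, runs_assign, runs_store,
      runs_ite, runs_skip, runs_flip, runs_emit, Function.update_self, ne_eq, not_not,
      Function.update_of_ne, Expr.cost, true_and, and_true]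
        by_cases hy : y = c + 1
        · subst hy
          refine ⟨u, by rw [Function.update_self], ?_⟩
          rw [Function.update_self, Function.update_self, Function.update_of_ne (by omega)]
        · obtain ⟨u', h3, h4⟩ := hT.path_eq y h1 (by omega)
          have := hpar y h1 (by omega)
          refine ⟨u', by rw [Function.update_of_ne hy, h3], ?_⟩
          rw [Function.update_of_ne hy, Function.update_of_ne hy, h4,
            Function.update_of_ne (by omega)]
      · intro y hy y' hy' he
        by_cases h1 : y = c + 1
        · by_cases h2 : y' = c + 1
          · omega
          · rw [h1, Function.update_self, Function.update_of_ne h2] at he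
            exact absurd he.symm (hnew y' (by omega))
        · by_cases h2 : y' = c + 1
          · rw [h2, Function.update_self, Function.update_of_ne h1] at he
            exact absurd he (hnew y (by omega))
          · rw [Function.update_of_ne h1, Function.update_of_ne h2] at he
            exact hT.inj y (by omega) y' (by omega) he
      · intro y hy
        simp (disch := omega) only [eval_op, eval_reg, eval_const, eval_load, op_add, op_sub,
            op_mul,
      op_div, op_mod, op_lt, op_and, ite_one_zero_eq, runs_seq, runs_assign, runs_store,
      runs_ite, runs_skip, runs_flip, runs_emit, Function.update_self, ne_eq, not_not,
      Function.update_of_ne, Expr.cost, true_and, and_true]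
        by_cases h1 : y = c + 1
        · rw [h1, Function.update_self, Function.update_self, hT.depth x hxc, List.length_cons]
        · rw [Function.update_of_ne h1, Function.update_of_ne h1, hT.depth y (by omega)]
      · intro y hy v
        simp (disch := omega) only [eval_op, eval_reg, eval_const, eval_load, op_add, op_sub,
            op_mul,
      op_div, op_mod, op_lt, op_and, ite_one_zero_eq, runs_seq, runs_assign, runs_store,
      runs_ite, runs_skip, runs_flip, runs_emit, Function.update_self, ne_eq, not_not,
      Function.update_of_ne, Expr.cost, true_and, and_true]
        by_cases h1 : y * n + v = x * n + u
        · rw [h1, Function.update_self]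
          rw [mul_add_inj v.2 u.2] at h1
          have hvu : v = u := Fin.ext h1.2
          rw [Function.update_self, h1.1, hvu, Function.update_of_ne (by omega)]
          exact fun _ => ⟨le_rfl, rfl⟩
        · rw [Function.update_of_ne h1]
          intro hne
          have hyc : y ≤ c := by
            by_contra hyc
            exact hne (hT.fresh y (by omega) v)
          obtain ⟨h2, h3⟩ := hT.child y hyc v hne
          rw [Function.update_of_ne (by omega), Function.update_of_ne (by omega)]
          exact ⟨by omega, h3⟩
      · intro y h1 h2
        simp (disch := omega) only [eval_op, eval_reg, eval_const, eval_load, op_add, op_sub,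
            op_mul,
      op_div, op_mod, op_lt, op_and, ite_one_zero_eq, runs_seq, runs_assign, runs_store,
      runs_ite, runs_skip, runs_flip, runs_emit, Function.update_self, ne_eq, not_not,
      Function.update_of_ne, Expr.cost, true_and, and_true]
        by_cases hy : y = c + 1
        · rw [hy, Function.update_self, Function.update_self, Function.update_self]
        · rw [Function.update_of_ne hy, Function.update_of_ne hy, Function.update_of_ne]
          · exact hT.child_parent y h1 (by omega)
          · intro he
            have h3 := hT.child_parent y h1 (by omega)
            rw [he, hz] at h3
            omega
      · intro y hy v
        simp (disch := omega) only [eval_op, eval_reg, eval_const, eval_load, op_add, op_sub,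
            op_mul,
      op_div, op_mod, op_lt, op_and, ite_one_zero_eq, runs_seq, runs_assign, runs_store,
      runs_ite, runs_skip, runs_flip, runs_emit, Function.update_self, ne_eq, not_not,
      Function.update_of_ne, Expr.cost, true_and, and_true]
        rw [Function.update_of_ne, hT.fresh y (by omega) v]
        rw [Ne, mul_add_inj v.2 u.2]
        omega
    · intro y hy
      rw [Function.update_of_ne (by omega)]
    · simp (disch := omega) only [eval_op, eval_reg, eval_const, eval_load, op_add, op_sub, op_mul,
      op_div, op_mod, op_lt, op_and, ite_one_zero_eq, runs_seq, runs_assign, runs_store,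
      runs_ite, runs_skip, runs_flip, runs_emit, Function.update_self, ne_eq, not_not,
      Function.update_of_ne, Expr.cost, true_and, and_true]
  · obtain ⟨h2, h3⟩ := hT.child x hxc u hz
    refine hQ _ _ c path (s.mem 9 (x * n + u)) (by omega)
      (by (apply_rules [hF.set_flips, Frame.update_reg,
          Frame.update_mem] <;> simp)) ?_ ?_ le_rfl (by omega) ?_ (fun _ _ => rfl) (by omega) h2 h3 ?_
    · intro r h1 h2
      simp only [Function.update_of_ne h2]
    · simp [h7]
    · refine hT.congr ?_ ?_ ?_ ?_ <;> simp (disch := omega) only [eval_op, eval_reg, eval_const,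
          eval_load, op_add, op_sub, op_mul,
      op_div, op_mod, op_lt, op_and, ite_one_zero_eq, runs_seq, runs_assign, runs_store,
      runs_ite, runs_skip, runs_flip, runs_emit, Function.update_self, ne_eq, not_not,
      Function.update_of_ne, Expr.cost, true_and, and_true]
    · simp (disch := omega) only [eval_op, eval_reg, eval_const, eval_load, op_add, op_sub, op_mul,
      op_div, op_mod, op_lt, op_and, ite_one_zero_eq, runs_seq, runs_assign, runs_store,
      runs_ite, runs_skip, runs_flip, runs_emit, Function.update_self, ne_eq, not_not,
      Function.update_of_ne, Expr.cost, true_and, and_true]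

/-- The closed pieces after the positions in `l` are read, as lists of vertices. -/
noncomputable def closedLists [NeZero n] (key : Fin n → ℕ) (K M : ℕ) (l : List ℕ) :
    List (List (Fin n)) :=
  (Cut.run K M l).closed.map (List.map (vertAt key))

/-- The contents of bank `2` used by the program. -/
def IsTable (n K M : ℕ) (f : ℕ → ℕ) : Prop :=
  ∀ i ≤ K, ∀ j < n, f (i * n + j) = min (i.choose j) (M + 1)

/-- The members of the open piece are different positions between its start and `P`. Together with a
span of at most `K < n`, this keeps the column of the table lookup below `n`. -/
theorem length_cur_le {K M : ℕ} {l : List ℕ} {P : ℕ} (hl : l.Pairwise (· < ·)) (hne : l ≠ [])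
    (hP : ∀ x ∈ l, x < P) : (Cut.run K M l).cur.length ≤ P - (Cut.run K M l).start := by
  have h := (Cut.cur_spec (K := K) (M := M) hl hne).2
  have hnd : (Cut.run K M l).cur.Nodup := by
    rw [h, List.nodup_reverse]
    exact (hl.imp fun h => ne_of_lt h).filter _
  rw [← List.toFinset_card_of_nodup hnd, ← Nat.card_Ico]
  apply Finset.card_le_card
  intro x hx
  rw [List.mem_toFinset, h, List.mem_reverse, List.mem_filter] at hx
  rw [Finset.mem_Ico]
  exact ⟨by simpa using hx.2, hP x hx.1⟩

/-- The program simulates the decision of `Cut.push`: the depth of the open node is the length of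
the open piece, and bank `8` holds its start. Afterwards register `16` is the node from which the
new position must be appended, the root if a new piece starts. -/
theorem runs_cutProg [NeZero n] {key : Fin n → ℕ} {K M c P : ℕ} {b : Fin n}
    {path : ℕ → List (Fin n)} {l : Fin n → List ℕ} {ml : ℕ → List (Fin n)} {s : State}
    (hn : 16 ≤ n) (hw : n ^ 4 < 2 ^ w) (h0 : s.reg 0 = n) (h4 : s.reg 4 = K) (h5 : s.reg 5 = M)
    (h10 : s.reg 10 = P) (h15 : s.reg 15 = b) (h16 : s.reg 16 = s.mem 7 b) (hc : c ≤ 2 * n ^ 2)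
    (hK : K < n) (hM : M ≤ n) (hP : P < 2 * n) (htab : IsTable n K M (s.mem 2))
    (hT : IsTrie c path s) (hm : HasMembers c path (fun b => closedLists key K M (l b)) ml s)
    (hopen : s.mem 7 b ≤ c ∧ path (s.mem 7 b) = (Cut.run K M (l b)).cur.map (vertAt key))
    (hstart : s.mem 8 b = (Cut.run K M (l b)).start) (hl : (l b).Pairwise (· < ·))
    (hlP : ∀ x ∈ l b, x < P) (hnd : ((l b).map (vertAt key)).Nodup) {Q : ℕ → State → Prop}
    (hQ : ∀ t s' x' ml', t ≤ 80 → Frame [] [8, 13, 14] s s' →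
      (∀ r, r ≠ 16 → r ≠ 17 → s'.reg r = s.reg r) → s'.reg 16 = x' → x' ≤ c →
      (Cut.run K M (l b ++ [P])).cur.map (vertAt key) = vertAt key P :: path x' →
      HasMembers c path (fun b' => closedLists key K M (Function.update l b (l b ++ [P]) b')) ml'
        s' →
      (∀ L ∈ closedLists key K M (l b ++ [P]), L ∈ closedLists key K M (l b) ∨
        (1 ≤ s.mem 7 b ∧ path (s.mem 7 b) = L)) →
      s'.mem 8 = Function.update (s.mem 8) b (Cut.run K M (l b ++ [P])).start → Q t s') :
    Runs w ω cutProg s Q := by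
  have hn4 : 16 * n ^ 3 ≤ n ^ 4 := by
    calc 16 * n ^ 3 ≤ n * n ^ 3 := Nat.mul_le_mul_right _ hn
      _ = n ^ 4 := by ring
  have hn3 : 16 * n ^ 2 ≤ n ^ 3 := by
    calc 16 * n ^ 2 ≤ n * n ^ 2 := Nat.mul_le_mul_right _ hn
      _ = n ^ 3 := by ring
  have hn2 : n * 16 ≤ n ^ 2 := by nlinarith
  have hbn := b.2
  have hx0 : s.mem 7 b ≠ 0 ↔ (Cut.run K M (l b)).cur ≠ [] := by
    rw [← hT.path_ne_nil hopen.1, hopen.2]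
    simp
  have hdep : s.mem 12 (s.mem 7 b) = (Cut.run K M (l b)).cur.length := by
    rw [hT.depth _ hopen.1, hopen.2, List.length_map]
  set x := s.mem 7 b with hx
  set r := Cut.run K M (l b) with hr
  have hcurlen : r.cur.length ≤ n := by
    have hsub : ∀ y ∈ r.cur, y ∈ l b := by
      intro y hy
      apply Cut.mem_of_mem_pieces (K := K) (M := M) _ hy
      rw [Cut.pieces_eq (List.ne_nil_of_mem hy)]
      simp [hr]
    by_cases hne : l b = []
    · rw [hr, hne]
      simp [Cut.run, Cut.init]
    have hcur : (r.cur.map (vertAt key)).Nodup := by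
      apply Cut.nodup_map_of_mem hnd (K := K) (M := M)
      rw [Cut.pieces_eq (Cut.cur_ne_nil hne)]
      simp [hr]
    simpa using hcur.length_le_card
  have hln : (P - r.start + 1) * n ≤ 2 * n ^ 2 := by
    calc (P - r.start + 1) * n ≤ (2 * n) * n := Nat.mul_le_mul_right _ (by omega)
      _ = 2 * n ^ 2 := by ring
  have hF := Frame.refl [] [8, 13, 14] s
  have hrun : Cut.run K M (l b ++ [P]) = r.push K M P := Cut.run_append _ _
  -- Beyond row `K` the table holds no binomial coefficients, but there the factor for the span is
  -- zero already, so the value read does not matter.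
  have hcond : ((0 < x ∧ P - r.start + 1 < K + 1) ∧
      s.mem 2 ((P - r.start + 1) * n + r.cur.length + 1) < M + 1) ↔
      (r.cur ≠ [] ∧ FitsPiece K M r.start P (r.cur.length + 1)) := by
    have hpos : 0 < x ↔ r.cur ≠ [] := by rw [← hx0]; omega
    rw [hpos, and_assoc]
    apply and_congr_right
    intro hne
    unfold FitsPiece
    rw [Nat.lt_succ_iff]
    apply and_congr_right
    intro hfit
    have h1 := length_cur_le (K := K) (M := M) hl (Cut.cur_ne_nil_iff.1 hne) hlP
    rw [← hr] at h1
    rw [add_assoc, htab _ hfit _ (by omega)]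
    omega
  unfold cutProg
  simp (disch := omega) only [eval_op, eval_reg, eval_const, eval_load, op_add, op_sub, op_mul,
      op_div, op_mod, op_lt, op_and, ite_one_zero_eq, runs_seq, runs_assign, runs_store,
      runs_ite, runs_skip, runs_flip, runs_emit, Function.update_self, ne_eq, not_not,
      Function.update_of_ne, Expr.cost, true_and, and_true, h0, h4, h5, h10, h15, h16, hstart, hdep]
  by_cases hc' : (0 < x ∧ P - r.start + 1 < K + 1) ∧
      s.mem 2 ((P - r.start + 1) * n + r.cur.length + 1) < M + 1
  · rw [if_pos hc']
    have hpush : Cut.run K M (l b ++ [P]) = { r with cur := P :: r.cur } := by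
      rw [hrun, Cut.push, if_pos (hcond.1 hc')]
    have hcl : closedLists key K M (l b ++ [P]) = closedLists key K M (l b) := by
      simp only [closedLists, hpush, ← hr]
    refine hQ _ _ x ml (by omega) (by (apply_rules [hF.set_flips, Frame.update_reg,
        Frame.update_mem] <;> simp)) ?_ ?_ hopen.1 ?_ ?_ ?_ ?_
    · intro q h1 h2
      simp only [Function.update_of_ne h2]
    · simp (disch := omega) only [eval_op, eval_reg, eval_const, eval_load, op_add, op_sub, op_mul,
      op_div, op_mod, op_lt, op_and, ite_one_zero_eq, runs_seq, runs_assign, runs_store,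
      runs_ite, runs_skip, runs_flip, runs_emit, Function.update_self, ne_eq, not_not,
      Function.update_of_ne, Expr.cost, true_and, and_true, h16]
    · rw [hpush, List.map_cons, hopen.2]
    · have : (fun b' => closedLists key K M (Function.update l b (l b ++ [P]) b')) =
          fun b' => closedLists key K M (l b') := by
        ext1 b'
        by_cases hb : b' = b
        · rw [hb, Function.update_self, hcl]
        · rw [Function.update_of_ne hb]
      rw [this]
      exact hm
    · intro L hL
      rw [hcl] at hL
      exact Or.inl hL
    · rw [hpush]
      simp only
      rw [← hstart, Function.update_eq_self]
  · rw [if_neg hc']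
    have hpush : Cut.run K M (l b ++ [P]) = ⟨r.pieces, [P], P⟩ := by
      rw [hrun, Cut.push, if_neg (fun h => hc' (hcond.2 h))]
    by_cases hxz : x = 0
    · have hnil : r.cur = [] := by
        by_contra h
        exact hx0.2 h hxz
      have hcl : closedLists key K M (l b ++ [P]) = closedLists key K M (l b) := by
        simp only [closedLists, hpush, ← hr, Cut.pieces, hnil, if_true]
      rw [if_neg (by simpa using hxz)]
      refine hQ _ _ 0 ml (by omega) (by (apply_rules [hF.set_flips, Frame.update_reg,
          Frame.update_mem] <;> simp)) ?_ ?_ (Nat.zero_le _) ?_ ?_ ?_ ?_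
      · intro q h1 h2
        simp only [Function.update_of_ne h1, Function.update_of_ne h2]
      · simp (disch := omega) only [eval_op, eval_reg, eval_const, eval_load, op_add, op_sub,
            op_mul,
      op_div, op_mod, op_lt, op_and, ite_one_zero_eq, runs_seq, runs_assign, runs_store,
      runs_ite, runs_skip, runs_flip, runs_emit, Function.update_self, ne_eq, not_not,
      Function.update_of_ne, Expr.cost, true_and, and_true]
      · rw [hpush, hT.root]
        rfl
      · have : (fun b' => closedLists key K M (Function.update l b (l b ++ [P]) b')) =
            fun b' => closedLists key K M (l b') := by
          ext1 b'
          by_cases hb : b' = b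
          · rw [hb, Function.update_self, hcl]
          · rw [Function.update_of_ne hb]
        rw [this]
        unfold HasMembers
        simp (disch := omega) only [eval_op, eval_reg, eval_const, eval_load, op_add, op_sub,
            op_mul,
      op_div, op_mod, op_lt, op_and, ite_one_zero_eq, runs_seq, runs_assign, runs_store,
      runs_ite, runs_skip, runs_flip, runs_emit, Function.update_self, ne_eq, not_not,
      Function.update_of_ne, Expr.cost, true_and, and_true]
        exact hm
      · intro L hL
        rw [hcl] at hL
        exact Or.inl hL
      · rw [hpush]
        simp (disch := omega) only [eval_op, eval_reg, eval_const, eval_load, op_add, op_sub,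
            op_mul,
      op_div, op_mod, op_lt, op_and, ite_one_zero_eq, runs_seq, runs_assign, runs_store,
      runs_ite, runs_skip, runs_flip, runs_emit, Function.update_self, ne_eq, not_not,
      Function.update_of_ne, Expr.cost, true_and, and_true]
    · have hne : r.cur ≠ [] := hx0.1 hxz
      have hcl : closedLists key K M (l b ++ [P]) =
          r.cur.map (vertAt key) :: closedLists key K M (l b) := by
        simp only [closedLists, hpush, ← hr, Cut.pieces, hne, if_false, List.map_cons]
      rw [if_pos (by simpa using hxz)]
      refine runs_closeProg (c := c) (x := x) (b := b) (path := path)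
        (closed := fun b => closedLists key K M (l b)) (ml := ml) hn hw ?_ ?_ ?_
        (by omega) hopen.1 hc hT.inj ?_ ?_ ?_
      · simp (disch := omega) only [eval_op, eval_reg, eval_const, eval_load, op_add, op_sub,
            op_mul,
      op_div, op_mod, op_lt, op_and, ite_one_zero_eq, runs_seq, runs_assign, runs_store,
      runs_ite, runs_skip, runs_flip, runs_emit, Function.update_self, ne_eq, not_not,
      Function.update_of_ne, Expr.cost, true_and, and_true, h0]
      · simp (disch := omega) only [eval_op, eval_reg, eval_const, eval_load, op_add, op_sub,
            op_mul,
      op_div, op_mod, op_lt, op_and, ite_one_zero_eq, runs_seq, runs_assign, runs_store,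
      runs_ite, runs_skip, runs_flip, runs_emit, Function.update_self, ne_eq, not_not,
      Function.update_of_ne, Expr.cost, true_and, and_true, h15]
      · simp (disch := omega) only [eval_op, eval_reg, eval_const, eval_load, op_add, op_sub,
            op_mul,
      op_div, op_mod, op_lt, op_and, ite_one_zero_eq, runs_seq, runs_assign, runs_store,
      runs_ite, runs_skip, runs_flip, runs_emit, Function.update_self, ne_eq, not_not,
      Function.update_of_ne, Expr.cost, true_and, and_true, h16]
      · exact hm
      · rw [hopen.2]
        exact Cut.cur_not_mem_closed hnd (Cut.cur_ne_nil_iff.1 hne)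
      · intro t s' ht hreg hmem hout hm'
        have hF' : Frame [] [8, 13, 14] s s' := by
          refine ⟨?_, ?_, hout⟩
          · intro q h1 _
            rw [hreg]
            simp only [Function.update_of_ne (show q ≠ 17 by omega)]
          · intro a ha
            simp only [List.mem_cons, List.not_mem_nil, or_false, not_or] at ha
            exact hmem a ha.2.1 ha.2.2
        have e15 : s'.reg 15 = b := by rw [hreg]; simp [h15]
        have e10 : s'.reg 10 = P := by rw [hreg]; simp [h10]
        simp (disch := omega) only [eval_op, eval_reg, eval_const, eval_load, op_add, op_sub,
            op_mul,
      op_div, op_mod, op_lt, op_and, ite_one_zero_eq, runs_seq, runs_assign, runs_store,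
      runs_ite, runs_skip, runs_flip, runs_emit, Function.update_self, ne_eq, not_not,
      Function.update_of_ne, Expr.cost, true_and, and_true, e15, e10]
        refine hQ _ _ 0 (Function.update ml x (ml x ++ [b])) (by omega) ?_ ?_ ?_ (Nat.zero_le _)
          ?_ ?_ ?_ ?_
        · exact Frame.update_reg (Frame.update_mem hF' (by simp)) (by simp)
        · intro q h1 h2
          simp only [Function.update_of_ne h1, hreg, Function.update_of_ne h2]
        · simp (disch := omega) only [eval_op, eval_reg, eval_const, eval_load, op_add, op_sub,
              op_mul,
      op_div, op_mod, op_lt, op_and, ite_one_zero_eq, runs_seq, runs_assign, runs_store,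
      runs_ite, runs_skip, runs_flip, runs_emit, Function.update_self, ne_eq, not_not,
      Function.update_of_ne, Expr.cost, true_and, and_true]
        · rw [hpush, hT.root]
          rfl
        · have : (fun b' => closedLists key K M (Function.update l b (l b ++ [P]) b')) =
              Function.update (fun b => closedLists key K M (l b)) b
                (path x :: closedLists key K M (l b)) := by
            ext1 b'
            by_cases hb : b' = b
            · rw [hb, Function.update_self, Function.update_self, hcl, hopen.2]
            · rw [Function.update_of_ne hb, Function.update_of_ne hb]
          rw [this]
          unfold HasMembers at hm' ⊢
          simp (disch := omega) only [eval_op, eval_reg, eval_const, eval_load, op_add, op_sub,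
              op_mul,
      op_div, op_mod, op_lt, op_and, ite_one_zero_eq, runs_seq, runs_assign, runs_store,
      runs_ite, runs_skip, runs_flip, runs_emit, Function.update_self, ne_eq, not_not,
      Function.update_of_ne, Expr.cost, true_and, and_true]
          exact hm'
        · intro L hL
          rw [hcl, List.mem_cons] at hL
          rcases hL with rfl | hL
          · exact Or.inr ⟨by omega, hopen.2⟩
          · exact Or.inl hL
        · rw [hpush]
          simp (disch := omega) only [eval_op, eval_reg, eval_const, eval_load, op_add, op_sub,
              op_mul,
      op_div, op_mod, op_lt, op_and, ite_one_zero_eq, runs_seq, runs_assign, runs_store,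
      runs_ite, runs_skip, runs_flip, runs_emit, Function.update_self, ne_eq, not_not,
      Function.update_of_ne, Expr.cost, true_and, and_true]
          rw [hmem 8 (by omega) (by omega)]

end WordRAM

/-! ### The main loop over positions and adjacency lists. -/

set_option linter.unusedSimpArgs false
set_option linter.unnecessarySeqFocus false

namespace WordRAM

variable {w : ℕ} {ω : ℕ → Bool} {n : ℕ}

/-- The pieces that arise from the position lists `l` are stored in the banks `7` to `14`. -/
def HasPieces [NeZero n] (key : Fin n → ℕ) (K M : ℕ) (l : Fin n → List ℕ)
    (path : ℕ → List (Fin n)) (ml : ℕ → List (Fin n)) (s : State) : Prop :=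
  IsTrie (s.reg 7) path s ∧
    HasMembers (s.reg 7) path (fun b => closedLists key K M (l b)) ml s ∧
    (∀ b : Fin n, s.mem 7 b ≤ s.reg 7 ∧
      path (s.mem 7 b) = (Cut.run K M (l b)).cur.map (vertAt key) ∧
      s.mem 8 b = (Cut.run K M (l b)).start) ∧
    (∀ b, ∀ L ∈ closedLists key K M (l b), ∃ y, 1 ≤ y ∧ y ≤ s.reg 7 ∧ path y = L) ∧
    s.reg 7 ≤ ∑ b, (l b).length

/-- Every vertex reads every other vertex at most once. At most one node is created per read, so
this bounds the number of nodes, and hence the addresses, polynomially. -/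
theorem sum_length_le [NeZero n] {key : Fin n → ℕ} {l : Fin n → List ℕ}
    (hnd : ∀ b, ((l b).map (vertAt key)).Nodup) : ∑ b, (l b).length ≤ n ^ 2 := by
  calc ∑ b, (l b).length ≤ ∑ _b : Fin n, n :=
        Finset.sum_le_sum fun b _ => by simpa using (hnd b).length_le_card
    _ = n ^ 2 := by simp [sq]

theorem HasPieces.congr [NeZero n] {key : Fin n → ℕ} {K M : ℕ} {l : Fin n → List ℕ}
    {path : ℕ → List (Fin n)} {ml : ℕ → List (Fin n)} {s s' : State}
    (h : HasPieces key K M l path ml s) (h7 : s'.reg 7 = s.reg 7) (hm : s'.mem = s.mem) :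
    HasPieces key K M l path ml s' := by
  obtain ⟨h1, h2, h3, h4, h5⟩ := h
  refine ⟨?_, ?_, ?_, ?_, ?_⟩
  · rw [h7]; exact h1.congr (by rw [hm]) (by rw [hm]) (by rw [hm]) (by rw [hm])
  · unfold HasMembers; rw [h7, hm]; exact h2
  · rw [h7, hm]; exact h3
  · rw [h7]; exact h4
  · rw [h7]; exact h5

/-- A possible closing of the open piece is followed by one step down the trie. The invariant that
every closed list already has a node makes the membership relation stable under the creation of a
node. -/
theorem runs_pushProg [NeZero n] {key : Fin n → ℕ} {K M P : ℕ} {b : Fin n} {l : Fin n → List ℕ}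
    {path : ℕ → List (Fin n)} {ml : ℕ → List (Fin n)} {s : State}
    (hn : 16 ≤ n) (hw : n ^ 4 < 2 ^ w) (h0 : s.reg 0 = n) (h4 : s.reg 4 = K) (h5 : s.reg 5 = M)
    (h10 : s.reg 10 = P) (h11 : s.reg 11 = vertAt key P) (h15 : s.reg 15 = b)
    (hK : K < n) (hM : M ≤ n) (hP : P < 2 * n) (htab : IsTable n K M (s.mem 2))
    (hp : HasPieces key K M l path ml s) (hl : (l b).Pairwise (· < ·)) (hlP : ∀ x ∈ l b, x < P)
    (hnd : ∀ b, ((l b).map (vertAt key)).Nodup) :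
    Runs w ω pushProg s fun t s' => t ≤ 140 ∧ Frame [7] [7, 8, 9, 10, 11, 12, 13, 14] s s' ∧
      (∀ r, r ≠ 7 → r < 16 → s'.reg r = s.reg r) ∧
      ∃ path' ml', HasPieces key K M (Function.update l b (l b ++ [P])) path' ml' s' := by
  obtain ⟨hT, hm, ho, hcl, hct⟩ := hp
  have hc := hct.trans (sum_length_le hnd)
  have hn2 : n * 16 ≤ n ^ 2 := by nlinarith
  obtain ⟨c, h7⟩ : ∃ c, s.reg 7 = c := ⟨_, rfl⟩
  rw [h7] at hT hm ho hcl hct hc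
  have hF0 : Frame [7] [7, 8, 9, 10, 11, 12, 13, 14]  s s := Frame.refl _ _ _
  unfold pushProg
  simp (disch := omega) only [eval_op, eval_reg, eval_const, eval_load, op_add, op_sub, op_mul,
      op_div, op_mod, op_lt, op_and, ite_one_zero_eq, runs_seq, runs_assign, runs_store,
      runs_ite, runs_skip, runs_flip, runs_emit, Function.update_self, ne_eq, not_not,
      Function.update_of_ne, Expr.cost, true_and, and_true, h15]
  refine runs_cutProg (key := key) (K := K) (M := M) (c := c) (P := P) (b := b) (path := path)
    (l := l) (ml := ml) (s := { s with reg := Function.update s.reg 16 (s.mem 7 b) }) hn hw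
    ?_ ?_ ?_ ?_ ?_ ?_ (by omega) hK hM hP htab
    (hT.congr rfl rfl rfl rfl) hm ⟨(ho b).1, (ho b).2.1⟩ (ho b).2.2 hl hlP (hnd b) ?_
  · simp [h0]
  · simp [h4]
  · simp [h5]
  · simp [h10]
  · simp [h15]
  · simp
  intro t1 s1 x1 ml1 ht1 hF1 hr1 h16 hx1 hcur hm1 hclosed hs1
  have r1 : ∀ r, r < 16 → s1.reg r = s.reg r := fun r hr => by
    rw [hr1 r (by omega) (by omega)]
    simp (disch := omega) only [ne_eq, Function.update_of_ne]
  have m1 : ∀ a, a ≠ 8 → a ≠ 13 → a ≠ 14 → s1.mem a = s.mem a := fun a e1 e2 e3 => by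
    rw [hF1.mem a (by simp [e1, e2, e3])]
  refine runs_childProg (c := c) (x := x1) (b := b) (u := vertAt key P) (path := path) hn hw
    (by rw [r1 _ (by omega), h0]) (by rw [r1 _ (by omega), h15]) h16 (by rw [r1 _ (by omega), h7])
    (by rw [r1 _ (by omega), h11]) hx1 (by omega)
    (hT.congr (m1 _ (by omega) (by omega) (by omega)) (m1 _ (by omega) (by omega) (by omega))
      (m1 _ (by omega) (by omega) (by omega)) (m1 _ (by omega) (by omega) (by omega))) ?_
  intro t2 s2 c2 path2 z ht2 hF2 hr2 h7' hcc hcc' hT2 hpath hz1 hz2 hpz hm7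
  have r2 : ∀ r, r ≠ 7 → r < 16 → s2.reg r = s.reg r := fun r h hr => by
    rw [hr2 r h (by omega), r1 r hr]
  have m2 : ∀ a, a ∉ [7, 8, 9, 10, 11, 12, 13, 14] → s2.mem a = s.mem a := fun a ha => by
    simp only [List.mem_cons, List.not_mem_nil, or_false, not_or] at ha
    rw [hF2.mem a (by simp; tauto), m1 a (by tauto) (by tauto) (by tauto)]
  refine ⟨by omega, ⟨?_, m2, ?_⟩, r2, path2, ml1, ?_, ?_, ?_, ?_, ?_⟩
  · intro r hr hr'
    exact r2 r (by simpa using hr') (by omega)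
  · rw [hF2.out, hF1.out]
  · rw [h7']
    exact hT2
  · rw [h7']
    obtain ⟨a1, a2, a3, a4⟩ := hm1
    refine ⟨?_, a2, ?_, ?_⟩
    · rw [hF2.mem 13 (by simp)]; exact a1
    · rw [hF2.mem 14 (by simp)]; exact a3
    · intro x b'
      rw [a4]
      constructor
      · rintro ⟨e1, e2, e3⟩
        rw [← hpath x e2] at e3
        exact ⟨e1, by omega, e3⟩
      · rintro ⟨e1, e2, e3⟩
        beta_reduce at e3
        -- A closed list belongs to an old node, and lists determine nodes, so the node just created
        -- has no members.
        have hold : ∃ y, 1 ≤ y ∧ y ≤ c ∧ path y = path2 x := by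
          by_cases hb : b' = b
          · subst hb
            rw [Function.update_self] at e3
            rcases hclosed _ e3 with h | ⟨h, h'⟩
            · exact hcl _ _ h
            · exact ⟨_, h, (ho b').1, h'⟩
          · rw [Function.update_of_ne hb] at e3
            exact hcl _ _ e3
        obtain ⟨y, y1, y2, y3⟩ := hold
        rw [← hpath y y2] at y3
        have := hT2.inj y (by omega) x e2 y3
        subst this
        rw [hpath y y2] at e3
        exact ⟨e1, y2, e3⟩
  · intro b'
    rw [h7', hm7, hF2.mem 8 (by simp), hs1, m1 7 (by omega) (by omega) (by omega)]
    by_cases hb : b' = b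
    · rw [hb, Function.update_self, Function.update_self, Function.update_self, hcur, hpz]
      exact ⟨hz2, rfl, rfl⟩
    · rw [Function.update_of_ne hb, Function.update_of_ne (by omega),
        Function.update_of_ne (by omega)]
      have := ho b'
      rw [hpath _ this.1]
      exact ⟨by omega, this.2⟩
  · intro b' L hL
    rw [h7']
    have hold : ∃ y, 1 ≤ y ∧ y ≤ c ∧ path y = L := by
      by_cases hb : b' = b
      · subst hb
        rw [Function.update_self] at hL
        rcases hclosed _ hL with h | ⟨h, h'⟩
        · exact hcl _ _ h
        · exact ⟨_, h, (ho b').1, h'⟩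
      · rw [Function.update_of_ne hb] at hL
        exact hcl _ _ hL
    obtain ⟨y, y1, y2, y3⟩ := hold
    exact ⟨y, y1, by omega, by rw [hpath y y2, y3]⟩
  · rw [h7']
    have : ∑ b', (Function.update l b (l b ++ [P]) b').length = ∑ b', (l b').length + 1 := by
      rw [← Finset.add_sum_erase _ _ (Finset.mem_univ b),
        ← Finset.add_sum_erase _ (fun b' => (l b').length) (Finset.mem_univ b),
        Function.update_self, List.length_append, List.length_singleton]
      have : ∑ x ∈ Finset.univ.erase b, (Function.update l b (l b ++ [P]) x).length =
          ∑ x ∈ Finset.univ.erase b, (l x).length :=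
        Finset.sum_congr rfl fun x hx => by rw [Function.update_of_ne (Finset.ne_of_mem_erase hx)]
      rw [this]
      ring
    rw [this]
    omega

/-- The data on which `mainProg` works. -/
structure IsReady [NeZero n] (key : Fin n → ℕ) (H K M : ℕ) (adj : Fin n → List (Fin n))
    (off : ℕ → ℕ) (s : State) : Prop where
  reg0 : s.reg 0 = n
  reg4 : s.reg 4 = K
  reg5 : s.reg 5 = M
  reg6 : s.reg 6 = H
  table : IsTable n K M (s.mem 2)
  key_eq : ∀ v : Fin n, s.mem 3 v = key v
  order : ∀ v : Fin n, s.mem 6 v = keyRank key v ∧ s.mem 5 (keyRank key v) = v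
  off_eq : ∀ v ≤ n, s.mem 0 v = off v
  adj_eq : ∀ (v : Fin n) (j : ℕ) (h : j < (adj v).length), s.mem 1 (off v + j) = (adj v)[j]

theorem IsReady.of_frame [NeZero n] {key : Fin n → ℕ} {H K M : ℕ} {adj : Fin n → List (Fin n)}
    {off : ℕ → ℕ} {s s' : State} (h : IsReady key H K M adj off s)
    (hF : Frame [7] [7, 8, 9, 10, 11, 12, 13, 14] s s') : IsReady key H K M adj off s' := by
  obtain ⟨h0, h4, h5, h6, ht, hk, ho, h8, h9⟩ := h
  constructor
  · rw [hF.reg 0 (by simp) (by simp), h0]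
  · rw [hF.reg 4 (by simp) (by simp), h4]
  · rw [hF.reg 5 (by simp) (by simp), h5]
  · rw [hF.reg 6 (by simp) (by simp), h6]
  · rw [hF.mem 2 (by simp)]; exact ht
  · rw [hF.mem 3 (by simp)]; exact hk
  · rw [hF.mem 6 (by simp), hF.mem 5 (by simp)]; exact ho
  · rw [hF.mem 0 (by simp)]; exact h8
  · rw [hF.mem 1 (by simp)]; exact h9

theorem runs_handleProg [NeZero n] {key : Fin n → ℕ} {H K M P : ℕ} {adj : Fin n → List (Fin n)}
    {off : ℕ → ℕ} {b u : Fin n} {s : State} (hn : 16 ≤ n) (hw : n ^ 4 < 2 ^ w)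
    (hs : IsReady key H K M adj off s) (hkey : ∀ v, key v < 2 * n) (hH : H ≤ 2 * n)
    (hP : P < 2 * n) (h10 : s.reg 10 = P) (h11 : s.reg 11 = u) (h15 : s.reg 15 = b) :
    Runs w ω handleProg s fun t s' => t ≤ 40 ∧
      s' = { s with reg := Function.update s.reg 14 (if Handles key H b u P then 1 else 0) } := by
  have hn4 : 16 * n ^ 3 ≤ n ^ 4 := by
    calc 16 * n ^ 3 ≤ n * n ^ 3 := Nat.mul_le_mul_right _ hn
      _ = n ^ 4 := by ring
  have hn3 : 16 * n ^ 2 ≤ n ^ 3 := by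
    calc 16 * n ^ 2 ≤ n * n ^ 2 := Nat.mul_le_mul_right _ hn
      _ = n ^ 3 := by ring
  have hn2 : n * 16 ≤ n ^ 2 := by nlinarith
  have hku := hkey u
  have hkb := hkey b
  have hr := keyRank_lt key b
  unfold handleProg
  simp (disch := omega) only [eval_op, eval_reg, eval_const, eval_load, op_add, op_sub, op_mul,
      op_div, op_mod, op_lt, op_and, ite_one_zero_eq, runs_seq, runs_assign, runs_store,
      runs_ite, runs_skip, runs_flip, runs_emit, Function.update_self, ne_eq, not_not,
      Function.update_of_ne, Expr.cost, true_and, and_true, hs.reg0, hs.reg6, h10, h11, h15,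
          hs.key_eq, (hs.order b).1]
  by_cases h : P < n
  · rw [if_pos h]
    refine ⟨by omega, ?_⟩
    have : (keyRank key b < P ∧ key u - key b < H + 1) ↔ Handles key H b u P := by
      unfold Handles; omega
    simp only [this]
  · rw [if_neg h]
    refine ⟨by omega, ?_⟩
    have : (P - n < keyRank key b ∧ H < key b - key u) ↔ Handles key H b u P := by
      unfold Handles; omega
    simp only [this]

/-- Two turns visit each vertex twice. This converts the cost of the outer loop into twice the total
degree. -/
theorem sum_range_two_mul_vertAt [NeZero n] (key : Fin n → ℕ) (f : Fin n → ℕ) :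
    ∑ P ∈ Finset.range (2 * n), f (vertAt key P) = 2 * ∑ v, f v := by
  have h1 : ∑ P ∈ Finset.range n, f (vertAt key P) = ∑ v, f v := by
    rw [Finset.sum_range, ← Equiv.sum_comp (keyPlace key).symm f]
    refine Finset.sum_congr rfl fun i _ => ?_
    unfold vertAt
    congr 2
    exact Fin.ext (Nat.mod_eq_of_lt i.2)
  have h2 : ∑ P ∈ Finset.range n, f (vertAt key (n + P)) = ∑ v, f v := by
    rw [← h1]
    refine Finset.sum_congr rfl fun P _ => ?_
    rw [vertAt_congr key (show (n + P) % n = P % n by simp)]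
  rw [two_mul, Finset.sum_range_add, h1, h2, two_mul]

theorem events_succ [NeZero n] {key : Fin n → ℕ} {G : SimpleGraph (Fin n)} {H : ℕ} {b : Fin n}
    {P : ℕ} [Decidable (G.Adj b (vertAt key P))] : events key G H b (P + 1) =
      if G.Adj b (vertAt key P) ∧ Handles key H b (vertAt key P) P then events key G H b P ++ [P]
      else events key G H b P := by
  unfold events
  rw [List.range_succ, List.filter_append]
  split_ifs with h <;> simp [h]

/-- At position `P` only the adjacency list of the vertex there is scanned, and each neighbour `b`
that is responsible at `P` appends `P` to its own list. The inner invariant says that exactly the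
neighbours scanned so far have been updated. -/
theorem runs_mainProg [NeZero n] {key : Fin n → ℕ} {H K M : ℕ} {adj : Fin n → List (Fin n)}
    {off : ℕ → ℕ} {G : SimpleGraph (Fin n)} {s : State} (hn : 16 ≤ n) (hw : n ^ 4 < 2 ^ w)
    (hs : IsReady key H K M adj off s) (hkey : ∀ v, key v < 2 * n) (hH : H ≤ 2 * n) (hK : K < n)
    (hM : M ≤ n) (hadj : IsAdjacencyList G adj)
    (hoff : ∀ v : Fin n, off (v + 1) = off v + (adj v).length) (hle : ∀ v ≤ n, off v ≤ n ^ 2)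
    (hp : ∃ path ml, HasPieces key K M (fun _ => []) path ml s) :
    Runs w ω mainProg s fun t s' => t ≤ 1000 * (n + ∑ v, (adj v).length) ∧
      Frame [7] [7, 8, 9, 10, 11, 12, 13, 14] s s' ∧
      ∃ path ml, HasPieces key K M (fun b => events key G H b (2 * n)) path ml s' := by
  classical
  have hn4 : 16 * n ^ 3 ≤ n ^ 4 := by
    calc 16 * n ^ 3 ≤ n * n ^ 3 := Nat.mul_le_mul_right _ hn
      _ = n ^ 4 := by ring
  have hn3 : 16 * n ^ 2 ≤ n ^ 3 := by
    calc 16 * n ^ 2 ≤ n * n ^ 2 := Nat.mul_le_mul_right _ hn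
      _ = n ^ 3 := by ring
  have hn2 : n * 16 ≤ n ^ 2 := by nlinarith
  unfold mainProg
  simp (disch := omega) only [eval_op, eval_reg, eval_const, eval_load, op_add, op_sub, op_mul,
      op_div, op_mod, op_lt, op_and, ite_one_zero_eq, runs_seq, runs_assign, runs_store,
      runs_ite, runs_skip, runs_flip, runs_emit, Function.update_self, ne_eq, not_not,
      Function.update_of_ne, Expr.cost, true_and, and_true]
  refine (runs_while (fun P s' => Frame [7] [7, 8, 9, 10, 11, 12, 13, 14] s s' ∧ s'.reg 10 = P ∧
      ∃ path ml, HasPieces key K M (fun b => events key G H b P) path ml s') (2 * n)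
      (fun P => 220 * (adj (vertAt key P)).length + 60) ?_ ?_ ?_).mono ?_
  · rintro P s1 hP ⟨hF, h10, hpc⟩
    have hr := hs.of_frame hF
    have hmod : s1.mem 5 (P % n) = vertAt key P := by
      have := (hr.order (vertAt key P)).2
      rwa [keyRank_vertAt] at this
    have hu := (vertAt key P).2
    have hPn : P % n < n := Nat.mod_lt _ (by omega)
    simp (disch := omega) only [eval_op, eval_reg, eval_const, eval_load, op_add, op_sub, op_mul,
      op_div, op_mod, op_lt, op_and, ite_one_zero_eq, runs_seq, runs_assign, runs_store,
      runs_ite, runs_skip, runs_flip, runs_emit, Function.update_self, ne_eq, not_not,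
      Function.update_of_ne, Expr.cost, true_and, and_true, hr.reg0, h10, hmod, hr.off_eq]
    refine ⟨by omega, ?_⟩
    generalize hud : vertAt key P = u at *
    have hou := hoff u
    have hou' := hle (u + 1) hu
    have hind : ∀ j, j ≤ (adj u).length → j ≤ n := fun j hj => by
      have := (hadj u).1.length_le_card
      simp at this
      omega
    refine (runs_while_const (fun j s' => Frame [7] [7, 8, 9, 10, 11, 12, 13, 14] s s' ∧
      s'.reg 10 = P ∧ s'.reg 11 = u ∧ s'.reg 12 = off u + j ∧ s'.reg 13 = off (u + 1) ∧
      ∃ path ml, HasPieces key K M (fun b => if b ∈ (adj u).take j ∧ Handles key H b u P then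
        events key G H b P ++ [P] else events key G H b P) path ml s') (adj u).length 210
        ?_ ?_ ?_).mono ?_
    · rintro j s2 hj ⟨hF2, e10, e11, e12, e13, path, ml, hp2⟩
      have hr2 := hs.of_frame hF2
      have hjn := hind j hj.le
      set b := (adj u)[j] with hb
      simp (disch := omega) only [eval_op, eval_reg, eval_const, eval_load, op_add, op_sub, op_mul,
      op_div, op_mod, op_lt, op_and, ite_one_zero_eq, runs_seq, runs_assign, runs_store,
      runs_ite, runs_skip, runs_flip, runs_emit, Function.update_self, ne_eq, not_not,
      Function.update_of_ne, Expr.cost, true_and, and_true, e10, e11, e12, e13, hr2.adj_eq u j hj]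
      refine ⟨by omega, ?_⟩
      rw [← hb]
      set s3 : State := { s2 with reg := Function.update s2.reg 15 b } with hs3
      have hF3 : Frame [7] [7, 8, 9, 10, 11, 12, 13, 14] s s3 :=
        Frame.update_reg hF2 (by simp)
      have hr3 := hs.of_frame hF3
      refine (runs_handleProg (b := b) (u := u) hn hw hr3 hkey hH hP (by simp [hs3, e10])
        (by simp [hs3, e11]) (by simp [hs3])).mono ?_
      rintro t3 s4 ⟨ht3, hs4⟩
      have hF4 : Frame [7] [7, 8, 9, 10, 11, 12, 13, 14] s s4 := by
        rw [hs4]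
        exact Frame.update_reg hF3 (by simp)
      have hr4 := hs.of_frame hF4
      have g10 : s4.reg 10 = P := by simp [hs4, hs3, e10]
      have g11 : s4.reg 11 = u := by simp [hs4, hs3, e11]
      have g12 : s4.reg 12 = off u + j := by simp [hs4, hs3, e12]
      have g13 : s4.reg 13 = off (u + 1) := by simp [hs4, hs3, e13]
      have g14 : s4.reg 14 = if Handles key H b u P then 1 else 0 := by simp [hs4]
      have g15 : s4.reg 15 = b := by simp [hs4, hs3]
      -- Adjacency lists have no repetitions, so `b` has not been updated at this position before.
      have hbt : b ∉ (adj u).take j := by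
        intro h
        rw [List.mem_take_iff_getElem] at h
        obtain ⟨i, hi, he⟩ := h
        have := (List.Nodup.getElem_inj_iff (hadj u).1).1 he
        omega
      have htake : (adj u).take (j + 1) = (adj u).take j ++ [b] := by
        rw [List.take_succ_eq_append_getElem hj]
      set l : Fin n → List ℕ := fun b => if b ∈ (adj u).take j ∧ Handles key H b u P then
        events key G H b P ++ [P] else events key G H b P with hl
      have hp4 : HasPieces key K M l path ml s4 :=
        hp2.congr (by simp [hs4, hs3]) (by rw [hs4])
      have hlb : l b = events key G H b P := by simp [hl, hbt]
      have hnd : ∀ b, ((l b).map (vertAt key)).Nodup := by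
        intro b'
        simp only [hl]
        split_ifs with h
        · have hG : G.Adj b' u := ((hadj u).2 b').1 (List.mem_of_mem_take h.1) |>.symm
          have := nodup_map_vertAt_events (key := key) (G := G) (H := H) (b := b') (N := P + 1)
          rwa [events_succ, hud, if_pos ⟨hG, h.2⟩] at this
        · exact nodup_map_vertAt_events
      simp (disch := omega) only [eval_op, eval_reg, eval_const, eval_load, op_add, op_sub, op_mul,
      op_div, op_mod, op_lt, op_and, ite_one_zero_eq, runs_seq, runs_assign, runs_store,
      runs_ite, runs_skip, runs_flip, runs_emit, Function.update_self, ne_eq, not_not,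
      Function.update_of_ne, Expr.cost, true_and, and_true, g14, ← hb]
      split_ifs with hh
      · refine (runs_pushProg (b := b) hn hw hr4.reg0 hr4.reg4 hr4.reg5 g10 (by rw [hud, g11]) g15
          hK hM hP hr4.table hp4 ?_ ?_ hnd).mono ?_
        · rw [hlb]
          exact pairwise_events
        · rw [hlb]
          exact fun x hx => (mem_events.1 hx).1
        rintro t5 s5 ⟨ht5, hF5, hr5, path', ml', hp5⟩
        have g12' : s5.reg 12 = off u + j := by rw [hr5 12 (by omega) (by omega), g12]
        have hF := hF4.trans hF5
        simp (disch := omega) only [eval_op, eval_reg, eval_const, eval_load, op_add, op_sub,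
            op_mul,
      op_div, op_mod, op_lt, op_and, ite_one_zero_eq, runs_seq, runs_assign, runs_store,
      runs_ite, runs_skip, runs_flip, runs_emit, Function.update_self, ne_eq, not_not,
      Function.update_of_ne, Expr.cost, true_and, and_true, g12']
        refine ⟨by omega, by (apply_rules [hF.set_flips, Frame.update_reg,
            Frame.update_mem] <;> simp), ?_, ?_, by omega, ?_, path', ml', ?_⟩
        · rw [hr5 10 (by omega) (by omega), g10]
        · rw [hr5 11 (by omega) (by omega), g11]
        · rw [hr5 13 (by omega) (by omega), g13]
        · have : (fun b' => if b' ∈ (adj u).take (j + 1) ∧ Handles key H b' u P then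
              events key G H b' P ++ [P] else events key G H b' P) =
              Function.update l b (l b ++ [P]) := by
            ext1 b'
            by_cases hb' : b' = b
            · rw [hb', Function.update_self, hlb, if_pos]
              exact ⟨by rw [htake]; simp, hh⟩
            · rw [Function.update_of_ne hb', htake]
              simp [hl, hb']
          rw [this]
          exact hp5.congr (by simp) rfl
      · have hF := hF4
        simp (disch := omega) only [eval_op, eval_reg, eval_const, eval_load, op_add, op_sub,
            op_mul,
      op_div, op_mod, op_lt, op_and, ite_one_zero_eq, runs_seq, runs_assign, runs_store,
      runs_ite, runs_skip, runs_flip, runs_emit, Function.update_self, ne_eq, not_not,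
      Function.update_of_ne, Expr.cost, true_and, and_true, g12]
        refine ⟨by omega, by (apply_rules [hF.set_flips, Frame.update_reg,
            Frame.update_mem] <;> simp), g10, g11, by omega, g13, path, ml, ?_⟩
        have : (fun b' => if b' ∈ (adj u).take (j + 1) ∧ Handles key H b' u P then
            events key G H b' P ++ [P] else events key G H b' P) = l := by
          ext1 b'
          by_cases hb' : b' = b
          · rw [hb', hlb, if_neg (by tauto)]
          · simp [hl, htake, hb']
        rw [this]
        exact hp4.congr (by simp) rfl
    · rintro s2 ⟨hF2, e10, e11, e12, e13, -⟩
      simp (disch := omega) only [eval_op, eval_reg, eval_const, eval_load, op_add, op_sub, op_mul,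
      op_div, op_mod, op_lt, op_and, ite_one_zero_eq, runs_seq, runs_assign, runs_store,
      runs_ite, runs_skip, runs_flip, runs_emit, Function.update_self, ne_eq, not_not,
      Function.update_of_ne, Expr.cost, true_and, and_true, e12, e13]
      omega
    · obtain ⟨path, ml, h⟩ := hpc
      refine ⟨by (apply_rules [hF.set_flips, Frame.update_reg, Frame.update_mem] <;> simp), ?_, ?_,
          ?_, ?_, path, ml, ?_⟩
      · simp (disch := omega) only [eval_op, eval_reg, eval_const, eval_load, op_add, op_sub,
            op_mul,
      op_div, op_mod, op_lt, op_and, ite_one_zero_eq, runs_seq, runs_assign, runs_store,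
      runs_ite, runs_skip, runs_flip, runs_emit, Function.update_self, ne_eq, not_not,
      Function.update_of_ne, Expr.cost, true_and, and_true, h10]
      · simp (disch := omega) only [eval_op, eval_reg, eval_const, eval_load, op_add, op_sub,
            op_mul,
      op_div, op_mod, op_lt, op_and, ite_one_zero_eq, runs_seq, runs_assign, runs_store,
      runs_ite, runs_skip, runs_flip, runs_emit, Function.update_self, ne_eq, not_not,
      Function.update_of_ne, Expr.cost, true_and, and_true]
      · simp (disch := omega) only [eval_op, eval_reg, eval_const, eval_load, op_add, op_sub,
            op_mul,
      op_div, op_mod, op_lt, op_and, ite_one_zero_eq, runs_seq, runs_assign, runs_store,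
      runs_ite, runs_skip, runs_flip, runs_emit, Function.update_self, ne_eq, not_not,
      Function.update_of_ne, Expr.cost, true_and, and_true, add_zero]
      · simp (disch := omega) only [eval_op, eval_reg, eval_const, eval_load, op_add, op_sub,
            op_mul,
      op_div, op_mod, op_lt, op_and, ite_one_zero_eq, runs_seq, runs_assign, runs_store,
      runs_ite, runs_skip, runs_flip, runs_emit, Function.update_self, ne_eq, not_not,
      Function.update_of_ne, Expr.cost, true_and, and_true]
      simp only [List.take_zero, List.not_mem_nil, false_and, if_false]
      exact h.congr (by simp) rfl
    · rintro t s2 ⟨ht, hF2, e10, e11, e12, e13, path, ml, hp2⟩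
      have hF := hF2
      simp (disch := omega) only [eval_op, eval_reg, eval_const, eval_load, op_add, op_sub, op_mul,
      op_div, op_mod, op_lt, op_and, ite_one_zero_eq, runs_seq, runs_assign, runs_store,
      runs_ite, runs_skip, runs_flip, runs_emit, Function.update_self, ne_eq, not_not,
      Function.update_of_ne, Expr.cost, true_and, and_true, e10]
      refine ⟨?_, by (apply_rules [hF.set_flips, Frame.update_reg, Frame.update_mem] <;> simp),
          path, ml, ?_⟩
      · simp only [Expr.cost] at ht
        omega
      -- After the whole list is scanned, the updated vertices are those adjacent to `u`; by
      -- symmetry of adjacency this is the recursion for events.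
      · have : (fun b' => if b' ∈ (adj u).take (adj u).length ∧ Handles key H b' u P then
            events key G H b' P ++ [P] else events key G H b' P) =
            fun b' => events key G H b' (P + 1) := by
          ext1 b'
          simp only [events_succ, hud, List.take_length, (hadj u).2, G.adj_comm]
        rw [this] at hp2
        exact hp2.congr (by simp) rfl
  · rintro s1 ⟨hF, h10, -⟩
    have hr := hs.of_frame hF
    simp (disch := omega) only [eval_op, eval_reg, eval_const, eval_load, op_add, op_sub, op_mul,
      op_div, op_mod, op_lt, op_and, ite_one_zero_eq, runs_seq, runs_assign, runs_store,
      runs_ite, runs_skip, runs_flip, runs_emit, Function.update_self, ne_eq, not_not,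
      Function.update_of_ne, Expr.cost, true_and, and_true, hr.reg0, h10]
    omega
  · have hF := Frame.refl [7] [7, 8, 9, 10, 11, 12, 13, 14] s
    refine ⟨by (apply_rules [hF.set_flips, Frame.update_reg, Frame.update_mem] <;> simp), ?_, ?_⟩
    · simp (disch := omega) only [eval_op, eval_reg, eval_const, eval_load, op_add, op_sub, op_mul,
      op_div, op_mod, op_lt, op_and, ite_one_zero_eq, runs_seq, runs_assign, runs_store,
      runs_ite, runs_skip, runs_flip, runs_emit, Function.update_self, ne_eq, not_not,
      Function.update_of_ne, Expr.cost, true_and, and_true]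
    · obtain ⟨path, ml, h⟩ := hp
      exact ⟨path, ml, h.congr (by simp) rfl⟩
  · rintro t s' ⟨ht, hF, h10, hpp⟩
    refine ⟨?_, hF, hpp⟩
    rw [Finset.sum_add_distrib, Finset.sum_add_distrib, Finset.sum_add_distrib, ← Finset.mul_sum,
      sum_range_two_mul_vertAt key fun v => (adj v).length] at ht
    simp [Expr.cost] at ht ⊢
    omega

end WordRAM

/-! ### Closing the last pieces and printing the bicliques. -/

set_option linter.unusedSimpArgs false
set_option linter.unnecessarySeqFocus false

namespace WordRAM

variable {w : ℕ} {ω : ℕ → Bool} {n : ℕ}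

theorem vertexPieces_eq [NeZero n] {key : Fin n → ℕ} {G : SimpleGraph (Fin n)} {H K M : ℕ}
    (b : Fin n) : vertexPieces key G H K M b =
      if (Cut.run K M (events key G H b (2 * n))).cur = [] then
        closedLists key K M (events key G H b (2 * n))
      else (Cut.run K M (events key G H b (2 * n))).cur.map (vertAt key) ::
        closedLists key K M (events key G H b (2 * n)) := by
  unfold vertexPieces Cut.pieces closedLists
  split_ifs <;> rfl

/-- The only difference between closed pieces and all pieces is a nonempty open piece; closing it
for each vertex in turn completes the membership lists. -/
theorem runs_flushProg [NeZero n] {key : Fin n → ℕ} {G : SimpleGraph (Fin n)} {H K M : ℕ}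
    {path ml : ℕ → List (Fin n)} {s : State} (hn : 16 ≤ n) (hw : n ^ 4 < 2 ^ w)
    (h0 : s.reg 0 = n) (hp : HasPieces key K M (fun b => events key G H b (2 * n)) path ml s) :
    Runs w ω flushProg s fun t s' => t ≤ 50 * n + 50 ∧ Frame [] [13, 14] s s' ∧
      ∃ ml', HasMembers (s.reg 7) path (vertexPieces key G H K M) ml' s' := by
  obtain ⟨hT, hm, ho, hcl, hct⟩ := hp
  have hc := hct.trans (sum_length_le fun b => nodup_map_vertAt_events)
  have hn4 : 16 * n ^ 3 ≤ n ^ 4 := by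
    calc 16 * n ^ 3 ≤ n * n ^ 3 := Nat.mul_le_mul_right _ hn
      _ = n ^ 4 := by ring
  have hn3 : 16 * n ^ 2 ≤ n ^ 3 := by
    calc 16 * n ^ 2 ≤ n * n ^ 2 := Nat.mul_le_mul_right _ hn
      _ = n ^ 3 := by ring
  have hn2 : n * 16 ≤ n ^ 2 := by nlinarith
  unfold flushProg
  simp (disch := omega) only [eval_op, eval_reg, eval_const, eval_load, op_add, op_sub, op_mul,
      op_div, op_mod, op_lt, op_and, ite_one_zero_eq, runs_seq, runs_assign, runs_store,
      runs_ite, runs_skip, runs_flip, runs_emit, Function.update_self, ne_eq, not_not,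
      Function.update_of_ne, Expr.cost, true_and, and_true]
  refine (runs_while_const (fun j s' => Frame [] [13, 14] s s' ∧ s'.reg 15 = j ∧
      ∃ ml', HasMembers (s.reg 7) path (fun b => if (b : ℕ) < j then vertexPieces key G H K M b else
        closedLists key K M (events key G H b (2 * n))) ml' s') n 40 ?_ ?_ ?_).mono ?_
  · rintro j s1 hj ⟨hF, h15, ml1, hm1⟩
    have h0' : s1.reg 0 = n := by rw [hF.reg 0 (by simp) (by simp), h0]
    set b : Fin n := ⟨j, hj⟩ with hb
    have h7 : s1.mem 7 j = s.mem 7 b := by rw [hF.mem 7 (by simp)]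
    simp (disch := omega) only [eval_op, eval_reg, eval_const, eval_load, op_add, op_sub, op_mul,
      op_div, op_mod, op_lt, op_and, ite_one_zero_eq, runs_seq, runs_assign, runs_store,
      runs_ite, runs_skip, runs_flip, runs_emit, Function.update_self, ne_eq, not_not,
      Function.update_of_ne, Expr.cost, true_and, and_true, h0', h15, h7]
    refine ⟨hj, ?_⟩
    have hob := ho b
    have hne : s.mem 7 b ≠ 0 ↔ (Cut.run K M (events key G H b (2 * n))).cur ≠ [] := by
      rw [← hT.path_ne_nil hob.1, hob.2.1]
      simp
    have hstep : (fun b' : Fin n => if (b' : ℕ) < j + 1 then vertexPieces key G H K M b' else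
        closedLists key K M (events key G H b' (2 * n))) =
        Function.update (fun b' : Fin n => if (b' : ℕ) < j then vertexPieces key G H K M b' else
          closedLists key K M (events key G H b' (2 * n))) b (vertexPieces key G H K M b) := by
      ext1 b'
      by_cases hb' : b' = b
      · rw [hb', Function.update_self, if_pos (by simp [hb])]
      · have : (b' : ℕ) ≠ j := fun h => hb' (Fin.ext h)
        rw [Function.update_of_ne hb']
        simp only [show ((b' : ℕ) < j + 1) ↔ ((b' : ℕ) < j) by omega]
    rw [hstep]
    by_cases hx : s.mem 7 b ≠ 0
    · rw [if_pos hx]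
      refine runs_closeProg (c := s.reg 7) (x := s.mem 7 b) (b := b) (path := path)
        (closed := (fun b' : Fin n => if (b' : ℕ) < j then vertexPieces key G H K M b' else
          closedLists key K M (events key G H b' (2 * n)))) (ml := ml1)
        (s := { s1 with reg := Function.update s1.reg 16 (s.mem 7 b) }) hn hw ?_ ?_ ?_
        (Nat.pos_of_ne_zero hx) hob.1 (by omega) hT.inj hm1 ?_ ?_
      · simp (disch := omega) only [eval_op, eval_reg, eval_const, eval_load, op_add, op_sub,
            op_mul,
      op_div, op_mod, op_lt, op_and, ite_one_zero_eq, runs_seq, runs_assign, runs_store,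
      runs_ite, runs_skip, runs_flip, runs_emit, Function.update_self, ne_eq, not_not,
      Function.update_of_ne, Expr.cost, true_and, and_true, h0']
      · simp (disch := omega) only [eval_op, eval_reg, eval_const, eval_load, op_add, op_sub,
            op_mul,
      op_div, op_mod, op_lt, op_and, ite_one_zero_eq, runs_seq, runs_assign, runs_store,
      runs_ite, runs_skip, runs_flip, runs_emit, Function.update_self, ne_eq, not_not,
      Function.update_of_ne, Expr.cost, true_and, and_true, h15]
        rfl
      · simp (disch := omega) only [eval_op, eval_reg, eval_const, eval_load, op_add, op_sub,
            op_mul,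
      op_div, op_mod, op_lt, op_and, ite_one_zero_eq, runs_seq, runs_assign, runs_store,
      runs_ite, runs_skip, runs_flip, runs_emit, Function.update_self, ne_eq, not_not,
      Function.update_of_ne, Expr.cost, true_and, and_true]
      · rw [hob.2.1]
        simp only [hb, lt_irrefl, if_false]
        exact Cut.cur_not_mem_closed nodup_map_vertAt_events (Cut.cur_ne_nil_iff.1 (hne.1 hx))
      intro t s2 ht hreg hmem hout hm2
      have e15 : s2.reg 15 = j := by rw [hreg]; simp (disch := omega) only [eval_op, eval_reg,
          eval_const, eval_load, op_add, op_sub, op_mul,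
      op_div, op_mod, op_lt, op_and, ite_one_zero_eq, runs_seq, runs_assign, runs_store,
      runs_ite, runs_skip, runs_flip, runs_emit, Function.update_self, ne_eq, not_not,
      Function.update_of_ne, Expr.cost, true_and, and_true, h15]
      have hF2 : Frame [] [13, 14] s s2 := by
        refine ⟨?_, ?_, ?_⟩
        · intro r h1 h2
          rw [hreg]
          simp only [Function.update_of_ne (show r ≠ 16 by omega)]
          exact hF.reg r h1 h2
        · intro a ha
          rw [hmem a (by rintro rfl; simp at ha) (by rintro rfl; simp at ha)]
          exact hF.mem a ha
        · rw [hout]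
          exact hF.out
      have hF := hF2
      simp (disch := omega) only [eval_op, eval_reg, eval_const, eval_load, op_add, op_sub, op_mul,
      op_div, op_mod, op_lt, op_and, ite_one_zero_eq, runs_seq, runs_assign, runs_store,
      runs_ite, runs_skip, runs_flip, runs_emit, Function.update_self, ne_eq, not_not,
      Function.update_of_ne, Expr.cost, true_and, and_true, e15]
      refine ⟨by omega, by (apply_rules [hF.set_flips, Frame.update_reg,
          Frame.update_mem] <;> simp),
        Function.update ml1 (s.mem 7 b) (ml1 (s.mem 7 b) ++ [b]), ?_⟩
      rw [vertexPieces_eq, if_neg (hne.1 hx)]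
      rw [hob.2.1] at hm2
      simp only [hb, lt_irrefl, if_false] at hm2
      exact hm2
    · rw [if_neg hx]
      refine ⟨by omega, by (apply_rules [hF.set_flips, Frame.update_reg,
          Frame.update_mem] <;> simp), ml1, ?_⟩
      rw [vertexPieces_eq, if_pos (by_contra fun h => hx (hne.2 h))]
      have := Function.update_eq_self b (fun b' : Fin n => if (b' : ℕ) < j then
        vertexPieces key G H K M b' else closedLists key K M (events key G H b' (2 * n)))
      simp only [hb, lt_irrefl, if_false] at this ⊢
      rw [this]
      exact hm1
  · rintro s1 ⟨hF, h15, -⟩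
    have h0' : s1.reg 0 = n := by rw [hF.reg 0 (by simp) (by simp), h0]
    simp (disch := omega) only [eval_op, eval_reg, eval_const, eval_load, op_add, op_sub, op_mul,
      op_div, op_mod, op_lt, op_and, ite_one_zero_eq, runs_seq, runs_assign, runs_store,
      runs_ite, runs_skip, runs_flip, runs_emit, Function.update_self, ne_eq, not_not,
      Function.update_of_ne, Expr.cost, true_and, and_true, h0', h15]
    omega
  · have hF := Frame.refl [] [13, 14] s
    refine ⟨by (apply_rules [hF.set_flips, Frame.update_reg, Frame.update_mem] <;> simp), ?_, ml,
        ?_⟩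
    · simp (disch := omega) only [eval_op, eval_reg, eval_const, eval_load, op_add, op_sub, op_mul,
      op_div, op_mod, op_lt, op_and, ite_one_zero_eq, runs_seq, runs_assign, runs_store,
      runs_ite, runs_skip, runs_flip, runs_emit, Function.update_self, ne_eq, not_not,
      Function.update_of_ne, Expr.cost, true_and, and_true]
    · simpa [HasMembers] using hm
  · rintro t s' ⟨ht, hF, -, ml', hm'⟩
    simp only [Fin.is_lt, if_true] at hm'
    refine ⟨?_, hF, ml', hm'⟩
    simp [Expr.cost] at ht ⊢
    omega

/-- Lists in the trie have the vertex read last at the head, so following the parent pointers down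
to the root prints the list of the node in order. -/
theorem runs_emitNodeProg {c y : ℕ} {path : ℕ → List (Fin n)} {L : List (Fin n)} {s : State}
    (hn : 16 ≤ n) (hw : n ^ 4 < 2 ^ w) (h0 : s.reg 0 = n) (h10 : s.reg 10 = y) (hy : y ≤ c)
    (hc : c ≤ n ^ 2) (hT : IsTrie c path s) (hlen : s.mem 13 y = L.length) (hLn : L.length ≤ n)
    (hL : ∀ i (h : i < L.length), s.mem 14 (y * n + i) = L[i]) :
    Runs w ω emitNodeProg s fun t s' => t ≤ 30 * ((path y).length + L.length) + 50 ∧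
      s'.mem = s.mem ∧ s'.reg 0 = s.reg 0 ∧ s'.reg 7 = s.reg 7 ∧ s'.reg 10 = y ∧
      s'.out = s.out ++ bicliqueCode [(path y, L)] := by
  have hn4 : 16 * n ^ 3 ≤ n ^ 4 := by
    calc 16 * n ^ 3 ≤ n * n ^ 3 := Nat.mul_le_mul_right _ hn
      _ = n ^ 4 := by ring
  have hn3 : 16 * n ^ 2 ≤ n ^ 3 := by
    calc 16 * n ^ 2 ≤ n * n ^ 2 := Nat.mul_le_mul_right _ hn
      _ = n ^ 3 := by ring
  have hn2 : n * 16 ≤ n ^ 2 := by nlinarith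
  have hyn : y * n ≤ n ^ 3 := by
    calc y * n ≤ n ^ 2 * n := Nat.mul_le_mul_right _ (hy.trans hc)
      _ = n ^ 3 := by ring
  unfold emitNodeProg
  simp (disch := omega) only [eval_op, eval_reg, eval_const, eval_load, op_add, op_sub, op_mul,
      op_div, op_mod, op_lt, op_and, ite_one_zero_eq, runs_seq, runs_assign, runs_store,
      runs_ite, runs_skip, runs_flip, runs_emit, Function.update_self, ne_eq, not_not,
      Function.update_of_ne, Expr.cost, true_and, and_true, h10, hlen]
  refine (runs_while_const (fun i s' => s'.mem = s.mem ∧ s'.reg 0 = s.reg 0 ∧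
      s'.reg 7 = s.reg 7 ∧ s'.reg 10 = y ∧ s'.reg 11 ≤ c ∧ path (s'.reg 11) = (path y).drop i ∧
      s'.out = s.out ++ (path y).length :: ((path y).take i).map Fin.val) (path y).length 10
      ?_ ?_ ?_).mono ?_
  · rintro i s1 hi ⟨hm, e0, e7, e10, e11, hpath, hout⟩
    have hT1 : IsTrie c path s1 := hT.congr (by rw [hm]) (by rw [hm]) (by rw [hm]) (by rw [hm])
    have hne : s1.reg 11 ≠ 0 := by
      rw [← hT1.path_ne_nil e11, hpath]
      simpa using hi
    obtain ⟨u, hu, hpu⟩ := hT1.path_eq _ (by omega) e11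
    have hlt := hT1.parent_lt _ (by omega) e11
    rw [hpath, List.drop_eq_getElem_cons hi, List.cons.injEq] at hpu
    simp (disch := omega) only [eval_op, eval_reg, eval_const, eval_load, op_add, op_sub, op_mul,
      op_div, op_mod, op_lt, op_and, ite_one_zero_eq, runs_seq, runs_assign, runs_store,
      runs_ite, runs_skip, runs_flip, runs_emit, Function.update_self, ne_eq, not_not,
      Function.update_of_ne, Expr.cost, true_and, and_true, hu]
    refine ⟨hne, by omega, hm, e0, e7, e10, by omega, hpu.2.symm, ?_⟩
    rw [hout, List.take_succ_eq_append_getElem hi, ← hpu.1]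
    simp only [List.map_append, List.map_cons, List.map_nil, List.append_assoc, List.cons_append]
  · rintro s1 ⟨hm, e0, e7, e10, e11, hpath, hout⟩
    have hT1 : IsTrie c path s1 := hT.congr (by rw [hm]) (by rw [hm]) (by rw [hm]) (by rw [hm])
    simp (disch := omega) only [eval_op, eval_reg, eval_const, eval_load, op_add, op_sub, op_mul,
      op_div, op_mod, op_lt, op_and, ite_one_zero_eq, runs_seq, runs_assign, runs_store,
      runs_ite, runs_skip, runs_flip, runs_emit, Function.update_self, ne_eq, not_not,
      Function.update_of_ne, Expr.cost, true_and, and_true]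
    by_contra hne
    exact (hT1.path_ne_nil e11).2 hne (by rw [hpath]; simp)
  · refine ⟨rfl, ?_, ?_, ?_, ?_, ?_, ?_⟩
    · simp (disch := omega) only [eval_op, eval_reg, eval_const, eval_load, op_add, op_sub, op_mul,
      op_div, op_mod, op_lt, op_and, ite_one_zero_eq, runs_seq, runs_assign, runs_store,
      runs_ite, runs_skip, runs_flip, runs_emit, Function.update_self, ne_eq, not_not,
      Function.update_of_ne, Expr.cost, true_and, and_true]
    · simp (disch := omega) only [eval_op, eval_reg, eval_const, eval_load, op_add, op_sub, op_mul,
      op_div, op_mod, op_lt, op_and, ite_one_zero_eq, runs_seq, runs_assign, runs_store,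
      runs_ite, runs_skip, runs_flip, runs_emit, Function.update_self, ne_eq, not_not,
      Function.update_of_ne, Expr.cost, true_and, and_true]
    · simp (disch := omega) only [eval_op, eval_reg, eval_const, eval_load, op_add, op_sub, op_mul,
      op_div, op_mod, op_lt, op_and, ite_one_zero_eq, runs_seq, runs_assign, runs_store,
      runs_ite, runs_skip, runs_flip, runs_emit, Function.update_self, ne_eq, not_not,
      Function.update_of_ne, Expr.cost, true_and, and_true, h10]
    · simp (disch := omega) only [eval_op, eval_reg, eval_const, eval_load, op_add, op_sub, op_mul,
      op_div, op_mod, op_lt, op_and, ite_one_zero_eq, runs_seq, runs_assign, runs_store,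
      runs_ite, runs_skip, runs_flip, runs_emit, Function.update_self, ne_eq, not_not,
      Function.update_of_ne, Expr.cost, true_and, and_true, hy]
    · simp (disch := omega) only [eval_op, eval_reg, eval_const, eval_load, op_add, op_sub, op_mul,
      op_div, op_mod, op_lt, op_and, ite_one_zero_eq, runs_seq, runs_assign, runs_store,
      runs_ite, runs_skip, runs_flip, runs_emit, Function.update_self, ne_eq, not_not,
      Function.update_of_ne, Expr.cost, true_and, and_true, List.drop_zero]
    · simp [hT.depth y hy]
  rintro t1 s1 ⟨ht1, hm, e0, e7, e10, -, -, hout⟩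
  simp (disch := omega) only [eval_op, eval_reg, eval_const, eval_load, op_add, op_sub, op_mul,
      op_div, op_mod, op_lt, op_and, ite_one_zero_eq, runs_seq, runs_assign, runs_store,
      runs_ite, runs_skip, runs_flip, runs_emit, Function.update_self, ne_eq, not_not,
      Function.update_of_ne, Expr.cost, true_and, and_true, e10, hm, hlen]
  refine (runs_while_const (fun i s' => s'.mem = s.mem ∧ s'.reg 0 = s.reg 0 ∧
      s'.reg 7 = s.reg 7 ∧ s'.reg 10 = y ∧ s'.reg 12 = i ∧
      s'.out = s1.out ++ L.length :: (L.take i).map Fin.val) L.length 20 ?_ ?_ ?_).mono ?_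
  · rintro i s2 hi ⟨hm2, f0, f7, f10, f12, hout2⟩
    simp (disch := omega) only [eval_op, eval_reg, eval_const, eval_load, op_add, op_sub, op_mul,
      op_div, op_mod, op_lt, op_and, ite_one_zero_eq, runs_seq, runs_assign, runs_store,
      runs_ite, runs_skip, runs_flip, runs_emit, Function.update_self, ne_eq, not_not,
      Function.update_of_ne, Expr.cost, true_and, and_true, f0, h0, f10, f12, hm2, hlen, hL i hi]
    refine ⟨hi, by omega, f7, ?_⟩
    rw [hout2, List.take_succ_eq_append_getElem hi]
    simp only [List.map_append, List.map_cons, List.map_nil, List.append_assoc, List.cons_append]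
  · rintro s2 ⟨hm2, f0, f7, f10, f12, hout2⟩
    simp (disch := omega) only [eval_op, eval_reg, eval_const, eval_load, op_add, op_sub, op_mul,
      op_div, op_mod, op_lt, op_and, ite_one_zero_eq, runs_seq, runs_assign, runs_store,
      runs_ite, runs_skip, runs_flip, runs_emit, Function.update_self, ne_eq, not_not,
      Function.update_of_ne, Expr.cost, true_and, and_true, f10, f12, hm2, hlen]
    omega
  · refine ⟨rfl, ?_, ?_, ?_, ?_, ?_⟩
    · simp (disch := omega) only [eval_op, eval_reg, eval_const, eval_load, op_add, op_sub, op_mul,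
      op_div, op_mod, op_lt, op_and, ite_one_zero_eq, runs_seq, runs_assign, runs_store,
      runs_ite, runs_skip, runs_flip, runs_emit, Function.update_self, ne_eq, not_not,
      Function.update_of_ne, Expr.cost, true_and, and_true, e0]
    · simp (disch := omega) only [eval_op, eval_reg, eval_const, eval_load, op_add, op_sub, op_mul,
      op_div, op_mod, op_lt, op_and, ite_one_zero_eq, runs_seq, runs_assign, runs_store,
      runs_ite, runs_skip, runs_flip, runs_emit, Function.update_self, ne_eq, not_not,
      Function.update_of_ne, Expr.cost, true_and, and_true, e7]
    · simp (disch := omega) only [eval_op, eval_reg, eval_const, eval_load, op_add, op_sub, op_mul,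
      op_div, op_mod, op_lt, op_and, ite_one_zero_eq, runs_seq, runs_assign, runs_store,
      runs_ite, runs_skip, runs_flip, runs_emit, Function.update_self, ne_eq, not_not,
      Function.update_of_ne, Expr.cost, true_and, and_true, e10]
    · simp (disch := omega) only [eval_op, eval_reg, eval_const, eval_load, op_add, op_sub, op_mul,
      op_div, op_mod, op_lt, op_and, ite_one_zero_eq, runs_seq, runs_assign, runs_store,
      runs_ite, runs_skip, runs_flip, runs_emit, Function.update_self, ne_eq, not_not,
      Function.update_of_ne, Expr.cost, true_and, and_true]
    · simp
  · rintro t2 s2 ⟨ht2, hm2, f0, f7, f10, f12, hout2⟩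
    refine ⟨?_, hm2, f0, f7, f10, ?_⟩
    · simp only [Expr.cost] at ht1 ht2
      omega
    · rw [hout2, hout]
      simp [bicliqueCode]

/-- The pairs of the nodes `1, …, i` with members. -/
def nodePairs (path ml : ℕ → List (Fin n)) (i : ℕ) : List (List (Fin n) × List (Fin n)) :=
  ((List.range i).filter fun y => ml (y + 1) ≠ []).map fun y => (path (y + 1), ml (y + 1))

/-- Nodes without members cost a constant. The cost of every other node is written as a sum over its
members, so that it can later be charged to the vertices. -/
theorem runs_outputProg {c : ℕ} {path ml : ℕ → List (Fin n)} {V : Fin n → List (List (Fin n))}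
    {s : State} (hn : 16 ≤ n) (hw : n ^ 4 < 2 ^ w) (h0 : s.reg 0 = n) (h7 : s.reg 7 = c)
    (hc : c ≤ n ^ 2) (hT : IsTrie c path s) (hm : HasMembers c path V ml s) (hout : s.out = []) :
    Runs w ω outputProg s fun t s' =>
      t ≤ ∑ y ∈ Finset.range c, ∑ _b ∈ (ml (y + 1)).toFinset, 100 * ((path (y + 1)).length + 1) +
        50 * c + 50 ∧
      s'.out = bicliqueCode (nodePairs path ml c) := by
  have hn4 : 16 * n ^ 3 ≤ n ^ 4 := by
    calc 16 * n ^ 3 ≤ n * n ^ 3 := Nat.mul_le_mul_right _ hn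
      _ = n ^ 4 := by ring
  have hn3 : 16 * n ^ 2 ≤ n ^ 3 := by
    calc 16 * n ^ 2 ≤ n * n ^ 2 := Nat.mul_le_mul_right _ hn
      _ = n ^ 3 := by ring
  have hn2 : n * 16 ≤ n ^ 2 := by nlinarith
  obtain ⟨m1, m2, m3, m4⟩ := hm
  unfold outputProg
  simp (disch := omega) only [eval_op, eval_reg, eval_const, eval_load, op_add, op_sub, op_mul,
      op_div, op_mod, op_lt, op_and, ite_one_zero_eq, runs_seq, runs_assign, runs_store,
      runs_ite, runs_skip, runs_flip, runs_emit, Function.update_self, ne_eq, not_not,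
      Function.update_of_ne, Expr.cost, true_and, and_true]
  refine (runs_while (fun i s' => s'.mem = s.mem ∧ s'.reg 0 = n ∧ s'.reg 7 = c ∧
      s'.reg 10 = i + 1 ∧ s'.out = bicliqueCode (nodePairs path ml i)) c
      (fun y => ∑ _b ∈ (ml (y + 1)).toFinset, 100 * ((path (y + 1)).length + 1) + 20)
      ?_ ?_ ?_).mono ?_
  · rintro i s1 hi ⟨hmem, e0, e7, e10, hout1⟩
    simp (disch := omega) only [eval_op, eval_reg, eval_const, eval_load, op_add, op_sub, op_mul,
      op_div, op_mod, op_lt, op_and, ite_one_zero_eq, runs_seq, runs_assign, runs_store,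
      runs_ite, runs_skip, runs_flip, runs_emit, Function.update_self, ne_eq, not_not,
      Function.update_of_ne, Expr.cost, true_and, and_true, e7, e10, hmem, m1]
    refine ⟨by omega, ?_⟩
    have hrange : nodePairs path ml (i + 1) = nodePairs path ml i ++
        if ml (i + 1) ≠ [] then [(path (i + 1), ml (i + 1))] else [] := by
      unfold nodePairs
      rw [List.range_succ, List.filter_append, List.map_append]
      split_ifs with h <;> simp [h]
    have hsum : ∑ _b ∈ (ml (i + 1)).toFinset, 100 * ((path (i + 1)).length + 1) =
        (ml (i + 1)).length * (100 * ((path (i + 1)).length + 1)) := by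
      rw [Finset.sum_const, List.toFinset_card_of_nodup (m2 _), smul_eq_mul]
    rw [hsum]
    by_cases h : (ml (i + 1)).length ≠ 0
    · rw [if_pos h]
      refine (runs_emitNodeProg (c := c) (y := i + 1) (path := path) (L := ml (i + 1)) hn hw e0 e10
        (by omega) hc (hT.congr (by rw [hmem]) (by rw [hmem]) (by rw [hmem]) (by rw [hmem]))
        (by rw [hmem, m1]) (by simpa using (m2 (i + 1)).length_le_card)
        (by rw [hmem]; exact m3 _)).mono ?_
      rintro t s2 ⟨ht, g1, g2, g3, g4, g5⟩
      simp (disch := omega) only [eval_op, eval_reg, eval_const, eval_load, op_add, op_sub, op_mul,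
      op_div, op_mod, op_lt, op_and, ite_one_zero_eq, runs_seq, runs_assign, runs_store,
      runs_ite, runs_skip, runs_flip, runs_emit, Function.update_self, ne_eq, not_not,
      Function.update_of_ne, Expr.cost, true_and, and_true, g4]
      refine ⟨?_, by rw [g1, hmem], by rw [g2, e0], by rw [g3, e7], ?_⟩
      · have h1 : 1 ≤ (ml (i + 1)).length := by omega
        -- The list is printed once, but it can be paid for once per member because there is at
        -- least one.
        have h2 : (path (i + 1)).length ≤ (ml (i + 1)).length * (path (i + 1)).length :=
          Nat.le_mul_of_pos_left _ h1
        have h3 : (ml (i + 1)).length * (100 * ((path (i + 1)).length + 1)) =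
          100 * ((ml (i + 1)).length * (path (i + 1)).length) + 100 * (ml (i + 1)).length := by ring
        omega
      · rw [g5, hout1, hrange, if_pos (by rintro h'; simp [h'] at h)]
        simp [bicliqueCode]
    · rw [if_neg h]
      refine ⟨by omega, e0, ?_⟩
      have : ml (i + 1) = [] := by simpa using h
      rw [hout1, hrange, if_neg (by simp [this]), List.append_nil]
  · rintro s1 ⟨hmem, e0, e7, e10, hout1⟩
    simp (disch := omega) only [eval_op, eval_reg, eval_const, eval_load, op_add, op_sub, op_mul,
      op_div, op_mod, op_lt, op_and, ite_one_zero_eq, runs_seq, runs_assign, runs_store,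
      runs_ite, runs_skip, runs_flip, runs_emit, Function.update_self, ne_eq, not_not,
      Function.update_of_ne, Expr.cost, true_and, and_true, e7, e10]
    omega
  · refine ⟨rfl, ?_, ?_, ?_, ?_⟩
    · simp (disch := omega) only [eval_op, eval_reg, eval_const, eval_load, op_add, op_sub, op_mul,
      op_div, op_mod, op_lt, op_and, ite_one_zero_eq, runs_seq, runs_assign, runs_store,
      runs_ite, runs_skip, runs_flip, runs_emit, Function.update_self, ne_eq, not_not,
      Function.update_of_ne, Expr.cost, true_and, and_true, h0]
    · simp (disch := omega) only [eval_op, eval_reg, eval_const, eval_load, op_add, op_sub, op_mul,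
      op_div, op_mod, op_lt, op_and, ite_one_zero_eq, runs_seq, runs_assign, runs_store,
      runs_ite, runs_skip, runs_flip, runs_emit, Function.update_self, ne_eq, not_not,
      Function.update_of_ne, Expr.cost, true_and, and_true, h7]
    · simp (disch := omega) only [eval_op, eval_reg, eval_const, eval_load, op_add, op_sub, op_mul,
      op_div, op_mod, op_lt, op_and, ite_one_zero_eq, runs_seq, runs_assign, runs_store,
      runs_ite, runs_skip, runs_flip, runs_emit, Function.update_self, ne_eq, not_not,
      Function.update_of_ne, Expr.cost, true_and, and_true]
    · simp [hout, nodePairs, bicliqueCode]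
  · rintro t s' ⟨ht, -, -, -, -, hout'⟩
    refine ⟨?_, hout'⟩
    rw [Finset.sum_add_distrib, Finset.sum_add_distrib, Finset.sum_add_distrib] at ht
    simp [Expr.cost] at ht ⊢
    omega

end WordRAM

/-! ### Output size, the input format and the run of the whole program. -/

set_option linter.unusedSimpArgs false
set_option linter.unnecessarySeqFocus false

namespace WordRAM

variable {w : ℕ} {ω : ℕ → Bool} {n : ℕ}

theorem sum_toFinset_le_sum_map {α : Type*} [DecidableEq α] (l : List α) (f : α → ℕ) :
    ∑ x ∈ l.toFinset, f x ≤ (l.map f).sum := by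
  induction l with
  | nil => simp
  | cons a l ih =>
    rw [List.toFinset_cons, List.map_cons, List.sum_cons]
    by_cases h : a ∈ l.toFinset
    · rw [Finset.insert_eq_of_mem h]
      omega
    · rw [Finset.sum_insert h]
      omega

theorem length_events_le [NeZero n] {key : Fin n → ℕ} {G : SimpleGraph (Fin n)} {H N : ℕ}
    {adj : Fin n → List (Fin n)} (hadj : IsAdjacencyList G adj) (b : Fin n) :
    (events key G H b N).length ≤ (adj b).length := by
  rw [← List.length_map (vertAt key),
    ← List.toFinset_card_of_nodup (nodup_map_vertAt_events (N := N)),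
    ← List.toFinset_card_of_nodup (hadj b).1]
  apply Finset.card_le_card
  intro u hu
  obtain ⟨P, hP, rfl⟩ := List.mem_map.1 (List.mem_toFinset.1 hu)
  rw [List.mem_toFinset, (hadj b).2]
  exact (mem_events.1 hP).2.1

/-- After the sums are exchanged, a vertex pays for its own pieces, each by its length plus one. The
lengths add up to the number of events, the number of pieces is no larger, and both are at most the
degree. -/
theorem sum_members_le [NeZero n] {key : Fin n → ℕ} {G : SimpleGraph (Fin n)} {H K M c : ℕ}
    {adj : Fin n → List (Fin n)} (hadj : IsAdjacencyList G adj) {path ml : ℕ → List (Fin n)}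
    {s : State} (hinj : ∀ x ≤ c, ∀ y ≤ c, path x = path y → x = y)
    (hm : HasMembers c path (vertexPieces key G H K M) ml s) :
    ∑ y ∈ Finset.range c, ∑ _b ∈ (ml (y + 1)).toFinset, 100 * ((path (y + 1)).length + 1) ≤
      200 * ∑ b, (adj b).length := by
  obtain ⟨m1, m2, m3, m4⟩ := hm
  have h1 : ∀ y ∈ Finset.range c,
      ∑ _b ∈ (ml (y + 1)).toFinset, 100 * ((path (y + 1)).length + 1) =
      ∑ b : Fin n, if path (y + 1) ∈ vertexPieces key G H K M b then
        100 * ((path (y + 1)).length + 1) else 0 := by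
    intro y hy
    rw [Finset.mem_range] at hy
    rw [← Finset.sum_filter]
    refine Finset.sum_congr ?_ fun _ _ => rfl
    ext b
    rw [List.mem_toFinset, m4, Finset.mem_filter]
    simp
    omega
  rw [Finset.sum_congr rfl h1, Finset.sum_comm, Finset.mul_sum]
  refine Finset.sum_le_sum fun b _ => ?_
  rw [← Finset.sum_filter]
  set F := (Finset.range c).filter fun y => path (y + 1) ∈ vertexPieces key G H K M b with hF
  have hinj' : Set.InjOn (fun y => path (y + 1)) F := by
    intro x hx y hy he
    simp only [hF, Finset.coe_filter, Set.mem_ofPred_eq, Finset.mem_range] at hx hy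
    have := hinj _ (by omega) _ (by omega) he
    omega
  calc ∑ y ∈ F, 100 * ((path (y + 1)).length + 1)
      = ∑ L ∈ F.image fun y => path (y + 1), 100 * (L.length + 1) :=
        (Finset.sum_image (f := fun L : List (Fin n) => 100 * (L.length + 1)) hinj').symm
    _ ≤ ∑ L ∈ (vertexPieces key G H K M b).toFinset, 100 * (L.length + 1) := by
        apply Finset.sum_le_sum_of_subset
        intro L hL
        obtain ⟨y, hy, rfl⟩ := Finset.mem_image.1 hL
        rw [List.mem_toFinset]
        exact (Finset.mem_filter.1 hy).2
    _ ≤ ((vertexPieces key G H K M b).map fun L => 100 * (L.length + 1)).sum :=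
        sum_toFinset_le_sum_map _ _
    _ = 100 * (events key G H b (2 * n)).length + 100 * (vertexPieces key G H K M b).length := by
        have : ∀ l : List (List (Fin n)), (l.map fun L => 100 * (L.length + 1)).sum =
            100 * l.flatten.length + 100 * l.length := by
          intro l
          induction l with
          | nil => simp
          | cons a l ih =>
            rw [List.map_cons, List.sum_cons, ih, List.flatten_cons, List.length_append,
              List.length_cons]
            ring
        rw [this]
        congr 2
        unfold vertexPieces
        rw [← List.map_flatten, Cut.flatten_run]
        simp
    _ ≤ 200 * (adj b).length := by
        have h2 := length_events_le (key := key) (H := H) (N := 2 * n) hadj b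
        have h3 := Cut.length_pieces_le (K := K) (M := M) (events key G H b (2 * n))
        have h4 : (vertexPieces key G H K M b).length =
          (Cut.run K M (events key G H b (2 * n))).pieces.length := by simp [vertexPieces]
        omega

/-- Lists determine nodes, hence left sides are different. A list that is a piece of some vertex has
a node, and this node has that vertex as a member, so it is not skipped. -/
theorem isGrouping_nodePairs [NeZero n] {key : Fin n → ℕ} {G : SimpleGraph (Fin n)} {H K M c : ℕ}
    {path ml : ℕ → List (Fin n)} {s : State} (hinj : ∀ x ≤ c, ∀ y ≤ c, path x = path y → x = y)
    (hm : HasMembers c path (vertexPieces key G H K M) ml s)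
    (hex : ∀ b, ∀ L ∈ vertexPieces key G H K M b, ∃ y, 1 ≤ y ∧ y ≤ c ∧ path y = L) :
    IsGrouping key G H K M (nodePairs path ml c) := by
  obtain ⟨m1, m2, m3, m4⟩ := hm
  have hmem : ∀ B, B ∈ nodePairs path ml c ↔
      ∃ y < c, ml (y + 1) ≠ [] ∧ B = (path (y + 1), ml (y + 1)) := by
    intro B
    simp only [nodePairs, List.mem_map, List.mem_filter, List.mem_range, decide_eq_true_eq]
    constructor
    · rintro ⟨y, ⟨h1, h2⟩, rfl⟩
      exact ⟨y, h1, h2, rfl⟩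
    · rintro ⟨y, h1, h2, rfl⟩
      exact ⟨y, ⟨h1, h2⟩, rfl⟩
  constructor
  · rw [nodePairs, List.map_map]
    refine List.Nodup.map_on ?_ (List.nodup_range.filter _)
    intro x hx y hy he
    have h1 := List.mem_range.1 (List.mem_of_mem_filter hx)
    have h2 := List.mem_range.1 (List.mem_of_mem_filter hy)
    have := hinj _ (by omega) _ (by omega) he
    omega
  · intro B hB
    obtain ⟨y, h1, h2, rfl⟩ := (hmem B).1 hB
    exact h2
  · intro B hB
    obtain ⟨y, h1, h2, rfl⟩ := (hmem B).1 hB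
    exact m2 _
  · intro B hB b
    obtain ⟨y, h1, h2, rfl⟩ := (hmem B).1 hB
    rw [m4]
    simp
    omega
  · intro b L hL
    obtain ⟨y, h1, h2, rfl⟩ := hex b L hL
    obtain ⟨z, rfl⟩ : ∃ z, y = z + 1 := ⟨y - 1, by omega⟩
    have hb : b ∈ ml (z + 1) := (m4 _ _).2 ⟨h1, h2, hL⟩
    exact ⟨_, (hmem _).2 ⟨z, by omega, List.ne_nil_of_mem hb, rfl⟩, rfl⟩

section Input

variable (adj : Fin n → List (Fin n))

theorem adjacencyInput_offset_succ (v : Fin n) : (adjacencyInput adj).mem 0 (v + 1) =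
    (adjacencyInput adj).mem 0 v + (adj v).length := by
  have h1 : (v : ℕ) + 1 ≤ n := v.2
  have h2 : (v : ℕ) ≤ n := by omega
  simp only [adjacencyInput, h1, h2, if_true]
  rw [List.take_succ_eq_append_getElem (by simp), List.flatten_append, List.length_append]
  simp

theorem adjacencyInput_offset_zero : (adjacencyInput adj).mem 0 0 = 0 := by
  simp [adjacencyInput]

theorem adjacencyInput_offset_eq_sum {k : ℕ} (hk : k ≤ n) : (adjacencyInput adj).mem 0 k =
    ∑ v ∈ Finset.univ.filter fun v : Fin n => (v : ℕ) < k, (adj v).length := by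
  induction k with
  | zero => simp [adjacencyInput_offset_zero]
  | succ k ih =>
    have h := adjacencyInput_offset_succ adj ⟨k, hk⟩
    simp only at h
    rw [h, ih (by omega)]
    have : (Finset.univ.filter fun v : Fin n => (v : ℕ) < k + 1) =
        insert ⟨k, hk⟩ (Finset.univ.filter fun v : Fin n => (v : ℕ) < k) := by
      ext v
      simp only [Finset.mem_filter, Finset.mem_univ, true_and, Finset.mem_insert, Fin.ext_iff]
      omega
    rw [this, Finset.sum_insert (by simp), add_comm]

theorem adjacencyInput_offset_last :
    (adjacencyInput adj).mem 0 n = ∑ v : Fin n, (adj v).length := by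
  rw [adjacencyInput_offset_eq_sum adj le_rfl]
  simp

theorem adjacencyInput_offset_le {G : SimpleGraph (Fin n)} (hadj : IsAdjacencyList G adj) {k : ℕ}
    (hk : k ≤ n) : (adjacencyInput adj).mem 0 k ≤ n ^ 2 := by
  rw [adjacencyInput_offset_eq_sum adj hk]
  calc ∑ v ∈ Finset.univ.filter fun v : Fin n => (v : ℕ) < k, (adj v).length
      ≤ ∑ v : Fin n, (adj v).length :=
        Finset.sum_le_sum_of_subset (Finset.filter_subset _ _)
    _ ≤ ∑ _v : Fin n, n :=
        Finset.sum_le_sum fun v _ => by simpa using (hadj v).1.length_le_card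
    _ = n ^ 2 := by simp [sq]

theorem adjacencyInput_neighbour (v : Fin n) (j : ℕ) (h : j < (adj v).length) :
    (adjacencyInput adj).mem 1 ((adjacencyInput adj).mem 0 v + j) = (adj v)[j] := by
  have h2 : (v : ℕ) ≤ n := v.2.le
  simp only [adjacencyInput, h2, if_true, one_ne_zero, if_false]
  have hsplit : (List.ofFn adj).flatten =
      ((List.ofFn adj).take v).flatten ++ (adj v ++ ((List.ofFn adj).drop (v + 1)).flatten) := by
    conv_lhs => rw [← List.take_append_drop v (List.ofFn adj)]
    rw [List.flatten_append, List.drop_eq_getElem_cons (by simp)]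
    simp
  rw [List.getD_eq_getElem?_getD, List.getElem?_map, hsplit, List.getElem?_append_right (by omega),
    Nat.add_sub_cancel_left, List.getElem?_append_left h, List.getElem?_eq_getElem h]
  rfl

theorem sum_length_eq_two_mul_ncard {G : SimpleGraph (Fin n)} (hadj : IsAdjacencyList G adj) :
    ∑ v, (adj v).length = 2 * G.edgeSet.ncard := by
  classical
  have h1 : ∀ v, (adj v).length = G.degree v := by
    intro v
    rw [← List.toFinset_card_of_nodup (hadj v).1, ← SimpleGraph.card_neighborFinset_eq_degree]
    congr 1
    ext u
    simp [(hadj v).2]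
  rw [Finset.sum_congr rfl fun v _ => h1 v, G.sum_degrees_eq_twice_card_edges,
    ← SimpleGraph.coe_edgeFinset, Set.ncard_coe_finset]

end Input

/-- The greatest smaller one of degree and co-degree. -/
def maxMinDegree (n : ℕ) (off : ℕ → ℕ) : ℕ := (Finset.range n).sup (minDegree n off)

/-- The greatest length of a piece in a run of the algorithm. -/
def pieceBound (n : ℕ) (off : ℕ → ℕ) : ℕ :=
  lengthBound n ((n / (maxMinDegree n off + 1) + 1) * Nat.size n)

theorem two_pow_size_le {n : ℕ} (hn : 1 ≤ n) : 2 ^ Nat.size n ≤ 2 * n := by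
  obtain ⟨k, hk⟩ : ∃ k, Nat.size n = k + 1 :=
    ⟨Nat.size n - 1, by have := Nat.size_pos.2 (show 0 < n by omega); omega⟩
  have : 2 ^ k ≤ n := Nat.lt_size.1 (by omega)
  rw [hk, pow_succ]
  omega

/-- This holds for every sequence of coins: the running time and the correctness of the partition
are deterministic, and randomness enters only in the number of pieces. -/
theorem runs_bicliqueProg [NeZero n] {G : SimpleGraph (Fin n)} {adj : Fin n → List (Fin n)}
    (hn : 16 ≤ n) (hw : n ^ 4 < 2 ^ w) (hadj : IsAdjacencyList G adj) :
    Runs w ω bicliqueProg (adjacencyInput adj) fun t s' =>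
      t ≤ 10000 * (n + G.edgeSet.ncard) ∧
      ∃ Q, IsGrouping (fun v : Fin n => keyValue ω n ((adjacencyInput adj).mem 0) v) G
        (keyRange n ((adjacencyInput adj).mem 0)) (pieceBound n ((adjacencyInput adj).mem 0))
        (n / pieceBound n ((adjacencyInput adj).mem 0) ^ 5) Q ∧ s'.out = bicliqueCode Q := by
  set off := (adjacencyInput adj).mem 0 with hoff
  set key : Fin n → ℕ := fun v : Fin n => keyValue ω n off v with hkey
  set K := pieceBound n off with hK
  have hle : ∀ v ≤ n, off v ≤ n ^ 2 := fun v hv => adjacencyInput_offset_le adj hadj hv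
  have hoffn : off n = 2 * G.edgeSet.ncard := by
    rw [hoff, adjacencyInput_offset_last, sum_length_eq_two_mul_ncard adj hadj]
  have hS := two_pow_size_le (show 1 ≤ n by omega)
  have hsz : Nat.size n ≤ n := Nat.size_le.2 Nat.lt_two_pow_self
  have hnS := Nat.lt_size_self n
  have hKn : K < n := lengthBound_lt (by omega) _
  have hK2 : K ^ 2 ≤ n := lengthBound_sq_le (by omega) _
  have hM : n / K ^ 5 ≤ n := Nat.div_le_self _ _
  have hΔ : maxMinDegree n off ≤ n := by
    refine Finset.sup_le fun v _ => ?_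
    unfold minDegree
    omega
  have hdeg : ∀ v < n, off (v + 1) - off v ≤ n := fun v hv => by
    have h1 : off (v + 1) = off v + (adj ⟨v, hv⟩).length :=
      adjacencyInput_offset_succ adj ⟨v, hv⟩
    have h2 : (adj ⟨v, hv⟩).length ≤ n := by simpa using (hadj ⟨v, hv⟩).1.length_le_card
    omega
  have hkeyS : ∀ v < n, keyValue ω n off v < 2 ^ Nat.size n := fun v hv => by
    unfold keyValue
    split_ifs
    · have := hdeg v hv
      omega
    · exact bitsValue_lt _ _ _
  have hH : keyRange n off ≤ 2 * n := by
    unfold keyRange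
    split_ifs <;> omega
  unfold bicliqueProg
  simp only [runs_seq]
  refine (runs_sizeProg (by omega) hw rfl rfl).mono ?_
  rintro t1 s1 ⟨ht1, hF1, a1, a2, f1⟩
  refine (runs_degreeProg (off := off) (by omega) hw (by rw [hF1.reg 0 (by simp) (by simp)]; rfl)
    (by rw [hF1.reg 3 (by simp) (by simp)]; rfl) (by rw [hF1.mem 0 (by simp)]) hle).mono ?_
  rintro t2 s2 ⟨ht2, hF2, a3, f2⟩
  have hA2 : Frame [1, 2, 3, 4, 5, 6] [2, 3, 4, 5, 6] (adjacencyInput adj) s2 :=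
    (hF1.mono (by simp) (by simp)).trans (hF2.mono (by simp) (by simp))
  have b1 : s2.reg 1 = 2 ^ Nat.size n := by rw [hF2.reg 1 (by simp) (by simp), a1]
  have b2 : s2.reg 2 = Nat.size n := by rw [hF2.reg 2 (by simp) (by simp), a2]
  refine (runs_paramProg hn hw (by rw [hA2.reg 0 (by simp) (by simp)]; rfl) b2 a3 hsz hΔ).mono ?_
  rintro t3 s3 ⟨ht3, hF3, c4, c5, f3⟩
  have hA3 := hA2.trans (hF3.mono (by simp) (by simp))
  change s3.reg 4 = K at c4
  change s3.reg 5 = n / K ^ 5 at c5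
  refine (runs_tableProg (by omega) hw (by rw [hA3.reg 0 (by simp) (by simp)]; rfl) c4 c5 hKn hK2
    hM (by rw [hF3.mem 2 (by simp), hF2.mem 2 (by simp), hF1.mem 2 (by simp)]; rfl)).mono ?_
  rintro t4 s4 ⟨ht4, hF4, d2, f4⟩
  have hA4 := hA3.trans (hF4.mono (by simp) (by simp))
  refine (runs_keyProg (off := off) (by omega) hw (by rw [hA4.reg 0 (by simp) (by simp)]; rfl)
    (by rw [hF4.reg 1 (by simp) (by simp), hF3.reg 1 (by simp) (by simp), b1])
    (by rw [hF4.reg 2 (by simp) (by simp), hF3.reg 2 (by simp) (by simp), b2])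
    (by rw [hA4.mem 0 (by simp)]) hle hS (by rw [f4, f3, f2, f1]; rfl)).mono ?_
  rintro t5 s5 ⟨ht5, hF5, e3, e6⟩
  have hA5 := hA4.trans (hF5.mono (by simp) (by simp))
  refine (runs_countProg (kf := keyValue ω n off) (by omega) hw hS
    (by rw [hA5.reg 0 (by simp) (by simp)]; rfl) e3 hkeyS
    (by rw [hF5.mem 4 (by simp), hF4.mem 4 (by simp), hF3.mem 4 (by simp), hF2.mem 4 (by simp),
      hF1.mem 4 (by simp)]; rfl)).mono ?_
  rintro t6 s6 ⟨ht6, hF6, g4⟩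
  have hA6 := hA5.trans (hF6.mono (by simp) (by simp))
  refine (runs_prefixProg (kf := keyValue ω n off) (by omega) hw hS
    (by rw [hF6.reg 1 (by simp) (by simp), hF5.reg 1 (by simp) (by simp),
      hF4.reg 1 (by simp) (by simp), hF3.reg 1 (by simp) (by simp), b1]) g4).mono ?_
  rintro t7 s7 ⟨ht7, hF7, i4⟩
  have hA7 := hA6.trans (hF7.mono (by simp) (by simp))
  refine (runs_placeProg (S := 2 ^ Nat.size n) (key := key) (kf := keyValue ω n off) (by omega) hw
    (by rw [hA7.reg 0 (by simp) (by simp)]; rfl) (fun v => rfl)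
    (by rw [hF7.mem 3 (by simp), hF6.mem 3 (by simp)]; exact e3) (fun v => hkeyS v v.2)
    i4).mono ?_
  rintro t8 s8 ⟨ht8, hF8, j56⟩
  have hA8 := hA7.trans (hF8.mono (by simp) (by simp))
  have hready : IsReady key (keyRange n off) K (n / K ^ 5) adj off s8 := by
    constructor
    · rw [hA8.reg 0 (by simp) (by simp)]; rfl
    · rw [hF8.reg 4 (by simp) (by simp), hF7.reg 4 (by simp) (by simp),
        hF6.reg 4 (by simp) (by simp), hF5.reg 4 (by simp) (by simp),
        hF4.reg 4 (by simp) (by simp), c4]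
    · rw [hF8.reg 5 (by simp) (by simp), hF7.reg 5 (by simp) (by simp),
        hF6.reg 5 (by simp) (by simp), hF5.reg 5 (by simp) (by simp),
        hF4.reg 5 (by simp) (by simp), c5]
    · rw [hF8.reg 6 (by simp) (by simp), hF7.reg 6 (by simp) (by simp),
        hF6.reg 6 (by simp) (by simp), e6]
    · intro i hi j hj
      rw [hF8.mem 2 (by simp), hF7.mem 2 (by simp), hF6.mem 2 (by simp), hF5.mem 2 (by simp), d2]
      have q1 : (i * n + j) / n = i := by
        rw [mul_comm, Nat.mul_add_div (by omega), Nat.div_eq_of_lt hj, add_zero]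
      have q2 : (i * n + j) % n = j := by
        rw [mul_comm, Nat.mul_add_mod, Nat.mod_eq_of_lt hj]
      simp only [q1, q2, hi, if_true]
    · intro v
      rw [hF8.mem 3 (by simp), hF7.mem 3 (by simp), hF6.mem 3 (by simp), e3 v v.2]
    · exact j56
    · intro v _
      rw [hA8.mem 0 (by simp)]
    · intro v j h
      rw [hA8.mem 1 (by simp)]
      exact adjacencyInput_neighbour adj v j h
  -- Zero-filled banks encode the trie that consists of the root alone, without members and without
  -- open pieces.
  have hinit : HasPieces key K (n / K ^ 5) (fun _ => []) (fun _ => []) (fun _ => []) s8 := by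
    have z7 : s8.reg 7 = 0 := by rw [hA8.reg 7 (by simp) (by simp)]; rfl
    have z : ∀ a, 7 ≤ a → s8.mem a = fun _ => 0 := fun a ha => by
      rw [hA8.mem a (by simp; omega)]
      ext i
      have h1 : a ≠ 0 := by omega
      have h2 : a ≠ 1 := by omega
      simp [adjacencyInput, h1, h2]
    have hcl : closedLists key K (n / K ^ 5) [] = [] := rfl
    refine ⟨?_, ?_, ?_, ?_, ?_⟩
    · rw [z7]
      constructor
      · rfl
      · intro y h1 h2; omega
      · intro y h1 h2; omega
      · intro x hx y hy _; omega
      · intro y _; simp [z]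
      · intro x _ u h; simp [z] at h
      · intro y h1 h2; omega
      · intro x _ u; simp [z]
    · rw [z7]
      refine ⟨?_, ?_, ?_, ?_⟩ <;> simp [z, hcl]
    · intro b
      simp [z, z7, Cut.run, Cut.init]
    · simp [hcl]
    · simp [z7]
  refine (runs_mainProg hn hw hready (fun v => (hkeyS v v.2).trans_le hS) hH hKn hM hadj
    (adjacencyInput_offset_succ adj) hle ⟨_, _, hinit⟩).mono ?_
  rintro t9 s9 ⟨ht9, hF9, path, ml, hp⟩
  have hr9 := hready.of_frame hF9
  refine (runs_flushProg hn hw hr9.reg0 hp).mono ?_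
  rintro t10 s10 ⟨ht10, hF10, ml', hm⟩
  obtain ⟨hT, -, ho, hcl, hct⟩ := hp
  have hev := hct.trans (Finset.sum_le_sum fun b _ =>
    length_events_le (key := key) (H := keyRange n off) (N := 2 * n) hadj b)
  have hcn := hct.trans (sum_length_le fun b => nodup_map_vertAt_events)
  have hsum := sum_members_le hadj hT.inj hm
  rw [sum_length_eq_two_mul_ncard adj hadj] at hev hsum ht9
  refine (runs_outputProg (c := s9.reg 7) hn hw
    (by rw [hF10.reg 0 (by simp) (by simp), hr9.reg0]) (by rw [hF10.reg 7 (by simp) (by simp)])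
    hcn (hT.congr (hF10.mem _ (by simp)) (hF10.mem _ (by simp)) (hF10.mem _ (by simp))
      (hF10.mem _ (by simp))) hm (by rw [hF10.out, hF9.out, hA8.out]; rfl)).mono ?_
  rintro t11 s11 ⟨ht11, hout⟩
  refine ⟨by omega, _, isGrouping_nodePairs hT.inj hm ?_, hout⟩
  intro b L hL
  rw [vertexPieces_eq] at hL
  split_ifs at hL with hcur
  · exact hcl b L hL
  · rcases List.mem_cons.1 hL with rfl | hL
    · refine ⟨s9.mem 7 b, ?_, (ho b).1, (ho b).2.1⟩
      have := (hT.path_ne_nil (ho b).1).1 (by rw [(ho b).2.1]; simpa using hcur)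
      omega
    · exact hcl b L hL

end WordRAM

/-! ### Exponential moments and concentration, in counting form. -/

section Counting

variable {α : Type*} [Fintype α]

/-- Hoeffding's lemma: by convexity the exponential lies below its chord on `[-c, c]`; the linear
part of the chord sums to zero, and `cosh x ≤ exp (x ^ 2 / 2)`. -/
theorem sum_exp_le_of_sum_eq_zero {y : α → ℝ} {c : ℝ} (hy : ∑ a, y a = 0) (hc : 0 < c)
    (hyc : ∀ a, |y a| ≤ c) (θ : ℝ) :
    ∑ a, Real.exp (θ * y a) ≤ Fintype.card α * Real.exp ((θ * c) ^ 2 / 2) := by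
  have h1 : ∀ a, Real.exp (θ * y a) ≤ Real.cosh (θ * c) + y a / c * Real.sinh (θ * c) := by
    intro a
    have h := Real.exp_mul_le_cosh_add_mul_sinh (t := y a / c)
      (by rw [abs_div, abs_of_pos hc]; exact (div_le_one hc).2 (hyc a)) (θ * c)
    convert h using 2
    field_simp
  calc ∑ a, Real.exp (θ * y a)
      ≤ ∑ a, (Real.cosh (θ * c) + y a / c * Real.sinh (θ * c)) := Finset.sum_le_sum fun a _ => h1 a
    _ = Fintype.card α * Real.cosh (θ * c) := by
        rw [Finset.sum_add_distrib, ← Finset.sum_mul, ← Finset.sum_div, hy]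
        simp
    _ ≤ _ := by gcongr; exact Real.cosh_le_exp_half_sq _

theorem sum_cons {n : ℕ} (f : (Fin (n + 1) → α) → ℝ) :
    ∑ x, f x = ∑ a, ∑ x : Fin n → α, f (Fin.cons a x) := by
  rw [← Fintype.sum_prod_type' fun (a : α) (x : Fin n → α) => f (Fin.cons a x)]
  exact (Fintype.sum_equiv (Fin.consEquiv fun _ => α) _ _ fun p => rfl).symm

/-- Exponential moments of functions with bounded differences. -/
theorem sum_exp_le_of_bounded_differences [Nonempty α] {c : ℝ} (hc : 0 < c) (θ : ℝ) {n : ℕ} :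
    ∀ {F : (Fin n → α) → ℝ} {m : ℝ}, (∀ x i a, F (Function.update x i a) ≤ F x + c) →
      ∑ x, F x = (Fintype.card α : ℝ) ^ n * m →
      ∑ x, Real.exp (θ * (F x - m)) ≤
        (Fintype.card α : ℝ) ^ n * Real.exp (n * ((θ * c) ^ 2 / 2)) := by
  have hcard : (0 : ℝ) < Fintype.card α := by exact_mod_cast Fintype.card_pos
  induction n with
  | zero =>
    intro F m _ hm
    simp at hm
    simp [hm]
  | succ n ih =>
    intro F m hF hm
    -- The mean of `F` when the first coordinate is fixed. The exponential moment splits into that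
    -- of `g` and, for each value `a`, that of `F` around `g a`, to which induction applies.
    set g : α → ℝ := fun a => (∑ x : Fin n → α, F (Fin.cons a x)) / (Fintype.card α : ℝ) ^ n with hg
    have hga : ∀ a, ∑ x : Fin n → α, F (Fin.cons a x) = (Fintype.card α : ℝ) ^ n * g a := by
      intro a
      rw [hg]
      field_simp
    have hgsum : ∑ a, (g a - m) = 0 := by
      rw [sum_cons, Finset.sum_congr rfl fun a _ => hga a, ← Finset.mul_sum, pow_succ,
          mul_assoc] at hm
      have := mul_left_cancel₀ (by positivity) hm
      rw [Finset.sum_sub_distrib, this]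
      simp
    have hgdiff : ∀ a b, g b ≤ g a + c := by
      intro a b
      have h1 : ∑ x : Fin n → α, F (Fin.cons b x) ≤ ∑ x : Fin n → α, (F (Fin.cons a x) + c) := by
        refine Finset.sum_le_sum fun x _ => ?_
        have := hF (Fin.cons a x) 0 b
        rwa [Fin.update_cons_zero] at this
      rw [Finset.sum_add_distrib, hga, hga] at h1
      simp only [Finset.sum_const, Finset.card_univ, Fintype.card_pi, Finset.prod_const,
        Fintype.card_fin, nsmul_eq_mul, Nat.cast_pow] at h1
      rw [← mul_add] at h1
      exact le_of_mul_le_mul_left h1 (by positivity)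
    -- The values of `g` differ pairwise by at most `c`, and `m` is their average.
    have hgabs : ∀ a, |g a - m| ≤ c := by
      intro a
      have hsum : ∑ b, g b = Fintype.card α * m := by
        rw [Finset.sum_sub_distrib] at hgsum
        simp at hgsum
        linarith
      have h1 : ∑ b, g b ≤ ∑ _b : α, (g a + c) := Finset.sum_le_sum fun b _ => hgdiff a b
      have h2 : ∑ _b : α, (g a - c) ≤ ∑ b, g b :=
        Finset.sum_le_sum fun b _ => by linarith [hgdiff b a]
      simp only [Finset.sum_const, Finset.card_univ, nsmul_eq_mul, hsum] at h1 h2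
      have h1' := le_of_mul_le_mul_left h1 hcard
      have h2' := le_of_mul_le_mul_left h2 hcard
      rw [abs_le]
      constructor <;> linarith
    rw [sum_cons]
    calc ∑ a, ∑ x : Fin n → α, Real.exp (θ * (F (Fin.cons a x) - m))
        = ∑ a, Real.exp (θ * (g a - m)) *
            ∑ x : Fin n → α, Real.exp (θ * (F (Fin.cons a x) - g a)) := by
          refine Finset.sum_congr rfl fun a _ => ?_
          rw [Finset.mul_sum]
          refine Finset.sum_congr rfl fun x _ => ?_
          rw [← Real.exp_add]
          ring_nf
      _ ≤ ∑ a, Real.exp (θ * (g a - m)) *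
            ((Fintype.card α : ℝ) ^ n * Real.exp (n * ((θ * c) ^ 2 / 2))) := by
          refine Finset.sum_le_sum fun a _ => mul_le_mul_of_nonneg_left ?_ (Real.exp_nonneg _)
          refine ih (fun x i b => ?_) (hga a)
          have := hF (Fin.cons a x) i.succ b
          rwa [← Fin.cons_update] at this
      _ ≤ (Fintype.card α * Real.exp ((θ * c) ^ 2 / 2)) *
            ((Fintype.card α : ℝ) ^ n * Real.exp (n * ((θ * c) ^ 2 / 2))) := by
          rw [← Finset.sum_mul]
          exact mul_le_mul_of_nonneg_right (sum_exp_le_of_sum_eq_zero hgsum hc hgabs θ)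
            (by positivity)
      _ = _ := by
          rw [show ((n + 1 : ℕ) : ℝ) * ((θ * c) ^ 2 / 2) =
            (θ * c) ^ 2 / 2 + n * ((θ * c) ^ 2 / 2) by push_cast; ring, Real.exp_add]
          ring

/-- The bounded differences inequality, in counting form. -/
theorem card_filter_le_of_bounded_differences [Nonempty α] {c r m : ℝ} (hc : 0 < c) (hr : 0 ≤ r)
    {n : ℕ} (hn : 0 < n) {F : (Fin n → α) → ℝ} (hF : ∀ x i a, F (Function.update x i a) ≤ F x + c)
    (hm : ∑ x, F x ≤ (Fintype.card α : ℝ) ^ n * m) :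
    (((Finset.univ.filter fun x => m + r ≤ F x).card : ℕ) : ℝ) ≤
      (Fintype.card α : ℝ) ^ n * Real.exp (-(r ^ 2 / (2 * n * c ^ 2))) := by
  have hcard : (0 : ℝ) < Fintype.card α := by exact_mod_cast Fintype.card_pos
  have hn' : (0 : ℝ) < n := by exact_mod_cast hn
  set m' := (∑ x, F x) / (Fintype.card α : ℝ) ^ n with hm'
  have hm1 : ∑ x, F x = (Fintype.card α : ℝ) ^ n * m' := by rw [hm']; field_simp
  have hmm : m' ≤ m := by
    rw [hm1] at hm
    exact le_of_mul_le_mul_left hm (by positivity)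
  -- This value minimises the exponent `n * (θ * c) ^ 2 / 2 - θ * r`.
  set θ := r / (n * c ^ 2) with hθ
  have hθ0 : 0 ≤ θ := by positivity
  have h := sum_exp_le_of_bounded_differences hc θ hF hm1
  have h2 : ((Finset.univ.filter fun x => m + r ≤ F x).card : ℝ) * Real.exp (θ * r) ≤
      ∑ x, Real.exp (θ * (F x - m')) := by
    rw [← nsmul_eq_mul, ← Finset.sum_const]
    refine (Finset.sum_le_sum fun x hx => ?_).trans
      (Finset.sum_le_sum_of_subset_of_nonneg (Finset.filter_subset _ _)
        fun x _ _ => (Real.exp_nonneg _))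
    have := (Finset.mem_filter.1 hx).2
    exact Real.exp_le_exp.2 (mul_le_mul_of_nonneg_left (by linarith) hθ0)
  have h3 := h2.trans h
  rw [← le_div_iff₀ (Real.exp_pos _), mul_div_assoc, ← Real.exp_sub] at h3
  refine h3.trans_eq ?_
  congr 2
  rw [hθ]
  field_simp
  ring

/-- The exponential of a count is a product over the coordinates, so the sum factorises; each factor
belonging to `W` is at most `1 + q * (exp l - 1)` times the number of values. -/
theorem sum_exp_card_filter_le {n : ℕ} [Nonempty α] (p : α → Prop) [DecidablePred p]
    (W : Finset (Fin n)) {l q : ℝ} (hl : 0 ≤ l)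
    (hq : ((Finset.univ.filter p).card : ℝ) ≤ q * Fintype.card α) :
    ∑ x : Fin n → α, Real.exp (l * (W.filter fun v => p (x v)).card) ≤
      (Fintype.card α : ℝ) ^ n * Real.exp (q * W.card * (Real.exp l - 1)) := by
  classical
  have hcard : (0 : ℝ) < Fintype.card α := by exact_mod_cast Fintype.card_pos
  have hl1 : 0 ≤ Real.exp l - 1 := by
    have := Real.add_one_le_exp l
    linarith
  have h1 : ∀ x : Fin n → α, Real.exp (l * (W.filter fun v => p (x v)).card) =
      ∏ v, (if v ∈ W ∧ p (x v) then Real.exp l else 1) := by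
    intro x
    rw [Finset.prod_ite, Finset.prod_const_one, mul_one, Finset.prod_const, ← Real.exp_nat_mul,
      mul_comm]
    congr 4
    ext v
    simp
  have h2 : ∏ v, ∑ a : α, (if v ∈ W ∧ p a then Real.exp l else 1) =
      ∑ x : Fin n → α, ∏ v, (if v ∈ W ∧ p (x v) then Real.exp l else 1) := by
    rw [Finset.prod_univ_sum, Fintype.piFinset_univ]
  rw [Finset.sum_congr rfl fun x _ => h1 x, ← h2]
  have h3 : ∀ v, ∑ a : α, (if v ∈ W ∧ p a then Real.exp l else 1) ≤
      Fintype.card α * (if v ∈ W then Real.exp (q * (Real.exp l - 1)) else 1) := by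
    intro v
    by_cases hv : v ∈ W
    · simp only [hv, true_and, if_true]
      have : ∀ a, (if p a then Real.exp l else 1) = 1 + if p a then Real.exp l - 1 else 0 := by
        intro a
        split_ifs <;> ring
      rw [Finset.sum_congr rfl fun a _ => this a, Finset.sum_add_distrib, ← Finset.sum_filter]
      simp only [Finset.sum_const, Finset.card_univ, nsmul_eq_mul, mul_one]
      calc (Fintype.card α : ℝ) + (Finset.univ.filter p).card * (Real.exp l - 1)
          ≤ Fintype.card α + q * Fintype.card α * (Real.exp l - 1) := by gcongr
        _ = Fintype.card α * (q * (Real.exp l - 1) + 1) := by ring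
        _ ≤ _ := by gcongr; exact Real.add_one_le_exp _
    · simp [hv]
  refine (Finset.prod_le_prod (fun v _ => Finset.sum_nonneg fun a _ => ?_) fun v _ => h3 v).trans ?_
  · split_ifs <;> positivity
  rw [Finset.prod_mul_distrib, Finset.prod_ite_mem, Finset.univ_inter, Finset.prod_const,
    Finset.prod_const, Finset.card_univ, Fintype.card_fin, ← Real.exp_nat_mul]
  apply le_of_eq
  ring_nf

/-- If the quotient `j` is positive, then `j ≤ 1 + l * (X - t)` because `l * t ≥ 1`, and `1 + x ≤
exp x`. This brings a floor quotient within reach of exponential moments. -/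
theorem natCast_div_le_exp {X t : ℕ} {l : ℝ} (ht : 1 ≤ t) (hl : 1 ≤ l * t) :
    ((X / t : ℕ) : ℝ) ≤ Real.exp (l * (X - t)) := by
  set j := X / t with hj
  rcases Nat.eq_zero_or_pos j with h0 | h0
  · rw [h0]
    simpa using Real.exp_nonneg _
  have h1 : j * t ≤ X := Nat.div_mul_le_self X t
  have h1' : (j : ℝ) * t ≤ X := by exact_mod_cast h1
  have ht' : (1 : ℝ) ≤ t := by exact_mod_cast ht
  have hj' : (1 : ℝ) ≤ j := by exact_mod_cast h0
  have hl0 : 0 < l := by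
    by_contra! h
    nlinarith
  have h2 : (j : ℝ) - 1 ≤ l * (X - t) := by
    calc (j : ℝ) - 1 ≤ (l * t) * (j - 1) := by nlinarith
      _ = l * (j * t - t) := by ring
      _ ≤ _ := by gcongr
  have := Real.add_one_le_exp (l * (X - t))
  linarith

theorem exp_sub_one_le {l : ℝ} (h0 : 0 ≤ l) (h1 : l ≤ 1) : Real.exp l - 1 ≤ l + l ^ 2 := by
  have := Real.abs_exp_sub_one_sub_id_le (x := l) (by rwa [abs_of_nonneg h0])
  rw [abs_le] at this
  linarith

/-- Chernoff's bound with parameter `ε / 2`, applied to the quotient itself and not to a tail. The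
exponent is at most `μ * (ε / 2 + ε ^ 2 / 4) - (ε / 2) * (1 + ε) * μ = -ε ^ 2 * μ / 4`. -/
theorem sum_card_filter_div_le {n : ℕ} [Nonempty α] (p : α → Prop) [DecidablePred p]
    (W : Finset (Fin n)) {ε q μ : ℝ} {t : ℕ} (hε : 0 < ε) (hε1 : ε ≤ 1)
    (hq : ((Finset.univ.filter p).card : ℝ) ≤ q * Fintype.card α) (hμ : q * W.card ≤ μ)
    (hμ0 : 0 ≤ μ) (ht : (1 + ε) * μ ≤ t) (htε : 2 / ε ≤ t) :
    ∑ x : Fin n → α, (((W.filter fun v => p (x v)).card / t : ℕ) : ℝ) ≤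
      (Fintype.card α : ℝ) ^ n * Real.exp (-(ε ^ 2 * μ / 4)) := by
  have ht0 : (0 : ℝ) < t := lt_of_lt_of_le (by positivity) htε
  have ht1 : 1 ≤ t := by exact_mod_cast ht0
  have hlt : 1 ≤ ε / 2 * t := by
    rw [div_le_iff₀ hε] at htε
    linarith
  have hl := exp_sub_one_le (l := ε / 2) (by positivity) (by linarith)
  have hl1 : 0 ≤ Real.exp (ε / 2) - 1 := by
    have := Real.add_one_le_exp (ε / 2)
    linarith
  calc ∑ x : Fin n → α, (((W.filter fun v => p (x v)).card / t : ℕ) : ℝ)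
      ≤ ∑ x : Fin n → α, Real.exp (-(ε / 2 * t)) *
          Real.exp (ε / 2 * (W.filter fun v => p (x v)).card) := by
        refine Finset.sum_le_sum fun x _ => ?_
        refine (natCast_div_le_exp ht1 hlt).trans_eq ?_
        rw [← Real.exp_add]
        ring_nf
    _ ≤ Real.exp (-(ε / 2 * t)) *
          ((Fintype.card α : ℝ) ^ n * Real.exp (q * W.card * (Real.exp (ε / 2) - 1))) := by
        rw [← Finset.mul_sum]
        gcongr
        exact sum_exp_card_filter_le p W (by positivity) hq
    _ = (Fintype.card α : ℝ) ^ n *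
          Real.exp (q * W.card * (Real.exp (ε / 2) - 1) - ε / 2 * t) := by
        rw [mul_left_comm, ← Real.exp_add]
        ring_nf
    _ ≤ _ := by
        gcongr
        have h1 : q * W.card * (Real.exp (ε / 2) - 1) ≤ μ * (ε / 2 + (ε / 2) ^ 2) :=
          mul_le_mul hμ hl hl1 hμ0
        nlinarith

end Counting

/-! ### The law of the random keys. -/

namespace WordRAM

instance : IsProbabilityMeasure coins := by
  unfold coins
  infer_instance

theorem coins_cylinder (ω₀ : ℕ → Bool) (N : ℕ) :
    coins {ω | ∀ i < N, ω i = ω₀ i} = (2⁻¹) ^ N := by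
  have h : {ω : ℕ → Bool | ∀ i < N, ω i = ω₀ i} =
      Set.pi (Finset.range N : Finset ℕ) fun i => {ω₀ i} := by
    ext ω
    simp [Set.mem_pi]
  rw [h, coins, Measure.infinitePi_pi _ fun i _ => MeasurableSet.singleton _]
  have : ∀ b : Bool, (PMF.uniformOfFintype Bool).toMeasure {b} = 2⁻¹ := by
    intro b
    rw [PMF.toMeasure_apply_singleton _ _ (MeasurableSet.singleton _), PMF.uniformOfFintype_apply]
    simp
  simp [this]

theorem bitsValue_inj {ω ω' : ℕ → Bool} {k r : ℕ} (h : bitsValue ω k r = bitsValue ω' k r) :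
    ∀ i < r, ω (k + i) = ω' (k + i) := by
  induction r with
  | zero => simp
  | succ r ih =>
    simp only [bitsValue] at h
    have h1 : bitsValue ω k r = bitsValue ω' k r ∧ ω (k + r) = ω' (k + r) := by
      cases h1 : ω (k + r) <;> cases h2 : ω' (k + r) <;> simp [h1, h2] at h ⊢ <;> omega
    intro i hi
    rcases Nat.lt_succ_iff_lt_or_eq.1 hi with h2 | h2
    · exact ih h1.1 i h2
    · rw [h2]
      exact h1.2

/-- The random keys drawn from the bits `ω`. -/
def randomKeys (n r : ℕ) (ω : ℕ → Bool) (v : Fin n) : Fin (2 ^ r) :=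
  ⟨bitsValue ω (v * r) r, bitsValue_lt ω _ r⟩

/-- Prescribing all keys prescribes the first `n * r` bits, so each key vector has probability at
most `2 ^ (-n r)`. An upper bound is all that is needed to pass from counting to probability. -/
theorem coins_randomKeys_mem_le {n r : ℕ} (T : Finset (Fin n → Fin (2 ^ r))) :
    coins.real {ω | randomKeys n r ω ∈ T} ≤ T.card / ((2 : ℝ) ^ r) ^ n := by
  have h1 : ∀ x : Fin n → Fin (2 ^ r),
      coins {ω | randomKeys n r ω = x} ≤ (2⁻¹) ^ (n * r) := by
    intro x
    rcases Set.eq_empty_or_nonempty {ω | randomKeys n r ω = x} with h | ⟨ω₀, h₀⟩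
    · rw [h]
      simp
    · rw [← coins_cylinder ω₀]
      apply measure_mono
      rintro ω hω i hi
      have hr : 0 < r := Nat.pos_of_ne_zero (by rintro rfl; simp at hi)
      have hv : i / r < n := (Nat.div_lt_iff_lt_mul hr).2 hi
      have he : randomKeys n r ω ⟨i / r, hv⟩ = randomKeys n r ω₀ ⟨i / r, hv⟩ := by
        rw [show randomKeys n r ω = x from hω, show randomKeys n r ω₀ = x from h₀]
      have := bitsValue_inj (Fin.mk.inj he) (i % r) (Nat.mod_lt _ hr)
      simp only [Nat.div_add_mod'] at this
      exact this
  have h2 : coins {ω | randomKeys n r ω ∈ T} ≤ T.card * (2⁻¹) ^ (n * r) := by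
    calc coins {ω | randomKeys n r ω ∈ T} = coins (⋃ x ∈ T, {ω | randomKeys n r ω = x}) := by
          congr 1
          ext ω
          simp
      _ ≤ ∑ x ∈ T, coins {ω | randomKeys n r ω = x} := measure_biUnion_finset_le _ _
      _ ≤ ∑ _x ∈ T, (2⁻¹) ^ (n * r) := Finset.sum_le_sum fun x _ => h1 x
      _ = _ := by simp
  rw [measureReal_def]
  refine (ENNReal.toReal_mono (by finiteness) h2).trans_eq ?_
  rw [ENNReal.toReal_mul, ENNReal.toReal_pow, ENNReal.toReal_inv, ENNReal.toReal_natCast,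
    ENNReal.toReal_ofNat, inv_pow, ← pow_mul, mul_comm r n, div_eq_mul_inv]

end WordRAM

/-! ### The numbers of pieces under random keys. -/

section RandomKeys

variable {n S : ℕ}

/-- Changing one key raises the count of a single class by at most one, hence at most one quotient,
and that by at most one. -/
theorem sum_classCount_div_update_le {x : Fin n → Fin S} (i : Fin n) (a : Fin S) {g t N : ℕ}
    (ht : 1 ≤ t) (W : Finset (Fin n)) :
    ∑ A ∈ Finset.range N, classCount (fun v => (Function.update x i a v : ℕ)) g W A / t ≤
      ∑ A ∈ Finset.range N, classCount (fun v => (x v : ℕ)) g W A / t + 1 := by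
  have h1 : ∀ A, classCount (fun v => (Function.update x i a v : ℕ)) g W A ≤
      classCount (fun v => (x v : ℕ)) g W A + if A = a / g then 1 else 0 := by
    intro A
    unfold classCount
    split_ifs with h
    · have : (W.filter fun v => (Function.update x i a v : ℕ) / g = A) ⊆
          insert i (W.filter fun v => (x v : ℕ) / g = A) := by
        intro v
        simp only [Finset.mem_filter, Finset.mem_insert]
        by_cases hv : v = i
        · tauto
        · rw [Function.update_of_ne hv]
          tauto
      exact (Finset.card_le_card this).trans (Finset.card_insert_le _ _)
    · apply Finset.card_le_card
      intro v
      simp only [Finset.mem_filter]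
      by_cases hv : v = i
      · rw [hv, Function.update_self]
        rintro ⟨-, h'⟩
        exact absurd h'.symm h
      · rw [Function.update_of_ne hv]
        tauto
  calc ∑ A ∈ Finset.range N, classCount (fun v => (Function.update x i a v : ℕ)) g W A / t
      ≤ ∑ A ∈ Finset.range N,
          (classCount (fun v => (x v : ℕ)) g W A / t + if A = a / g then 1 else 0) := by
        refine Finset.sum_le_sum fun A _ => (Nat.div_le_div_right (h1 A)).trans ?_
        split_ifs
        · rw [Nat.div_le_iff_le_mul_add_pred (by omega)]
          have := Nat.div_add_mod (classCount (fun v => (x v : ℕ)) g W A) t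
          have := Nat.mod_lt (classCount (fun v => (x v : ℕ)) g W A) (show 0 < t by omega)
          rw [mul_add]
          omega
        · simp
    _ ≤ _ := by
        rw [Finset.sum_add_distrib]
        gcongr
        rw [Finset.sum_ite_eq' ]
        split_ifs <;> omega

theorem card_filter_div_eq_le {g : ℕ} (hg : 1 ≤ g) (A : ℕ) :
    (Finset.univ.filter fun a : Fin S => (a : ℕ) / g = A).card ≤ g := by
  calc (Finset.univ.filter fun a : Fin S => (a : ℕ) / g = A).card
      ≤ (Finset.Ico (A * g) (A * g + g)).card := by
        refine Finset.card_le_card_of_injOn Fin.val ?_ Fin.val_injective.injOn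
        intro a ha
        have h := (Finset.mem_filter.1 ha).2
        rw [Nat.div_eq_iff (by omega)] at h
        simp only [Finset.coe_Ico, Set.mem_Ico]
        omega
    _ = g := by simp

variable [NeZero n] {G : SimpleGraph (Fin n)} {K M : ℕ}

/-- With random keys, all vertices have few pieces with high probability. -/
theorem coins_length_vertexPieces_le {r H g t K₀ : ℕ} {ε Δ μ₁ μ₂ ρ : ℝ} (hr : 2 ^ r = 2 * H)
    (hg : 1 ≤ g) (hK : K₀ ≤ K) (hM : ∀ l j, l ≤ K₀ → j ≤ t → l.choose j ≤ M) (hε : 0 < ε)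
    (hε1 : ε ≤ 1)
    (hΔ : ∀ b, ∃ W : Finset (Fin n), (W.card : ℝ) ≤ Δ ∧ ((∀ u, u ∈ W ↔ G.Adj b u) ∨
      ∀ u, u ∈ W ↔ Gᶜ.Adj b u))
    (hμ₁ : (g : ℝ) / 2 ^ r * Δ ≤ μ₁) (ht : (1 + ε) * μ₁ ≤ t) (htε : 2 / ε ≤ t)
    (hμ₂ : (g : ℝ) / 2 ^ r * n ≤ μ₂) (hK₀ : (1 + ε) * μ₂ ≤ K₀) (hKε : 2 / ε ≤ K₀) (hρ : 0 ≤ ρ) :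
    WordRAM.coins.real {ω | ∃ b, ((H / g : ℕ) : ℝ) + 3 + 2 * ((2 ^ r / g + 1 : ℕ) *
      (Real.exp (-(ε ^ 2 * μ₁ / 4)) + Real.exp (-(ε ^ 2 * μ₂ / 4))) + ρ) <
      (vertexPieces (fun v => (WordRAM.randomKeys n r ω v : ℕ)) G H K M b).length} ≤
      n * Real.exp (-(ρ ^ 2 / (8 * n))) := by
  classical
  choose W hW1 hW2 using hΔ
  have hn : 0 < n := NeZero.pos n
  have ht1 : 1 ≤ t := by
    have : (0 : ℝ) < t := lt_of_lt_of_le (by positivity) htε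
    exact_mod_cast this
  have hK1 : 1 ≤ K₀ := by
    have : (0 : ℝ) < K₀ := lt_of_lt_of_le (by positivity) hKε
    exact_mod_cast this
  have hg0 : (0 : ℝ) < g := by exact_mod_cast hg
  have hΔ0 : 0 ≤ Δ := (Nat.cast_nonneg _).trans (hW1 ⟨0, hn⟩)
  have hμ₁0 : 0 ≤ μ₁ := le_trans (by positivity) hμ₁
  have hμ₂0 : 0 ≤ μ₂ := le_trans (by positivity) hμ₂
  set NB := 2 ^ r / g + 1 with hNB
  set m : ℝ := NB * (Real.exp (-(ε ^ 2 * μ₁ / 4)) + Real.exp (-(ε ^ 2 * μ₂ / 4))) with hm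
  set F : Fin n → (Fin n → Fin (2 ^ r)) → ℕ := fun b x => ∑ A ∈ Finset.range NB,
    (classCount (fun v => (x v : ℕ)) g (W b) A / t +
      classCount (fun v => (x v : ℕ)) g Finset.univ A / K₀) with hF
  have hq : ∀ A, ((Finset.univ.filter fun a : Fin (2 ^ r) => (a : ℕ) / g = A).card : ℝ) ≤
      (g : ℝ) / 2 ^ r * Fintype.card (Fin (2 ^ r)) := by
    intro A
    have : ((Finset.univ.filter fun a : Fin (2 ^ r) => (a : ℕ) / g = A).card : ℝ) ≤ g := by
      exact_mod_cast card_filter_div_eq_le hg A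
    simpa using this
  have hmean : ∀ b, ∑ x, (F b x : ℝ) ≤ (Fintype.card (Fin (2 ^ r)) : ℝ) ^ n * m := by
    intro b
    simp only [hF, Nat.cast_sum, Nat.cast_add]
    rw [Finset.sum_comm]
    calc ∑ A ∈ Finset.range NB, ∑ x : Fin n → Fin (2 ^ r),
          (((classCount (fun v => (x v : ℕ)) g (W b) A / t : ℕ) : ℝ) +
            ((classCount (fun v => (x v : ℕ)) g Finset.univ A / K₀ : ℕ) : ℝ))
        ≤ ∑ _A ∈ Finset.range NB, ((Fintype.card (Fin (2 ^ r)) : ℝ) ^ n *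
            Real.exp (-(ε ^ 2 * μ₁ / 4)) + (Fintype.card (Fin (2 ^ r)) : ℝ) ^ n *
            Real.exp (-(ε ^ 2 * μ₂ / 4))) := by
          refine Finset.sum_le_sum fun A _ => ?_
          rw [Finset.sum_add_distrib]
          refine add_le_add ?_ ?_
          · refine sum_card_filter_div_le (fun a : Fin (2 ^ r) => (a : ℕ) / g = A) (W b) hε hε1
              (hq A) (le_trans ?_ hμ₁) hμ₁0 ht htε
            exact mul_le_mul_of_nonneg_left (hW1 b) (by positivity)
          · refine sum_card_filter_div_le (fun a : Fin (2 ^ r) => (a : ℕ) / g = A) Finset.univ hε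
              hε1 (hq A) (le_trans ?_ hμ₂) hμ₂0 hK₀ hKε
            simp
      _ = _ := by
          rw [Finset.sum_const, Finset.card_range, nsmul_eq_mul, hm]
          ring
  -- One unit for the quotients by `t` and one for those by `K₀`; this is the constant `c = 2` that
  -- gives `8 * n` in the tail.
  have hdiff : ∀ b x i a, (F b (Function.update x i a) : ℝ) ≤ F b x + 2 := by
    intro b x i a
    have h1 := sum_classCount_div_update_le (x := x) i a (g := g) (N := NB) ht1 (W b)
    have h2 := sum_classCount_div_update_le (x := x) i a (g := g) (N := NB) hK1 Finset.univ
    have : F b (Function.update x i a) ≤ F b x + 2 := by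
      simp only [hF, Finset.sum_add_distrib]
      omega
    exact_mod_cast this
  -- The bad key vectors; the union over `b` accounts for the factor `n` in the failure probability.
  set T : Finset (Fin n → Fin (2 ^ r)) := Finset.univ.biUnion fun b =>
    Finset.univ.filter fun x => m + ρ ≤ F b x with hT
  have hTcard : (T.card : ℝ) ≤ n * (((2 : ℝ) ^ r) ^ n * Real.exp (-(ρ ^ 2 / (8 * n)))) := by
    calc (T.card : ℝ) ≤ ∑ b : Fin n, ((Finset.univ.filter fun x => m + ρ ≤ F b x).card : ℝ) := by
          exact_mod_cast Finset.card_biUnion_le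
      _ ≤ ∑ _b : Fin n, (((2 : ℝ) ^ r) ^ n * Real.exp (-(ρ ^ 2 / (8 * n)))) := by
          refine Finset.sum_le_sum fun b _ => ?_
          refine (card_filter_le_of_bounded_differences (c := 2) (by norm_num) hρ hn (hdiff b)
            (hmean b)).trans_eq ?_
          rw [Fintype.card_fin]
          push_cast
          congr 4
          ring
      _ = _ := by simp
  calc _ ≤ WordRAM.coins.real {ω | WordRAM.randomKeys n r ω ∈ T} := by
        refine measureReal_mono ?_
        rintro ω ⟨b, hb⟩
        rw [Set.mem_ofPred_eq, hT, Finset.mem_biUnion]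
        refine ⟨b, Finset.mem_univ _, Finset.mem_filter.2 ⟨Finset.mem_univ _, ?_⟩⟩
        have h := length_vertexPieces_le (G := G) (key := fun v => (WordRAM.randomKeys n r ω v : ℕ))
          (b := b) (fun v => (WordRAM.randomKeys n r ω v).2) hr hg ht1 hK1 hK hM (W := W b) (by
            rcases hW2 b with h | h
            · left; ext u; simp [h]
            · right; ext u; simp only [h, Finset.mem_filter, Finset.mem_univ, true_and])
        have h' : ((vertexPieces (fun v => (WordRAM.randomKeys n r ω v : ℕ)) G H K M b).length : ℝ)
            ≤
            ((H / g : ℕ) : ℝ) + 3 + 2 * F b (WordRAM.randomKeys n r ω) := by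
          exact_mod_cast h
        linarith
    _ ≤ T.card / ((2 : ℝ) ^ r) ^ n := WordRAM.coins_randomKeys_mem_le T
    _ ≤ _ := by
        rw [div_le_iff₀ (by positivity)]
        refine hTcard.trans_eq ?_
        ring

end RandomKeys

/-! ### Estimates for the entropy function. -/

section Entropy

theorem binEntropyTwo_eq (x : ℝ) : binEntropyTwo x = Real.binEntropy x / Real.log 2 := by
  rw [binEntropyTwo, Real.binEntropy_eq_negMulLog_add_negMulLog_one_sub, Real.negMulLog,
    Real.negMulLog, Real.logb, Real.logb]
  ring

/-- By concavity the entropy lies above the chord from `0` to `1/2`. -/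
theorem two_mul_le_binEntropyTwo {x : ℝ} (h0 : 0 ≤ x) (h1 : x ≤ 1 / 2) :
    2 * x ≤ binEntropyTwo x := by
  have hlog : 0 < Real.log 2 := Real.log_pos (by norm_num)
  rw [binEntropyTwo_eq, le_div_iff₀ hlog]
  have := Real.strictConcave_binEntropy.concaveOn.2 (x := 0) (y := 2⁻¹) (by norm_num) (by norm_num)
    (show 0 ≤ 1 - 2 * x by linarith) (show 0 ≤ 2 * x by linarith) (by ring)
  simp only [smul_eq_mul, mul_zero, Real.binEntropy_zero, Real.binEntropy_two_inv, zero_add] at this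
  rwa [show 2 * x * 2⁻¹ = x by ring] at this

/-- The second summand of the entropy is linear in `x`, so the order of magnitude is `x * lg (1 /
x)`. -/
theorem binEntropyTwo_le {x : ℝ} (h0 : 0 < x) (h1 : x ≤ 1 / 2) :
    binEntropyTwo x ≤ x * (Real.logb 2 x⁻¹ + 2) := by
  have hlog : 1 / 2 < Real.log 2 := by
    have := Real.log_two_gt_d9
    linarith
  have h2 : -(1 - x) * Real.log (1 - x) ≤ x := by
    have := Real.one_sub_inv_le_log_of_pos (show 0 < 1 - x by linarith)
    have h3 : (1 - x) * (1 - (1 - x)⁻¹) ≤ (1 - x) * Real.log (1 - x) :=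
      mul_le_mul_of_nonneg_left this (by linarith)
    rw [mul_sub, mul_inv_cancel₀ (by linarith)] at h3
    linarith
  have h4 : -(1 - x) * Real.logb 2 (1 - x) ≤ 2 * x := by
    rw [Real.logb, ← mul_div_assoc, div_le_iff₀ (by linarith)]
    nlinarith
  rw [binEntropyTwo, Real.logb_inv]
  linarith

/-- A single term of the binomial expansion of `(x + (1 - x)) ^ N` is at most `1`. The slack `c`
absorbs that `j` may exceed `x * N` slightly; since `x ≤ 1 - x`, a larger `j` only weakens the
bound. -/
theorem choose_le_exp_binEntropy {N j : ℕ} {x c : ℝ} (h0 : 0 < x) (h1 : x ≤ 1 / 2) (hc : 1 ≤ c)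
    (hj : (j : ℝ) ≤ c * x * N) : (N.choose j : ℝ) ≤ Real.exp (c * N * Real.binEntropy x) := by
  rcases lt_or_ge N j with hN | hN
  · rw [Nat.choose_eq_zero_of_lt hN]
    simpa using Real.exp_nonneg _
  have hx1 : 0 < 1 - x := by linarith
  have hbin : (N.choose j : ℝ) * (x ^ j * (1 - x) ^ (N - j)) ≤ 1 := by
    have h := add_pow x (1 - x) N
    rw [add_sub_cancel, one_pow] at h
    refine le_of_le_of_eq ?_ h.symm
    have := Finset.single_le_sum
      (f := fun m => x ^ m * (1 - x) ^ (N - m) * (N.choose m : ℝ)) (s := Finset.range (N + 1))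
      (fun m _ => by positivity) (Finset.mem_range.2 (Nat.lt_succ_of_le hN))
    rwa [mul_comm]
  have hpow : x ^ j * (1 - x) ^ (N - j) =
      Real.exp (j * Real.log x + (N - j) * Real.log (1 - x)) := by
    rw [Real.exp_add, ← Nat.cast_sub hN, Real.exp_nat_mul, Real.exp_nat_mul, Real.exp_log h0,
      Real.exp_log hx1]
  rw [hpow, ← le_div_iff₀ (Real.exp_pos _), one_div, ← Real.exp_neg] at hbin
  refine hbin.trans (Real.exp_le_exp.2 ?_)
  have hl1 : Real.log x ≤ Real.log (1 - x) := Real.log_le_log h0 (by linarith)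
  have hl2 : Real.log (1 - x) ≤ 0 := Real.log_nonpos hx1.le (by linarith)
  have hN0 : (0 : ℝ) ≤ N := Nat.cast_nonneg N
  rw [Real.binEntropy_eq_negMulLog_add_negMulLog_one_sub, Real.negMulLog, Real.negMulLog]
  have e1 : (j : ℝ) * (Real.log (1 - x) - Real.log x) ≤
      c * x * N * (Real.log (1 - x) - Real.log x) :=
    mul_le_mul_of_nonneg_right hj (by linarith)
  have e2 : N * (-Real.log (1 - x)) ≤ c * (N * (-Real.log (1 - x))) :=
    le_mul_of_one_le_left (mul_nonneg hN0 (by linarith)) hc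
  nlinarith

end Entropy

/-! ### Bounds that need no randomness, and the degree bound in terms of the input. -/

section Deterministic

variable {n : ℕ} {G : SimpleGraph (Fin n)} {H K M : ℕ} {b : Fin n}

/-- The general count with a single class (`g = 2 * S`) and `t = 1`: a break requires a member of
`W` or `K` positions. With `t = 1` only binomial coefficients with `j ≤ 1` must be at most `M`,
which is `K ≤ M`. -/
theorem length_vertexPieces_le_card [NeZero n] {key : Fin n → ℕ} {S : ℕ} (hS : ∀ v, key v < S)
    (hH : S = 2 * H) (hK : 1 ≤ K) (hKM : K ≤ M) {W : Finset (Fin n)}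
    (hW : (∀ u, u ∈ W ↔ G.Adj b u) ∨ ∀ u, u ∈ W ↔ Gᶜ.Adj b u) :
    (vertexPieces key G H K M b).length ≤ 3 + 2 * (W.card + n / K) := by
  classical
  have hS0 : 0 < S := (Nat.zero_le _).trans_lt (hS b)
  have h := length_vertexPieces_le (G := G) (b := b) (K := K) (M := M) (g := 2 * S) (t := 1)
    (K₀ := K) hS hH (by omega) le_rfl hK le_rfl (fun l j hl hj => by
      interval_cases j
      · simp
        omega
      · simp
        omega) (W := W) (by
      rcases hW with h | h
      · left; ext u; simp [h]
      · right; ext u; simp only [h, Finset.mem_filter, Finset.mem_univ, true_and])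
  have h1 : H / (2 * S) = 0 := Nat.div_eq_of_lt (by omega)
  have h2 : S / (2 * S) = 0 := Nat.div_eq_of_lt (by omega)
  have h3 : classCount key (2 * S) W 0 ≤ W.card := Finset.card_filter_le _ _
  have h4 : classCount key (2 * S) Finset.univ 0 / K ≤ n / K := by
    apply Nat.div_le_div_right
    exact (Finset.card_filter_le _ _).trans_eq (by simp)
  rw [h1, h2, zero_add, Finset.sum_range_one, Nat.div_one] at h
  omega

/-- Since `H` is at least every key, there is no wrapping, and `b` is responsible only for
neighbours whose degree is at least its own. There are at most `deg b` of them, each contributes at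
least `deg b` to the degree sum, and pieces are no more numerous than these neighbours. -/
theorem sq_length_vertexPieces_le [NeZero n] {adj : Fin n → List (Fin n)} (hadj :
    IsAdjacencyList G adj)
    (hH : ∀ v, (adj v).length ≤ H) :
    (vertexPieces (fun v => (adj v).length) G H K M b).length ^ 2 ≤ ∑ v, (adj v).length := by
  set key : Fin n → ℕ := fun v => (adj v).length with hkey
  set E := events key G H b (2 * n) with hE
  set T := (E.map (vertAt key)).toFinset with hT
  have h1 : (vertexPieces key G H K M b).length ≤ T.card := by
    rw [hT, List.toFinset_card_of_nodup nodup_map_vertAt_events, List.length_map, vertexPieces,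
      List.length_map]
    exact Cut.length_pieces_le E
  have hmem : ∀ u ∈ T, G.Adj b u ∧ key b ≤ key u := by
    intro u hu
    rw [hT, List.mem_toFinset, List.mem_map, exists_event_iff] at hu
    refine ⟨hu.1, ?_⟩
    rcases hu.2 with h | h
    · exact key_le_of_keyRank_lt h.1
    · have := hH b
      simp only [hkey] at h
      omega
  have h2 : T.card ≤ key b := by
    change T.card ≤ (adj b).length
    rw [← List.toFinset_card_of_nodup (hadj b).1]
    apply Finset.card_le_card
    intro u hu
    rw [List.mem_toFinset, (hadj b).2]
    exact (hmem u hu).1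
  calc (vertexPieces key G H K M b).length ^ 2 ≤ T.card * T.card := by
        rw [sq]
        exact Nat.mul_le_mul h1 h1
    _ ≤ T.card * key b := Nat.mul_le_mul_left _ h2
    _ = ∑ _u ∈ T, key b := by simp
    _ ≤ ∑ u ∈ T, key u := Finset.sum_le_sum fun u hu => (hmem u hu).2
    _ ≤ _ := Finset.sum_le_sum_of_subset (Finset.subset_univ _)

theorem exists_small_side {adj : Fin n → List (Fin n)} (hadj : IsAdjacencyList G adj) (b : Fin n) :
    ∃ W : Finset (Fin n), W.card ≤ WordRAM.maxMinDegree n ((adjacencyInput adj).mem 0) ∧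
      ((∀ u, u ∈ W ↔ G.Adj b u) ∨ ∀ u, u ∈ W ↔ Gᶜ.Adj b u) := by
  classical
  have hdeg : (adjacencyInput adj).mem 0 (b + 1) - (adjacencyInput adj).mem 0 b =
      (adj b).length := by
    rw [WordRAM.adjacencyInput_offset_succ]
    omega
  have hle : WordRAM.minDegree n ((adjacencyInput adj).mem 0) b ≤
      WordRAM.maxMinDegree n ((adjacencyInput adj).mem 0) :=
    Finset.le_sup (f := WordRAM.minDegree n ((adjacencyInput adj).mem 0)) (Finset.mem_range.2 b.2)
  unfold WordRAM.minDegree at hle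
  rw [hdeg] at hle
  have h1 : (adj b).length = G.degree b := by
    rw [← List.toFinset_card_of_nodup (hadj b).1, ← SimpleGraph.card_neighborFinset_eq_degree]
    congr 1
    ext u
    simp [(hadj b).2]
  rcases min_le_iff.1 hle with h | h
  · refine ⟨G.neighborFinset b, ?_, Or.inl fun u => by simp⟩
    rw [SimpleGraph.card_neighborFinset_eq_degree]
    omega
  · refine ⟨Gᶜ.neighborFinset b, ?_, Or.inr fun u => by simp⟩
    rw [SimpleGraph.card_neighborFinset_eq_degree, SimpleGraph.degree_compl, Fintype.card_fin]
    omega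

theorem maxMinDegree_le {adj : Fin n → List (Fin n)} (hadj : IsAdjacencyList G adj) {δ : ℝ}
    (hn : 2 ≤ n) (hδ : DegreeBound G δ) :
    (WordRAM.maxMinDegree n ((adjacencyInput adj).mem 0) : ℝ) ≤ δ * (n - 1) := by
  classical
  have hn1 : (0 : ℝ) < (n : ℝ) - 1 := by
    have : (2 : ℝ) ≤ n := by exact_mod_cast hn
    linarith
  have hmem : ∀ v : Fin n, (WordRAM.minDegree n ((adjacencyInput adj).mem 0) v : ℝ) ≤
      δ * (n - 1) := by
    intro v
    have hdeg : (adjacencyInput adj).mem 0 (v + 1) - (adjacencyInput adj).mem 0 v =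
        (adj v).length := by
      rw [WordRAM.adjacencyInput_offset_succ]
      omega
    have hset : (G.neighborSet v).ncard = (adj v).length := by
      rw [← List.toFinset_card_of_nodup (hadj v).1, ← Set.ncard_coe_finset]
      congr 1
      ext u
      simp [(hadj v).2]
    have hlt : (adj v).length + 1 ≤ n := by
      have h : (v :: adj v).length ≤ Fintype.card (Fin n) := by
        apply List.Nodup.length_le_card
        rw [List.nodup_cons, (hadj v).2]
        exact ⟨G.loopless.irrefl v, (hadj v).1⟩
      simpa using h
    have h := hδ v
    rw [hset] at h
    rw [WordRAM.minDegree, hdeg]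
    rcases min_le_iff.1 h with h | h
    · rw [div_le_iff₀ hn1] at h
      refine le_trans ?_ h
      exact_mod_cast min_le_left _ _
    · have h2 : ((n - 1 - (adj v).length : ℕ) : ℝ) ≤ δ * (n - 1) := by
        rw [Nat.cast_sub (by omega), Nat.cast_sub (by omega), Nat.cast_one]
        have h3 : (1 - ((adj v).length : ℝ) / (n - 1)) * (n - 1) ≤ δ * (n - 1) :=
          mul_le_mul_of_nonneg_right h hn1.le
        rw [sub_mul, div_mul_cancel₀ _ hn1.ne'] at h3
        linarith
      refine le_trans ?_ h2
      exact_mod_cast min_le_right _ _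
  obtain ⟨v, hv, he⟩ := Finset.exists_mem_eq_sup (Finset.range n)
    ⟨0, Finset.mem_range.2 (by omega)⟩ (WordRAM.minDegree n ((adjacencyInput adj).mem 0))
  rw [WordRAM.maxMinDegree, he]
  exact hmem ⟨v, Finset.mem_range.1 hv⟩

end Deterministic

/-! ### The load bound for a fixed precision. -/

/-- The unit in which loads are measured. -/
noncomputable def loadUnit (δ : ℝ) (n : ℕ) : ℝ := binEntropyTwo δ * ((n : ℝ) / Real.logb 2 n)

/-- The expected number of vertices in a class of keys. -/
noncomputable def classSize (e δ : ℝ) (n : ℕ) : ℝ :=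
  (1 - e) * Real.logb 2 n / (binEntropyTwo δ * (1 + e) ^ 3)

/-- The loss factor from rounding and from deviations of size `e`. -/
noncomputable def lossFactor (e : ℝ) : ℝ := (1 + e) ^ 4 / (1 - e)

/-- The conditions on `n` under which the load bound with precision `e` is proved. -/
structure LargeEnough (e δ : ℝ) (n : ℕ) : Prop where
  e_pos : 0 < e
  e_le : e ≤ 1 / 2
  le_n : 16 ≤ n
  δ_pos : 0 < δ
  δ_le : δ ≤ 1 / 2
  le_size : (1 + e) / e ≤ classSize e δ n
  loss_le_size : (lossFactor e + 1) / e ≤ classSize e δ n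
  le_δ_size : 2 / e ≤ δ * classSize e δ n
  exp_le : Real.exp (-(e ^ 2 * (δ * classSize e δ n) / 4)) ≤ e / (4 * (lossFactor e + 1))
  one_le : 1 ≤ δ * n
  three_le : 3 ≤ e * loadUnit δ n
  pow_two_thirds_le : (n : ℝ) ^ (2 / 3 : ℝ) ≤ e * loadUnit δ n / 2
  pow_three_fourths_le : (n : ℝ) ^ (3 / 4 : ℝ) ≤ e * loadUnit δ n
  pow_le : (n : ℝ) ^ (1 - e / 5) ≤ e * loadUnit δ n / 4
  size_mul_pow_le : 2 * Nat.size n * (n : ℝ) ^ (1 - e / 5) ≤ e * loadUnit δ n / 4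
  size_le : (Nat.size n : ℝ) ≤ (n : ℝ) ^ (1 / 2 : ℝ)
  log_div_le : Real.logb 2 n / (2 * δ) + 1 ≤ (n : ℝ) ^ (1 / 8 : ℝ)
  one_lt_pow : 1 < (n : ℝ) ^ (e / 5)
  fail_le : n * Real.exp (-(((n : ℝ) ^ (2 / 3 : ℝ)) ^ 2 / (8 * n))) ≤ e

namespace LargeEnough

variable {e δ : ℝ} {n : ℕ}

theorem n_pos (hL : LargeEnough e δ n) : (0 : ℝ) < n := by
  have := hL.le_n
  exact_mod_cast (show 0 < n by omega)

theorem log_pos (hL : LargeEnough e δ n) : 0 < Real.logb 2 n := by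
  have := hL.le_n
  exact Real.logb_pos (by norm_num) (by exact_mod_cast (show 1 < n by omega))

theorem entropy_pos (hL : LargeEnough e δ n) : 0 < binEntropyTwo δ := by
  have := two_mul_le_binEntropyTwo hL.δ_pos.le hL.δ_le
  have := hL.δ_pos
  linarith

theorem one_sub_pos (hL : LargeEnough e δ n) : 0 < 1 - e := by
  have := hL.e_le
  linarith

theorem unit_pos (hL : LargeEnough e δ n) : 0 < loadUnit δ n :=
  mul_pos hL.entropy_pos (div_pos hL.n_pos hL.log_pos)

theorem size_pos (hL : LargeEnough e δ n) : 0 < classSize e δ n := by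
  have h1 := hL.one_sub_pos
  have h2 := hL.log_pos
  have h3 := hL.entropy_pos
  have h4 := hL.e_pos
  unfold classSize
  positivity

theorem loss_pos (hL : LargeEnough e δ n) : 0 < lossFactor e := by
  have h1 := hL.one_sub_pos
  have h4 := hL.e_pos
  unfold lossFactor
  positivity

theorem n_div_size (hL : LargeEnough e δ n) :
    (1 + e) * (n / classSize e δ n) = lossFactor e * loadUnit δ n := by
  have h1 := hL.one_sub_pos
  have h2 := hL.log_pos
  have h3 := hL.entropy_pos
  have h4 := hL.e_pos
  unfold classSize loadUnit lossFactor
  field_simp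

theorem δ_mul_size_le (hL : LargeEnough e δ n) : δ * classSize e δ n ≤ classSize e δ n :=
  mul_le_of_le_one_left hL.size_pos.le (by have := hL.δ_le; linarith)

theorem one_le_unit (hL : LargeEnough e δ n) : 1 ≤ loadUnit δ n := by
  have h1 := hL.three_le
  have h2 := hL.e_le
  have h3 := hL.unit_pos
  nlinarith

theorem one_le_mul_size (hL : LargeEnough e δ n) : 1 ≤ e * classSize e δ n := by
  have h := hL.le_size
  have he := hL.e_pos
  rw [div_le_iff₀ he] at h
  linarith

theorem ceil_size_le (hL : LargeEnough e δ n) : ((⌈(1 + e) * classSize e δ n⌉₊ : ℕ) :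
    ℝ) ≤ (1 + e) ^ 2 * classSize e δ n := by
  have h1 := hL.one_le_mul_size
  have he := hL.e_pos
  have hk := hL.size_pos
  have := Nat.ceil_lt_add_one (show 0 ≤ (1 + e) * classSize e δ n by positivity)
  nlinarith

/-- The loss factors in the definition of `classSize` leave at most `lg n / h₂(δ)`, and `h₂(δ) ≥ 2 *
δ`. -/
theorem ceil_size_le_log (hL : LargeEnough e δ n) : ((⌈(1 + e) * classSize e δ n⌉₊ : ℕ) :
    ℝ) ≤ Real.logb 2 n / (2 * δ) := by
  refine hL.ceil_size_le.trans ?_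
  have h1 := hL.one_sub_pos
  have h2 := hL.log_pos
  have h3 := hL.entropy_pos
  have h4 := hL.e_pos
  have h5 := hL.δ_pos
  have h6 := two_mul_le_binEntropyTwo hL.δ_pos.le hL.δ_le
  calc (1 + e) ^ 2 * classSize e δ n = ((1 - e) / (1 + e)) * (Real.logb 2 n / binEntropyTwo δ) := by
        unfold classSize
        field_simp
    _ ≤ 1 * (Real.logb 2 n / binEntropyTwo δ) := by
        gcongr
        rw [div_le_one (by linarith)]
        linarith
    _ ≤ _ := by
        rw [one_mul]
        gcongr

variable {G : SimpleGraph (Fin n)} {adj : Fin n → List (Fin n)}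

/-- The program does not know `δ` and derives `K` from the actual degrees. If the loop stopped at
its first bound, then `K ≥ n / (Δ + 1) * lg n ≥ lg n / (2 * δ)` because `Δ + 1 ≤ 2 * δ * n`;
otherwise `K + 1 > n ^ (1 / 8)`, which is larger still. -/
theorem ceil_size_le_pieceBound (hL : LargeEnough e δ n) (hδ : DegreeBound G δ) (hadj :
    IsAdjacencyList G adj) :
    ⌈(1 + e) * classSize e δ n⌉₊ ≤ WordRAM.pieceBound n ((adjacencyInput adj).mem 0) := by
  have hn := hL.n_pos
  have hδ0 := hL.δ_pos
  have hlog := hL.log_pos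
  have hΔ := maxMinDegree_le hadj (by have := hL.le_n; omega) hδ
  set Δ := WordRAM.maxMinDegree n ((adjacencyInput adj).mem 0) with hΔd
  have hΔ1 : (Δ : ℝ) + 1 ≤ 2 * δ * n := by
    have := hL.one_le
    nlinarith
  have h := hL.ceil_size_le_log
  have hsz : Real.logb 2 n ≤ Nat.size n := by
    have h1 : (n : ℝ) ≤ 2 ^ (Nat.size n : ℝ) := by
      rw [Real.rpow_natCast]
      exact_mod_cast (Nat.lt_size_self n).le
    rwa [Real.logb_le_iff_le_rpow (by norm_num) hn]
  rcases WordRAM.lengthBound_spec n ((n / (Δ + 1) + 1) * Nat.size n) with h1 | h1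
  · refine (Nat.cast_le (α := ℝ)).1 (h.trans (le_trans ?_ (Nat.cast_le.2 h1)))
    have h2 : (n : ℝ) / (Δ + 1) ≤ (n / (Δ + 1) : ℕ) + 1 := by
      have := (Nat.lt_floor_add_one ((n : ℝ) / ((Δ + 1 : ℕ) : ℝ))).le
      rw [Nat.floor_div_eq_div] at this
      exact_mod_cast this
    push_cast
    calc Real.logb 2 n / (2 * δ) = 1 / (2 * δ) * Real.logb 2 n := by ring
      _ ≤ (n : ℝ) / (Δ + 1) * Real.logb 2 n := by
          refine mul_le_mul_of_nonneg_right ?_ hlog.le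
          rw [div_le_div_iff₀ (by positivity) (by positivity)]
          linarith
      _ ≤ _ := by gcongr
  · have h3 := hL.log_div_le
    have h4 : (n : ℝ) ^ (1 / 8 : ℝ) <
        (WordRAM.lengthBound n ((n / (Δ + 1) + 1) * Nat.size n) : ℝ) + 1 := by
      have h5 : (n : ℝ) < ((WordRAM.lengthBound n ((n / (Δ + 1) + 1) * Nat.size n) : ℝ) + 1) ^ 8 :=
          by
        exact_mod_cast h1
      rw [show (1 / 8 : ℝ) = ((8 : ℕ) : ℝ)⁻¹ by norm_num,
        Real.rpow_inv_lt_iff_of_pos hn.le (by positivity) (by norm_num), Real.rpow_natCast]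
      exact h5
    refine (Nat.cast_le (α := ℝ)).1 (h.trans ?_)
    change _ ≤ (WordRAM.lengthBound n ((n / (Δ + 1) + 1) * Nat.size n) : ℝ)
    linarith

theorem size_le_of_ceil_le (hL : LargeEnough e δ n) {K : ℕ} (hK :
    ⌈(1 + e) * classSize e δ n⌉₊ ≤ K) :
    classSize e δ n ≤ K := by
  have h1 := Nat.le_ceil ((1 + e) * classSize e δ n)
  have h2 : ((⌈(1 + e) * classSize e δ n⌉₊ : ℕ) : ℝ) ≤ K := by exact_mod_cast hK
  have he := hL.e_pos
  have hk := hL.size_pos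
  nlinarith

/-- The left side contributes at most `n / K ^ 2 ≤ (n / k) / k`, where `n / k` is of the order of
the unit and `k` is large. -/
theorem pow_three_mul_le (hL : LargeEnough e δ n) {K : ℕ} (hK : ⌈(1 + e) * classSize e δ n⌉₊ ≤ K) :
    ((K ^ 3 * (n / K ^ 5) : ℕ) : ℝ) ≤ e * loadUnit δ n := by
  have h1 := hL.size_le_of_ceil_le hK
  have hk := hL.size_pos
  have hU := hL.unit_pos
  have he := hL.e_pos
  have hl := hL.loss_pos
  have hn := hL.n_pos
  have hK0 : (0 : ℝ) < K := hk.trans_le h1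
  have h2 : ((K ^ 3 * (n / K ^ 5) : ℕ) : ℝ) ≤ n / (K : ℝ) ^ 2 := by
    have h3 : ((n / K ^ 5 : ℕ) : ℝ) ≤ n / (K : ℝ) ^ 5 := by
      have := Nat.cast_div_le (m := n) (n := K ^ 5) (α := ℝ)
      push_cast at this
      exact this
    push_cast
    calc (K : ℝ) ^ 3 * ((n / K ^ 5 : ℕ) : ℝ) ≤ (K : ℝ) ^ 3 * (n / (K : ℝ) ^ 5) := by gcongr
      _ = _ := by field_simp
  refine h2.trans ?_
  have h4 := hL.loss_le_size
  rw [div_le_iff₀ he] at h4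
  have h5 := hL.n_div_size
  have h6 : (n : ℝ) / classSize e δ n ≤ lossFactor e * loadUnit δ n := by
    have : 0 ≤ (n : ℝ) / classSize e δ n := by positivity
    nlinarith
  calc (n : ℝ) / (K : ℝ) ^ 2 ≤ n / classSize e δ n ^ 2 := by gcongr
    _ = (n / classSize e δ n) / classSize e δ n := by rw [div_div, sq]
    _ ≤ (lossFactor e * loadUnit δ n) / classSize e δ n := by gcongr
    _ ≤ e * loadUnit δ n := by
        rw [div_le_iff₀ hk]
        nlinarith

/-- A window of at most `(1 + e) ^ 2 * k` positions with at most `(1 + e) ^ 2 * δ * k` exceptional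
ones admits at most `2 ^ ((1 + e) ^ 3 * k * h₂(δ))` subsets. By the definition of `k` this is `n ^
(1 - e)`, and the factor `n ^ e` is left for `K ^ 5`. -/
theorem choose_le (hL : LargeEnough e δ n) {K : ℕ} (hKe : (K : ℝ) ^ 5 ≤ (n : ℝ) ^ e) (hK0 :
    0 < K) {l j : ℕ}
    (hl : l ≤ ⌈(1 + e) * classSize e δ n⌉₊) (hj : j ≤ ⌈(1 + e) * (δ * classSize e δ n)⌉₊) :
    l.choose j ≤ n / K ^ 5 := by
  have hk := hL.size_pos
  have he := hL.e_pos
  have he1 := hL.one_sub_pos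
  have hδ := hL.δ_pos
  have hn := hL.n_pos
  have hent := hL.entropy_pos
  have hδk := hL.le_δ_size
  set k := classSize e δ n with hkd
  set K₀ := ⌈(1 + e) * k⌉₊ with hK₀
  have h1 : l.choose j ≤ K₀.choose j := Nat.choose_le_choose _ hl
  have hj' : (j : ℝ) ≤ (1 + e) ^ 2 * (δ * k) := by
    have h2 : (j : ℝ) ≤ (⌈(1 + e) * (δ * k)⌉₊ : ℕ) := by exact_mod_cast hj
    have h3 := Nat.ceil_lt_add_one (show 0 ≤ (1 + e) * (δ * k) by positivity)
    rw [div_le_iff₀ he] at hδk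
    nlinarith
  have hK₀1 : (1 + e) * k ≤ K₀ := Nat.le_ceil _
  have hK₀2 : (K₀ : ℝ) ≤ (1 + e) ^ 2 * k := hL.ceil_size_le
  have h2 := choose_le_exp_binEntropy (N := K₀) (j := j) hδ hL.δ_le (c := 1 + e) (by linarith) (by
    calc (j : ℝ) ≤ (1 + e) ^ 2 * (δ * k) := hj'
      _ = (1 + e) * δ * ((1 + e) * k) := by ring
      _ ≤ _ := by gcongr)
  have hbin : Real.binEntropy δ = binEntropyTwo δ * Real.log 2 := by
    rw [binEntropyTwo_eq]
    field_simp
  have h3 : (K₀.choose j : ℝ) ≤ (n : ℝ) ^ (1 - e) := by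
    refine h2.trans ?_
    rw [Real.rpow_def_of_pos hn, Real.exp_le_exp, hbin]
    have hlog2 : 0 < Real.log 2 := Real.log_pos (by norm_num)
    calc (1 + e) * K₀ * (binEntropyTwo δ * Real.log 2)
        ≤ (1 + e) * ((1 + e) ^ 2 * k) * (binEntropyTwo δ * Real.log 2) := by gcongr
      _ = Real.log n * (1 - e) := by
          rw [hkd, classSize, Real.logb]
          field_simp
  rw [Nat.le_div_iff_mul_le (by positivity)]
  have h4 : ((l.choose j : ℕ) : ℝ) * (K : ℝ) ^ 5 ≤ n := by
    calc ((l.choose j : ℕ) : ℝ) * (K : ℝ) ^ 5 ≤ (n : ℝ) ^ (1 - e) * (n : ℝ) ^ e := by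
          gcongr
          exact (Nat.cast_le.2 h1).trans h3
      _ = n := by rw [← Real.rpow_add hn]; simp
  exact_mod_cast h4

end LargeEnough

namespace LargeEnough

variable {e δ : ℝ} {n : ℕ} {G : SimpleGraph (Fin n)} {adj : Fin n → List (Fin n)}

/-- With degrees as keys the square of the number of pieces is at most `n * Nat.size n ≤ n ^ (3 /
2)`. -/
theorem length_le_of_sparse [NeZero n] (hL : LargeEnough e δ n) (hadj : IsAdjacencyList G adj)
    (hs : (adjacencyInput adj).mem 0 n < n * Nat.size n) (ω : ℕ → Bool) (K M : ℕ) (b : Fin n) :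
    ((vertexPieces (fun v : Fin n => WordRAM.keyValue ω n ((adjacencyInput adj).mem 0) v) G
      (WordRAM.keyRange n ((adjacencyInput adj).mem 0)) K M b).length : ℝ) ≤ e * loadUnit δ n := by
  have hn := hL.n_pos
  have hkey : (fun v : Fin n => WordRAM.keyValue ω n ((adjacencyInput adj).mem 0) v) =
      fun v => (adj v).length := by
    ext v
    rw [WordRAM.keyValue, if_pos hs, WordRAM.adjacencyInput_offset_succ]
    omega
  have hlen : ∀ v, (adj v).length ≤ WordRAM.keyRange n ((adjacencyInput adj).mem 0) := by
    intro v
    have h1 : (adj v).length ≤ n := by simpa using (hadj v).1.length_le_card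
    have h2 := Nat.lt_size_self n
    rw [WordRAM.keyRange, if_pos hs]
    omega
  rw [hkey]
  have h := sq_length_vertexPieces_le (K := K) (M := M) (b := b) hadj hlen
  rw [← WordRAM.adjacencyInput_offset_last adj] at h
  refine le_trans ?_ hL.pow_three_fourths_le
  generalize (vertexPieces (fun v => (adj v).length) G
    (WordRAM.keyRange n ((adjacencyInput adj).mem 0)) K M b).length = p at *
  have h1 : (p : ℝ) ^ 2 ≤ n * Nat.size n := by exact_mod_cast (h.trans hs.le)
  have h2 : (p : ℝ) ^ 2 ≤ ((n : ℝ) ^ (3 / 4 : ℝ)) ^ 2 := by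
    calc (p : ℝ) ^ 2 ≤ n * Nat.size n := h1
      _ ≤ n * (n : ℝ) ^ (1 / 2 : ℝ) := by gcongr; exact hL.size_le
      _ = (n : ℝ) ^ (1 + 1 / 2 : ℝ) := by rw [Real.rpow_add hn, Real.rpow_one]
      _ = _ := by
          rw [← Real.rpow_natCast, ← Real.rpow_mul hn.le]
          norm_num
  exact (sq_le_sq₀ (by positivity) (by positivity)).1 h2

/-- A large `K` forces a small `Δ`, because `K ≤ (n / (Δ + 1) + 1) * Nat.size n`. Then both `Δ` and
`n / K` are below the unit by a power of `n`, and the count with a single class suffices. -/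
theorem length_le_of_large_pieceBound [NeZero n] (hL : LargeEnough e δ n)
    (hadj : IsAdjacencyList G adj)
    (hK : (n : ℝ) ^ e < (WordRAM.pieceBound n ((adjacencyInput adj).mem 0) : ℝ) ^ 5)
    {key : Fin n → ℕ} {S H : ℕ} (hS : ∀ v, key v < S) (hH : S = 2 * H) (b : Fin n) :
    ((vertexPieces key G H (WordRAM.pieceBound n ((adjacencyInput adj).mem 0))
      (n / WordRAM.pieceBound n ((adjacencyInput adj).mem 0) ^ 5) b).length : ℝ) ≤
      2 * (e * loadUnit δ n) := by
  have hn := hL.n_pos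
  have hn16 := hL.le_n
  have hX1 := hL.one_lt_pow
  set Δ := WordRAM.maxMinDegree n ((adjacencyInput adj).mem 0) with hΔ
  set K := WordRAM.pieceBound n ((adjacencyInput adj).mem 0) with hKd
  have hK1 : 1 ≤ K := WordRAM.one_le_lengthBound _ _
  have hK0 : (0 : ℝ) < K := by exact_mod_cast hK1
  have hK8 : K ^ 8 ≤ n := WordRAM.lengthBound_pow_le (by omega) _
  have hKM : K ≤ n / K ^ 5 := by
    rw [Nat.le_div_iff_mul_le (by positivity)]
    calc K * K ^ 5 = K ^ 6 := by ring
      _ ≤ K ^ 8 := Nat.pow_le_pow_right hK1 (by omega)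
      _ ≤ n := hK8
  set X : ℝ := (n : ℝ) ^ (e / 5) with hX
  have hXK : X < K := by
    have : X ^ 5 < (K : ℝ) ^ 5 := by
      rw [hX, ← Real.rpow_natCast, ← Real.rpow_mul hn.le]
      convert hK using 2
      push_cast
      ring
    exact lt_of_pow_lt_pow_left₀ 5 hK0.le this
  have hnX : (n : ℝ) / X = (n : ℝ) ^ (1 - e / 5) := by
    rw [Real.rpow_sub hn, Real.rpow_one]
  have hXpos : 0 < X := by linarith
  have hΔn : Δ + 1 ≤ n := by
    obtain ⟨v, hv, he⟩ := Finset.exists_mem_eq_sup (Finset.range n)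
      ⟨0, Finset.mem_range.2 (by omega)⟩ (WordRAM.minDegree n ((adjacencyInput adj).mem 0))
    rw [hΔ, WordRAM.maxMinDegree, he, WordRAM.minDegree]
    omega
  have hΔX : (Δ : ℝ) ≤ 2 * Nat.size n * (n : ℝ) ^ (1 - e / 5) := by
    have hKB : K ≤ max 1 ((n / (Δ + 1) + 1) * Nat.size n) := WordRAM.lengthBound_le _ _
    have hKB' : K ≤ (n / (Δ + 1) + 1) * Nat.size n := by
      rcases le_max_iff.1 hKB with h | h
      · have : (K : ℝ) ≤ 1 := by exact_mod_cast h
        linarith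
      · exact h
    have h1 : (X : ℝ) ≤ (((n / (Δ + 1) : ℕ) : ℝ) + 1) * Nat.size n := by
      refine hXK.le.trans ?_
      exact_mod_cast hKB'
    have h2 : ((n / (Δ + 1) : ℕ) : ℝ) ≤ n / (Δ + 1) := by
      have := Nat.cast_div_le (m := n) (n := Δ + 1) (α := ℝ)
      push_cast at this
      exact this
    have h3 : (1 : ℝ) ≤ n / (Δ + 1) := by
      rw [le_div_iff₀ (by positivity), one_mul]
      exact_mod_cast hΔn
    have h4 : X ≤ 2 * (n / (Δ + 1)) * Nat.size n :=
      h1.trans (mul_le_mul_of_nonneg_right (by linarith) (by positivity))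
    rw [← hnX, ← mul_div_assoc, le_div_iff₀ hXpos]
    have h5 : X * (Δ + 1) ≤ 2 * Nat.size n * n := by
      calc X * (Δ + 1) ≤ 2 * (n / (Δ + 1)) * Nat.size n * (Δ + 1) := by gcongr
        _ = _ := by field_simp
    nlinarith
  obtain ⟨W, hW1, hW2⟩ := exists_small_side hadj b
  have h := length_vertexPieces_le_card hS hH hK1 hKM hW2
  have h1 : ((vertexPieces key G H K (n / K ^ 5) b).length : ℝ) ≤
      3 + 2 * ((Δ : ℝ) + (n / K : ℕ)) := by
    have : (vertexPieces key G H K (n / K ^ 5) b).length ≤ 3 + 2 * (Δ + n / K) := by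
      have := hW1
      omega
    exact_mod_cast this
  have h2 : ((n / K : ℕ) : ℝ) ≤ (n : ℝ) ^ (1 - e / 5) := by
    refine Nat.cast_div_le.trans ?_
    rw [← hnX]
    gcongr
  have h3 := hL.three_le
  have h4 := hL.pow_le
  have h5 := hL.size_mul_pow_le
  linarith

-- The main case. Half a turn contains `H / g` classes, at most `lossFactor e / 2` units; the
-- rounding terms, the mean excess and the deviation `n ^ (2 / 3)` contribute at most `e` units
-- each.
set_option maxHeartbeats 800000 in
theorem coins_dense_le [NeZero n] (hL : LargeEnough e δ n) (hδ : DegreeBound G δ)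
    (hadj : IsAdjacencyList G adj)
    (hK : (WordRAM.pieceBound n ((adjacencyInput adj).mem 0) : ℝ) ^ 5 ≤ (n : ℝ) ^ e) {H : ℕ}
    (hH : 2 ^ Nat.size n = 2 * H) :
    WordRAM.coins.real {ω | ∃ b, (lossFactor e / 2 + 3 * e) * loadUnit δ n <
      (vertexPieces (fun v => (WordRAM.randomKeys n (Nat.size n) ω v : ℕ)) G H
        (WordRAM.pieceBound n ((adjacencyInput adj).mem 0))
        (n / WordRAM.pieceBound n ((adjacencyInput adj).mem 0) ^ 5) b).length} ≤ e := by
  have hn := hL.n_pos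
  have hn16 := hL.le_n
  have he := hL.e_pos
  have he1 := hL.e_le
  have hk := hL.size_pos
  have hδ0 := hL.δ_pos
  have hU := hL.unit_pos
  have hl := hL.loss_pos
  have hKsize := hL.ceil_size_le_pieceBound hδ hadj
  set K := WordRAM.pieceBound n ((adjacencyInput adj).mem 0) with hKd
  have hK1 : 1 ≤ K := WordRAM.one_le_lengthBound _ _
  have hδk := hL.le_δ_size
  have hnk := hL.n_div_size
  have hek := hL.le_size
  have hexp := hL.exp_le
  set k := classSize e δ n with hkd
  set U := loadUnit δ n with hUd
  set A := lossFactor e with hA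
  have hSn : (n : ℝ) ≤ 2 ^ Nat.size n := by exact_mod_cast (Nat.lt_size_self n).le
  have hS0 : (0 : ℝ) < 2 ^ Nat.size n := by positivity
  -- The width for which a class of keys has at most `k` vertices on average. The quotient is at
  -- least `(1 + e) / e`, so rounding down costs a factor of at most `1 + e`.
  set g := ⌊k * 2 ^ Nat.size n / n⌋₊ with hg
  have hkS : (1 + e) / e ≤ k * 2 ^ Nat.size n / n := by
    refine hek.trans ?_
    rw [le_div_iff₀ hn]
    gcongr
  have hg1 : (g : ℝ) ≤ k * 2 ^ Nat.size n / n := Nat.floor_le (by positivity)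
  have hg2 : k * 2 ^ Nat.size n / n ≤ (1 + e) * g := by
    have h1 := Nat.lt_floor_add_one (k * 2 ^ Nat.size n / n)
    rw [← hg] at h1
    rw [div_le_iff₀ he] at hkS
    nlinarith
  have hgpos : (0 : ℝ) < g := by
    have : 0 < k * 2 ^ Nat.size n / n := by positivity
    by_contra! h
    nlinarith
  have hg3 : 1 ≤ g := by exact_mod_cast hgpos
  have hgq : (g : ℝ) / 2 ^ Nat.size n ≤ k / n := by
    rw [div_le_div_iff₀ hS0 hn]
    rwa [le_div_iff₀ hn] at hg1
  have hSg : (2 : ℝ) ^ Nat.size n / g ≤ A * U := by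
    rw [← hnk, div_le_iff₀ hgpos]
    rw [div_le_iff₀ hn] at hg2
    calc (2 : ℝ) ^ Nat.size n = (k * 2 ^ Nat.size n) / k := by field_simp
      _ ≤ ((1 + e) * g * n) / k := by gcongr
      _ = _ := by ring
  have hmax := maxMinDegree_le hadj (by omega) hδ
  have hmain := coins_length_vertexPieces_le (G := G) (K := K) (M := n / K ^ 5)
    (r := Nat.size n) (H := H) (g := g) (t := ⌈(1 + e) * (δ * k)⌉₊) (K₀ := ⌈(1 + e) * k⌉₊)
    (ε := e) (Δ := δ * n) (μ₁ := δ * k) (μ₂ := k) (ρ := (n : ℝ) ^ (2 / 3 : ℝ)) hH hg3 hKsize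
    (fun l j h1 h2 => hL.choose_le hK (by omega) h1 h2) he (by linarith) (fun b => by
      obtain ⟨W, hW1, hW2⟩ := exists_small_side hadj b
      refine ⟨W, ?_, hW2⟩
      have h1 : (W.card : ℝ) ≤ WordRAM.maxMinDegree n ((adjacencyInput adj).mem 0) := by
        exact_mod_cast hW1
      nlinarith)
    (by
      calc (g : ℝ) / 2 ^ Nat.size n * (δ * n) ≤ k / n * (δ * n) := by gcongr
        _ = δ * k := by field_simp)
    (Nat.le_ceil _) (by
      refine le_trans ?_ (Nat.le_ceil _)
      have : 0 < e * (δ * k) := by positivity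
      linarith)
    (by
      calc (g : ℝ) / 2 ^ Nat.size n * n ≤ k / n * n := by gcongr
        _ = k := by field_simp)
    (Nat.le_ceil _) (by
      refine le_trans ?_ (Nat.le_ceil _)
      have h1 : δ * k ≤ k := hL.δ_mul_size_le
      have : 0 < e * k := by positivity
      linarith)
    (by positivity)
  refine (measureReal_mono ?_).trans (hmain.trans hL.fail_le)
  rintro ω ⟨b, hb⟩
  refine ⟨b, lt_of_le_of_lt ?_ hb⟩
  have h1 : ((H / g : ℕ) : ℝ) ≤ A * U / 2 := by
    refine Nat.cast_div_le.trans ?_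
    have h2 : (2 : ℝ) ^ Nat.size n = 2 * H := by exact_mod_cast hH
    rw [h2, mul_div_assoc] at hSg
    linarith
  have h2 : ((2 ^ Nat.size n / g + 1 : ℕ) : ℝ) ≤ (A + 1) * U := by
    have h3 : ((2 ^ Nat.size n / g : ℕ) : ℝ) ≤ (2 : ℝ) ^ Nat.size n / g := by
      have := Nat.cast_div_le (m := 2 ^ Nat.size n) (n := g) (α := ℝ)
      push_cast at this
      exact this
    have h4 : 1 ≤ U := hL.one_le_unit
    push_cast
    linarith
  have h3 : Real.exp (-(e ^ 2 * k / 4)) ≤ e / (4 * (A + 1)) := by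
    refine le_trans (Real.exp_le_exp.2 ?_) hexp
    have h1 : δ * k ≤ k := hL.δ_mul_size_le
    have : e ^ 2 * (δ * k) ≤ e ^ 2 * k := by gcongr
    linarith
  have hNB0 : (0 : ℝ) ≤ ((2 ^ Nat.size n / g + 1 : ℕ) : ℝ) := Nat.cast_nonneg _
  clear hmain
  generalize ((2 ^ Nat.size n / g + 1 : ℕ) : ℝ) = NB at *
  generalize Real.exp (-(e ^ 2 * k / 4)) = E₂ at *
  generalize Real.exp (-(e ^ 2 * (δ * k) / 4)) = E₁ at *
  have h4 : NB * (E₁ + E₂) ≤ e * U / 2 := by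
    have hE : E₁ + E₂ ≤ e / (2 * (A + 1)) :=
      (add_le_add hexp h3).trans_eq (by field_simp; ring)
    have hAU : (A + 1) * U * (e / (2 * (A + 1))) = e * U / 2 := by field_simp
    have hE0 : 0 ≤ e / (2 * (A + 1)) := by positivity
    have hNB : NB * (E₁ + E₂) ≤ NB * (e / (2 * (A + 1))) := mul_le_mul_of_nonneg_left hE hNB0
    exact hNB.trans ((mul_le_mul_of_nonneg_right h2 hE0).trans_eq hAU)
  have h5 := hL.three_le
  have h6 := hL.pow_two_thirds_le
  linarith

/-- With high probability, all loads are small. -/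
theorem coins_load_le [NeZero n] (hL : LargeEnough e δ n) (hδ : DegreeBound G δ)
    (hadj : IsAdjacencyList G adj) :
    WordRAM.coins.real {ω | ∃ b, (lossFactor e / 2 + 4 * e) * loadUnit δ n <
      ((WordRAM.pieceBound n ((adjacencyInput adj).mem 0) ^ 3 *
        (n / WordRAM.pieceBound n ((adjacencyInput adj).mem 0) ^ 5) +
      (vertexPieces (fun v : Fin n => WordRAM.keyValue ω n ((adjacencyInput adj).mem 0) v) G
        (WordRAM.keyRange n ((adjacencyInput adj).mem 0))
        (WordRAM.pieceBound n ((adjacencyInput adj).mem 0))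
        (n / WordRAM.pieceBound n ((adjacencyInput adj).mem 0) ^ 5) b).length : ℕ) : ℝ)} ≤ e := by
  have he := hL.e_pos
  have hU := hL.unit_pos
  have hl := hL.loss_pos
  have heU : 0 < e * loadUnit δ n := by positivity
  have hlU : 0 < lossFactor e * loadUnit δ n := by positivity
  have hn16 := hL.le_n
  have hA := hL.pow_three_mul_le (hL.ceil_size_le_pieceBound hδ hadj)
  by_cases hs : (adjacencyInput adj).mem 0 n < n * Nat.size n
  · refine le_trans (le_of_eq ?_) he.le
    convert measureReal_empty
    rw [Set.eq_empty_iff_forall_notMem]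
    rintro ω ⟨b, hb⟩
    have := hL.length_le_of_sparse hadj hs ω (WordRAM.pieceBound n ((adjacencyInput adj).mem 0))
      (n / WordRAM.pieceBound n ((adjacencyInput adj).mem 0) ^ 5) b
    rw [Nat.cast_add] at hb
    linarith
  · have hkey : ∀ ω, (fun v : Fin n => WordRAM.keyValue ω n ((adjacencyInput adj).mem 0) v) =
        fun v => (WordRAM.randomKeys n (Nat.size n) ω v : ℕ) := by
      intro ω
      ext v
      rw [WordRAM.keyValue, if_neg hs]
      rfl
    have hH : 2 ^ Nat.size n = 2 * (2 ^ Nat.size n / 2) := by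
      obtain ⟨j, hj⟩ : ∃ j, Nat.size n = j + 1 :=
        ⟨Nat.size n - 1, by have := Nat.size_pos.2 (show 0 < n by omega); omega⟩
      rw [hj, pow_succ]
      omega
    simp only [hkey, WordRAM.keyRange, if_neg hs]
    -- The estimate of binomial coefficients needs `K ^ 5 ≤ n ^ e`; in the opposite case the bound
    -- is deterministic and the bad event is empty.
    rcases le_or_gt ((WordRAM.pieceBound n ((adjacencyInput adj).mem 0) : ℝ) ^ 5) ((n : ℝ) ^ e)
      with hK | hK
    · refine le_trans (measureReal_mono ?_) (hL.coins_dense_le hδ hadj hK hH)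
      rintro ω ⟨b, hb⟩
      refine ⟨b, ?_⟩
      rw [Nat.cast_add] at hb
      linarith
    · refine le_trans (le_of_eq ?_) he.le
      convert measureReal_empty
      rw [Set.eq_empty_iff_forall_notMem]
      rintro ω ⟨b, hb⟩
      have := hL.length_le_of_large_pieceBound hadj hK
        (fun v => (WordRAM.randomKeys n (Nat.size n) ω v).2) hH b
      rw [Nat.cast_add] at hb
      linarith

end LargeEnough

/-! ### The conditions on `n` hold eventually; diagonalisation over the precision. -/

section Asymptotics

theorem eventually_mul_logb_add_one_le (c : ℝ) {η : ℝ} (hη : 0 < η) :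
    ∀ᶠ n : ℕ in atTop, c * (Real.logb 2 n + 1) ≤ (n : ℝ) ^ η := by
  have h1 : (fun n : ℕ => c * (Real.logb 2 n + 1)) =o[atTop] fun n : ℕ => (n : ℝ) ^ η := by
    have h2 : (fun x : ℝ => Real.logb 2 x + 1) =o[atTop] fun x : ℝ => x ^ η := by
      refine Asymptotics.IsLittleO.add ?_ ?_
      · have := (isLittleO_log_rpow_atTop hη).const_mul_left (Real.log 2)⁻¹
        refine this.congr_left fun x => ?_
        rw [Real.logb]
        ring
      · exact Asymptotics.isLittleO_const_left.2 (Or.inr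
          (tendsto_norm_atTop_atTop.comp (tendsto_rpow_atTop hη)))
    exact (h2.comp_tendsto tendsto_natCast_atTop_atTop).const_mul_left c
  filter_upwards [h1.bound one_pos] with n hn
  rw [one_mul, Real.norm_eq_abs, Real.norm_eq_abs, abs_of_nonneg (a := (n : ℝ) ^ η) (by positivity)]
    at hn
  exact (le_abs_self _).trans hn

theorem size_le_logb_add_one {n : ℕ} (hn : 1 ≤ n) : (Nat.size n : ℝ) ≤ Real.logb 2 n + 1 := by
  obtain ⟨k, hk⟩ : ∃ k, Nat.size n = k + 1 :=
    ⟨Nat.size n - 1, by have := Nat.size_pos.2 (show 0 < n by omega); omega⟩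
  have h1 : 2 ^ k ≤ n := Nat.lt_size.1 (by omega)
  have h2 : (k : ℝ) ≤ Real.logb 2 n := by
    rw [Real.le_logb_iff_rpow_le (by norm_num) (by exact_mod_cast hn), Real.rpow_natCast]
    exact_mod_cast h1
  rw [hk]
  push_cast
  linarith

variable {δ : ℕ → ℝ}

theorem InvSubpolynomial.eventually_rpow_le (h : InvSubpolynomial δ) {η : ℝ} (hη : 0 < η) :
    ∀ᶠ n : ℕ in atTop, (n : ℝ) ^ (-η) ≤ δ n := by
  obtain ⟨e, he, h⟩ := h
  filter_upwards [h, he.eventually_lt_const hη, eventually_ge_atTop 1] with n h1 h2 h3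
  have hn : (1 : ℝ) ≤ n := by exact_mod_cast h3
  rw [← inv_inv (δ n), h1, ← Real.rpow_neg (by linarith)]
  exact Real.rpow_le_rpow_of_exponent_le hn (by linarith)

theorem InvSubpolynomial.eventually_pos (h : InvSubpolynomial δ) : ∀ᶠ n : ℕ in atTop, 0 < δ n := by
  filter_upwards [h.eventually_rpow_le one_pos, eventually_ge_atTop 1] with n h1 h2
  have hn : (0 : ℝ) < n := by exact_mod_cast h2
  exact (Real.rpow_pos_of_pos hn _).trans_le h1

/-- `h₂(δ) ≤ δ * (lg (1 / δ) + 2)` and `lg (1 / δ) = o(lg n)`. This is the point at which the growth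
condition on `1 / δ` is essential: it makes the expected number of exceptional vertices in a class
tend to infinity. -/
theorem InvSubpolynomial.eventually_mul_entropy_le (h : InvSubpolynomial δ)
    (hδ : ∀ n, δ n ∈ Set.Icc (0 : ℝ) (1 / 2)) {c : ℝ} (hc : 0 < c) :
    ∀ᶠ n : ℕ in atTop, c * binEntropyTwo (δ n) ≤ δ n * Real.logb 2 n := by
  have hpos := h.eventually_pos
  obtain ⟨e, he, h⟩ := h
  have hL : Tendsto (fun n : ℕ => Real.logb 2 n) atTop atTop :=
    (Real.tendsto_logb_atTop (by norm_num)).comp tendsto_natCast_atTop_atTop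
  filter_upwards [h, he.eventually_lt_const (show 0 < 1 / (2 * c) by positivity),
    eventually_ge_atTop 1, hpos, hL.eventually_ge_atTop (4 * c)] with n h1 h2 h3 h4 h5
  have hn : (0 : ℝ) < n := by exact_mod_cast h3
  have h6 := binEntropyTwo_le h4 (hδ n).2
  rw [h1, Real.logb_rpow_eq_mul_logb_of_pos hn] at h6
  calc c * binEntropyTwo (δ n) ≤ c * (δ n * (e n * Real.logb 2 n + 2)) := by gcongr
    _ = δ n * (c * e n * Real.logb 2 n + 2 * c) := by ring
    _ ≤ δ n * (1 / 2 * Real.logb 2 n + 1 / 2 * Real.logb 2 n) := by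
        rw [lt_div_iff₀ (by positivity)] at h2
        exact mul_le_mul_of_nonneg_left (add_le_add
          (mul_le_mul_of_nonneg_right (by linarith) (by linarith)) (by linarith)) h4.le
    _ = _ := by ring

/-- Both `h₂(δ) ≥ 2 * δ` and `1 / lg n` are at least `n ^ (-η / 2)` up to constants, so every error
term that is a smaller power of `n` is negligible. -/
theorem InvSubpolynomial.eventually_rpow_le_loadUnit (h : InvSubpolynomial δ)
    (hδ : ∀ n, δ n ∈ Set.Icc (0 : ℝ) (1 / 2)) {c η : ℝ} (hc : 0 < c) (hη : 0 < η) :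
    ∀ᶠ n : ℕ in atTop, (n : ℝ) ^ (1 - η) ≤ c * loadUnit (δ n) n := by
  filter_upwards [h.eventually_rpow_le (half_pos hη),
    eventually_mul_logb_add_one_le c⁻¹ (half_pos hη), eventually_ge_atTop 2] with n h1 h2 h3
  have hn : (0 : ℝ) < n := by exact_mod_cast (show 0 < n by omega)
  have hlog : 0 < Real.logb 2 n :=
    Real.logb_pos (by norm_num) (by exact_mod_cast (show 1 < n by omega))
  have h4 := two_mul_le_binEntropyTwo (hδ n).1 (hδ n).2
  have h5 : Real.logb 2 n ≤ c * (n : ℝ) ^ (η / 2) := by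
    rw [inv_mul_le_iff₀ hc] at h2
    linarith
  have h6 : (n : ℝ) ^ (-(η / 2)) ≤ binEntropyTwo (δ n) := by
    have := (hδ n).1
    linarith
  rw [loadUnit, ← mul_div_assoc, ← mul_div_assoc, le_div_iff₀ hlog]
  calc (n : ℝ) ^ (1 - η) * Real.logb 2 n ≤ (n : ℝ) ^ (1 - η) * (c * (n : ℝ) ^ (η / 2)) := by gcongr
    _ = c * ((n : ℝ) ^ (1 - η + η / 2)) := by rw [Real.rpow_add hn]; ring
    _ = c * ((n : ℝ) ^ (-(η / 2)) * n) := by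
        conv_rhs => rw [← Real.rpow_add_one hn.ne']
        congr 2
        ring
    _ ≤ _ := by gcongr

theorem InvSubpolynomial.eventually_le_mul_classSize (h : InvSubpolynomial δ)
    (hδ : ∀ n, δ n ∈ Set.Icc (0 : ℝ) (1 / 2)) {e : ℝ} (he : 0 < e) (he1 : e ≤ 1 / 2) {C : ℝ}
    (hC : 0 < C) :
    ∀ᶠ n : ℕ in atTop, C ≤ δ n * classSize e (δ n) n ∧ C ≤ classSize e (δ n) n := by
  have he2 : 0 < 1 - e := by linarith
  filter_upwards [h.eventually_mul_entropy_le hδ (c := C * (1 + e) ^ 3 / (1 - e)) (by positivity),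
    h.eventually_pos] with n h1 h2
  have h3 := two_mul_le_binEntropyTwo (hδ n).1 (hδ n).2
  have h4 : 0 < binEntropyTwo (δ n) := by linarith
  have h5 : C ≤ δ n * classSize e (δ n) n := by
    rw [classSize, ← mul_div_assoc, le_div_iff₀ (by positivity)]
    calc C * (binEntropyTwo (δ n) * (1 + e) ^ 3)
        = (1 - e) * (C * (1 + e) ^ 3 / (1 - e) * binEntropyTwo (δ n)) := by field_simp
      _ ≤ (1 - e) * (δ n * Real.logb 2 n) := by gcongr
      _ = _ := by ring
  refine ⟨h5, ?_⟩
  have h6 := (hδ n).2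
  have h7 : 0 < classSize e (δ n) n := by
    by_contra! h
    nlinarith
  nlinarith

/-- With `y = n ^ (1 / 3) / 8` the expression equals `512 * y ^ 3 * exp (-y)`. -/
theorem eventually_mul_exp_le {e : ℝ} (he : 0 < e) : ∀ᶠ n : ℕ in atTop,
    n * Real.exp (-(((n : ℝ) ^ (2 / 3 : ℝ)) ^ 2 / (8 * n))) ≤ e := by
  have h1 : Tendsto (fun n : ℕ => (n : ℝ) ^ (1 / 3 : ℝ) / 8) atTop atTop :=
    ((tendsto_rpow_atTop (by norm_num)).comp tendsto_natCast_atTop_atTop).atTop_div_const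
      (by norm_num)
  have h2 := (Real.tendsto_pow_mul_exp_neg_atTop_nhds_zero 3).comp h1
  filter_upwards [h2.eventually_le_const (show 0 < e / 512 by positivity),
    eventually_ge_atTop 1] with n h3 h4
  have hn : (0 : ℝ) < n := by exact_mod_cast h4
  have e1 : ((n : ℝ) ^ (2 / 3 : ℝ)) ^ 2 / (8 * n) = (n : ℝ) ^ (1 / 3 : ℝ) / 8 := by
    rw [div_eq_div_iff (by positivity) (by norm_num), ← Real.rpow_natCast, ← Real.rpow_mul hn.le]
    have : (n : ℝ) ^ (2 / 3 * ((2 : ℕ) : ℝ)) = (n : ℝ) ^ (1 / 3 : ℝ) * n := by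
      rw [← Real.rpow_add_one hn.ne']
      norm_num
    rw [this]
    ring
  have e2 : ((n : ℝ) ^ (1 / 3 : ℝ)) ^ 3 = n := by
    rw [← Real.rpow_natCast, ← Real.rpow_mul hn.le]
    norm_num
  simp only [Function.comp_apply] at h3
  rw [div_pow, e2] at h3
  rw [e1]
  linarith

theorem InvSubpolynomial.eventually_largeEnough (h : InvSubpolynomial δ)
    (hδ : ∀ n, δ n ∈ Set.Icc (0 : ℝ) (1 / 2)) {e : ℝ} (he : 0 < e) (he1 : e ≤ 1 / 2) :
    ∀ᶠ n : ℕ in atTop, LargeEnough e (δ n) n := by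
  have hl : 0 < lossFactor e := by
    have : 0 < 1 - e := by linarith
    unfold lossFactor
    positivity
  set E := e / (4 * (lossFactor e + 1)) with hE
  have hE0 : 0 < E := by positivity
  have hE1 : E < 1 := by
    rw [hE, div_lt_one (by positivity)]
    linarith
  have hlE : 0 < 4 * -Real.log E / e ^ 2 := by
    have := Real.log_neg hE0 hE1
    have : 0 < -Real.log E := by linarith
    positivity
  filter_upwards [eventually_ge_atTop 16, h.eventually_pos,
    h.eventually_le_mul_classSize hδ he he1 (C := (1 + e) / e) (by positivity),
    h.eventually_le_mul_classSize hδ he he1 (C := (lossFactor e + 1) / e) (by positivity),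
    h.eventually_le_mul_classSize hδ he he1 (C := 2 / e) (by positivity),
    h.eventually_le_mul_classSize hδ he he1 hlE,
    h.eventually_rpow_le one_pos,
    h.eventually_rpow_le_loadUnit hδ (c := e / 3) (η := 1) (by positivity) one_pos,
    h.eventually_rpow_le_loadUnit hδ (c := e / 2) (η := 1 / 3) (by positivity) (by norm_num),
    h.eventually_rpow_le_loadUnit hδ (c := e) (η := 1 / 4) (by positivity) (by norm_num),
    h.eventually_rpow_le_loadUnit hδ (c := e / 4) (η := e / 5) (by positivity) (by positivity),
    h.eventually_rpow_le_loadUnit hδ (c := e / 4) (η := e / 10) (by positivity) (by positivity),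
    eventually_mul_logb_add_one_le 2 (η := e / 10) (by positivity),
    eventually_mul_logb_add_one_le 1 (η := 1 / 2) (by norm_num),
    eventually_mul_logb_add_one_le 1 (η := 1 / 16) (by norm_num),
    h.eventually_rpow_le (η := 1 / 16) (by norm_num),
    eventually_mul_exp_le he] with n h1 h2 h3 h4 h5 h6 h7 h8 h9 h10 h11 h12 h13 h14 h15 h16 h17
  have hn : (0 : ℝ) < n := by exact_mod_cast (show 0 < n by omega)
  have hn1 : (1 : ℝ) < n := by exact_mod_cast (show 1 < n by omega)
  have hlog : 0 < Real.logb 2 n := Real.logb_pos (by norm_num) hn1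
  have hsz := size_le_logb_add_one (show 1 ≤ n by omega)
  constructor
  · exact he
  · exact he1
  · exact h1
  · exact h2
  · exact (hδ n).2
  · exact h3.2
  · exact h4.2
  · exact h5.1
  · rw [← hE, ← Real.exp_log hE0, Real.exp_le_exp]
    have := h6.1
    rw [div_le_iff₀ (by positivity)] at this
    linarith
  · rw [Real.rpow_neg_one, inv_le_iff_one_le_mul₀ hn] at h7
    exact h7
  · rw [sub_self, Real.rpow_zero] at h8
    linarith
  · rw [show (1 - 1 / 3 : ℝ) = 2 / 3 by norm_num] at h9
    linarith
  · rw [show (1 - 1 / 4 : ℝ) = 3 / 4 by norm_num] at h10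
    exact h10
  · linarith
  · calc 2 * Nat.size n * (n : ℝ) ^ (1 - e / 5)
        ≤ (n : ℝ) ^ (e / 10) * (n : ℝ) ^ (1 - e / 5) := by
          gcongr
          linarith
      _ = (n : ℝ) ^ (1 - e / 10) := by
          rw [← Real.rpow_add hn]
          congr 1
          ring
      _ ≤ _ := by linarith
  · linarith
  · have h18 : (1 : ℝ) ≤ (n : ℝ) ^ (1 / 16 : ℝ) := Real.one_le_rpow hn1.le (by norm_num)
    have h19 : (δ n)⁻¹ ≤ (n : ℝ) ^ (1 / 16 : ℝ) := by
      rw [Real.rpow_neg hn.le] at h16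
      exact inv_le_of_inv_le₀ (by positivity) h16
    calc Real.logb 2 n / (2 * δ n) + 1 = Real.logb 2 n / 2 * (δ n)⁻¹ + 1 := by
          field_simp
      _ ≤ Real.logb 2 n * (n : ℝ) ^ (1 / 16 : ℝ) + 1 * (n : ℝ) ^ (1 / 16 : ℝ) := by
          gcongr
          · linarith
          · linarith
      _ = 1 * (Real.logb 2 n + 1) * (n : ℝ) ^ (1 / 16 : ℝ) := by ring
      _ ≤ (n : ℝ) ^ (1 / 16 : ℝ) * (n : ℝ) ^ (1 / 16 : ℝ) := by gcongr
      _ = _ := by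
          rw [← Real.rpow_add hn]
          norm_num
  · exact Real.one_lt_rpow hn1 (by positivity)
  · exact h17

/-- If a property holds eventually for each positive precision, then it holds eventually for
precisions that tend to zero. -/
theorem exists_tendsto_zero_of_forall_eventually {Q : ℝ → ℕ → Prop}
    (h : ∀ k : ℕ, ∀ᶠ n in atTop, Q (1 / (k + 1)) n) :
    ∃ e : ℕ → ℝ, Tendsto e atTop (𝓝 0) ∧ ∀ᶠ n in atTop, Q (e n) n := by
  choose N hN using fun k => eventually_atTop.1 (h k)
  classical
  -- The best index `k ≤ n` such that the thresholds of all precisions up to `k` have been passed at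
  -- `n`.
  set κ : ℕ → ℕ := fun n => Nat.findGreatest (fun k => ∀ j ≤ k, N j ≤ n) n with hκ
  have hκt : Tendsto κ atTop atTop := by
    rw [tendsto_atTop]
    intro b
    filter_upwards [eventually_ge_atTop (max b ((Finset.range (b + 1)).sup N))] with n hn
    apply Nat.le_findGreatest ((le_max_left _ _).trans hn)
    intro j hj
    exact (Finset.le_sup (Finset.mem_range.2 (Nat.lt_succ_of_le hj))).trans
      ((le_max_right _ _).trans hn)
  refine ⟨fun n => 1 / ((κ n : ℝ) + 1), ?_, ?_⟩
  · exact tendsto_one_div_add_atTop_nhds_zero_nat.comp hκt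
  · filter_upwards [eventually_ge_atTop (N 0)] with n hn
    have : ∀ j ≤ κ n, N j ≤ n := Nat.findGreatest_spec (P := fun k => ∀ j ≤ k, N j ≤ n)
      (Nat.zero_le n) (by intro j hj; rw [Nat.le_zero.1 hj]; exact hn)
    exact hN _ n (this _ le_rfl)

end Asymptotics

/-! ### Assembly of the theorem. -/

theorem exists_lossFactor_le {ε : ℝ} (hε : 0 < ε) :
    ∃ e : ℝ, 0 < e ∧ e ≤ 1 / 2 ∧ e ≤ ε ∧ lossFactor e / 2 + 4 * e ≤ 1 / 2 + ε := by
  -- At `e = 0` the loss factor is `1`, so the leading constant is `1/2` there, and continuity gives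
  -- the rest.
  have h1 : ContinuousAt (fun e : ℝ => lossFactor e / 2 + 4 * e) 0 := by
    unfold lossFactor
    refine ContinuousAt.add (ContinuousAt.div_const (ContinuousAt.div (by fun_prop) (by fun_prop)
      (by norm_num)) _) (by fun_prop)
  have h2 : ∀ᶠ e : ℝ in 𝓝 0, lossFactor e / 2 + 4 * e < 1 / 2 + ε :=
    h1.eventually_lt_const (by norm_num [lossFactor]; exact hε)
  have h3 : ∀ᶠ e : ℝ in 𝓝[>] 0, lossFactor e / 2 + 4 * e < 1 / 2 + ε := h2.filter_mono inf_le_left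
  have h4 : ∀ᶠ e : ℝ in 𝓝[>] 0, e ∈ Set.Ioo (0 : ℝ) (min (1 / 2) ε) :=
    Ioo_mem_nhdsGT (by positivity)
  obtain ⟨e, h5, h6⟩ := (h3.and h4).exists
  exact ⟨e, h6.1, h6.2.le.trans (min_le_left _ _), h6.2.le.trans (min_le_right _ _), h5.le⟩

/-- On inputs for `G`, the program `P` outputs within `T * (n + m)` steps a biclique partition with
loads at most `B`, except with probability `ε`. -/
def Succeeds (P : WordRAM.Prog) (κ T : ℕ) {n : ℕ} (G : SimpleGraph (Fin n))
    (adj : Fin n → List (Fin n)) (B ε : ℝ) : Prop :=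
  1 - ε ≤ WordRAM.coins.real
    {ω | ∃ (t : ℕ) (s : WordRAM.State),
      WordRAM.Exec (WordRAM.wordLength κ n) ω P (adjacencyInput adj) t s ∧
      t ≤ T * (n + G.edgeSet.ncard) ∧
      ∃ C : List (Finset (Fin n) × Finset (Fin n)),
        Describes s.out C ∧ IsBicliquePartition G C ∧ ∀ v, (bicliqueLoad C v : ℝ) ≤ B}

theorem IsGrouping.describes_bicliqueCode {n : ℕ} [NeZero n] {key : Fin n → ℕ}
    {G : SimpleGraph (Fin n)} {H K M : ℕ} {Q : List (List (Fin n) × List (Fin n))}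
    (hQ : IsGrouping key G H K M Q) :
    Describes (bicliqueCode Q) (Q.map fun B => (B.1.toFinset, B.2.toFinset)) := by
  refine ⟨Q, fun B hB => ⟨?_, hQ.nodup B hB⟩, rfl, rfl⟩
  obtain ⟨b, hb⟩ := List.exists_mem_of_ne_nil _ (hQ.ne_nil B hB)
  exact nodup_of_mem_vertexPieces ((hQ.mem_iff B hB b).1 hb)

/-- Every run yields a correct partition in time, so failure can only be due to the event that some
load is too large. -/
theorem LargeEnough.succeeds {e δ : ℝ} {n : ℕ} (hL : LargeEnough e δ n) {G : SimpleGraph (Fin n)}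
    (hδ : DegreeBound G δ) {adj : Fin n → List (Fin n)} (hadj : IsAdjacencyList G adj) :
    Succeeds WordRAM.bicliqueProg 4 10000 G adj ((lossFactor e / 2 + 4 * e) * loadUnit δ n) e := by
  have hn := hL.le_n
  have : NeZero n := ⟨by omega⟩
  have hw : n ^ 4 < 2 ^ WordRAM.wordLength 4 n := by
    rw [WordRAM.wordLength, mul_comm, pow_mul]
    exact Nat.pow_lt_pow_left (Nat.lt_size_self n) (by norm_num)
  have hbad := hL.coins_load_le hδ hadj
  have hK1 : 1 ≤ WordRAM.pieceBound n ((adjacencyInput adj).mem 0) :=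
    WordRAM.one_le_lengthBound _ _
  have hM1 : 1 ≤ n / WordRAM.pieceBound n ((adjacencyInput adj).mem 0) ^ 5 := by
    rw [Nat.one_le_div_iff (by positivity)]
    exact (Nat.pow_le_pow_right hK1 (by norm_num)).trans
      (WordRAM.lengthBound_pow_le (by omega) _)
  unfold Succeeds
  -- The good and the bad event cover the whole space; subadditivity suffices, and no measurability
  -- is required.
  refine (sub_le_sub_left hbad 1).trans (sub_le_iff_le_add.2 (le_trans ?_
    (measureReal_union_le _ _)))
  rw [← probReal_univ (μ := WordRAM.coins)]
  refine measureReal_mono ?_ (measure_ne_top _ _)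
  intro ω _
  by_contra! hω
  simp only [Set.mem_union, not_or] at hω
  refine hω.1 ?_
  obtain ⟨t, s, hex, ht, Q, hQ, hs⟩ := WordRAM.runs_bicliqueProg (ω := ω) hn hw hadj
  refine ⟨t, s, hex, ht, _, hs ▸ hQ.describes_bicliqueCode, hQ.isBicliquePartition, fun v => ?_⟩
  have h1 := hω.2
  simp only [Set.mem_ofPred_eq, not_exists, not_lt] at h1
  exact le_trans (by exact_mod_cast hQ.bicliqueLoad_le hK1 hM1 v) (h1 v)

theorem Succeeds.mono {P : WordRAM.Prog} {κ T n : ℕ} {G : SimpleGraph (Fin n)}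
    {adj : Fin n → List (Fin n)} {B B' ε ε' : ℝ} (h : Succeeds P κ T G adj B ε) (hB : B ≤ B')
    (hε : ε ≤ ε') : Succeeds P κ T G adj B' ε' := by
  refine (sub_le_sub_left hε 1).trans (h.trans (measureReal_mono ?_))
  rintro ω ⟨t, s, hex, ht, C, h1, h2, h3⟩
  exact ⟨t, s, hex, ht, C, h1, h2, fun v => (h3 v).trans hB⟩

theorem InvSubpolynomial.exists_succeeds {δ : ℕ → ℝ} (h : InvSubpolynomial δ)
    (hδ : ∀ n, δ n ∈ Set.Icc (0 : ℝ) (1 / 2)) :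
    ∃ ε : ℕ → ℝ, Tendsto ε atTop (𝓝 0) ∧ ∀ᶠ n : ℕ in atTop,
      ∀ G : SimpleGraph (Fin n), DegreeBound G (δ n) →
        ∀ adj : Fin n → List (Fin n), IsAdjacencyList G adj →
          Succeeds WordRAM.bicliqueProg 4 10000 G adj ((1 / 2 + ε n) * loadUnit (δ n) n) (ε n) := by
  refine exists_tendsto_zero_of_forall_eventually (Q := fun ε n =>
    ∀ G : SimpleGraph (Fin n), DegreeBound G (δ n) →
      ∀ adj : Fin n → List (Fin n), IsAdjacencyList G adj →
        Succeeds WordRAM.bicliqueProg 4 10000 G adj ((1 / 2 + ε) * loadUnit (δ n) n) ε) fun k => ?_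
  obtain ⟨e, he, he1, he2, he3⟩ := exists_lossFactor_le (ε := 1 / ((k : ℝ) + 1)) (by positivity)
  filter_upwards [h.eventually_largeEnough hδ he he1] with n hL G hG adj hadj
  exact (hL.succeeds hG hadj).mono (mul_le_mul_of_nonneg_right he3 hL.unit_pos.le) he2

/-- An event of positive probability contains an outcome, and its output is a partition with the
required loads. -/
theorem Succeeds.lbp_le {P : WordRAM.Prog} {κ T n : ℕ} {G : SimpleGraph (Fin n)}
    {adj : Fin n → List (Fin n)} {B ε : ℝ} (h : Succeeds P κ T G adj B ε) (hε : ε < 1) :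
    lbp G ≤ ⌊B⌋₊ := by
  obtain ⟨ω, t, s, -, -, C, -, hC, hload⟩ := nonempty_of_measureReal_ne_zero
    ((sub_pos.2 hε).trans_le h).ne'
  exact Nat.sInf_le ⟨C, hC, fun v => Nat.le_floor (hload v)⟩

theorem exists_isAdjacencyList {n : ℕ} (G : SimpleGraph (Fin n)) :
    ∃ adj : Fin n → List (Fin n), IsAdjacencyList G adj := by
  classical
  exact ⟨fun v => (Finset.univ.filter (G.Adj v)).toList, fun v =>
    ⟨Finset.nodup_toList _, fun u => by simp⟩⟩

theorem mainTheorem4 :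
    (∀ δ : ℕ → ℝ, (∀ n, δ n ∈ Set.Icc (0 : ℝ) (1 / 2)) → InvSubpolynomial δ →
      ∃ err : ℕ → ℝ, Tendsto err atTop (𝓝 0) ∧
        ∀ᶠ n : ℕ in atTop,
          (lbpMax n (δ n) : ℝ) ≤
            (1 / 2 + err n) * binEntropyTwo (δ n) * ((n : ℝ) / Real.logb 2 n)) ∧
    (∃ (P : WordRAM.Prog) (κ T : ℕ), 2 ≤ κ ∧
      ∀ δ : ℕ → ℝ, (∀ n, δ n ∈ Set.Icc (0 : ℝ) (1 / 2)) → InvSubpolynomial δ →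
        ∃ err fail : ℕ → ℝ, Tendsto err atTop (𝓝 0) ∧ Tendsto fail atTop (𝓝 0) ∧
          ∀ᶠ n : ℕ in atTop, ∀ G : SimpleGraph (Fin n), DegreeBound G (δ n) →
            ∀ adj : Fin n → List (Fin n), IsAdjacencyList G adj →
              1 - fail n ≤ WordRAM.coins.real
                {ω | ∃ (t : ℕ) (s : WordRAM.State),
                  WordRAM.Exec (WordRAM.wordLength κ n) ω P (adjacencyInput adj) t s ∧
                  t ≤ T * (n + G.edgeSet.ncard) ∧
                  ∃ C : List (Finset (Fin n) × Finset (Fin n)),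
                    Describes s.out C ∧ IsBicliquePartition G C ∧
                    ∀ v, (bicliqueLoad C v : ℝ) ≤
                      (1 / 2 + err n) * binEntropyTwo (δ n) * ((n : ℝ) / Real.logb 2 n)}) := by
  have hu (x : ℝ) (n : ℕ) : binEntropyTwo x * ((n : ℝ) / Real.logb 2 n) = loadUnit x n := rfl
  simp only [mul_assoc, hu]
  classical
  constructor
  · intro δ hδ h
    obtain ⟨ε, hε, hs⟩ := h.exists_succeeds hδ
    refine ⟨ε, hε, ?_⟩
    filter_upwards [hs, hε.eventually_lt_const one_pos,
      hε.eventually_const_lt (show (-1 / 2 : ℝ) < 0 by norm_num),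
      -- The precision `1/2` is used only to obtain that the unit is positive.
      h.eventually_largeEnough hδ (e := 1 / 2) (by norm_num) le_rfl] with n h1 h2 h3 hL
    have h4 : 0 ≤ (1 / 2 + ε n) * loadUnit (δ n) n :=
      mul_nonneg (by linarith) hL.unit_pos.le
    refine le_trans (Nat.cast_le.2 (Finset.sup_le fun G hG => ?_)) (Nat.floor_le h4)
    obtain ⟨adj, hadj⟩ := exists_isAdjacencyList G
    exact (h1 G (Finset.mem_filter.1 hG).2 adj hadj).lbp_le h2
  · refine ⟨WordRAM.bicliqueProg, 4, 10000, by norm_num, fun δ hδ h => ?_⟩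
    obtain ⟨ε, hε, hs⟩ := h.exists_succeeds hδ
    exact ⟨ε, ε, hε, hε, hs⟩
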